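/- Let $G$ be a Lie group of real dimension $2n$ with Lie algebra $\mathfrak g$, equipped with a left-invariant complex structure $J$ and a left-invariant Riemannian metric $g=\langle\,,\rangle$ compatible with $J$. Assume that $G$ is nilpotent, i.e. that $\mathfrak g$ is nilpotent. Write $\mathfrak n=[\mathfrak g,\mathfrak g]$. Let $\nabla^s$ be the Strominger (Bismut) connection of $(G,J,g)$, that is, the unique connection with $\nabla^s g=0$, $\nabla^s J=0$ and totally skew-symmetric torsion, and let $R(X,Y)Z=\nabla^s_X\nabla^s_YZ-\nabla^s_Y\nabla^s_XZ-\nabla^s_{[X,Y]}Z$ be its curvature. Call $(G,J,g)$ Strominger Kähler-like if $R$ has the symmetries of the curvature of a Kähler metric: $R(X,Y)Z+R(Y,Z)X+R(Z,X)Y=0$ and $\langle R(X,Y)JZ,JW\rangle=\langle R(X,Y)Z,W\rangle$ for all $X,Y,Z,W$. (Equivalently, as $\nabla^s$ is Hermitian, the complex multilinear extension of $R(X,Y,Z,W)=\langle R(X,Y)Z,W\rangle$ satisfies $R(X,Y,Z,W)=R(Z,Y,X,W)$ whenever $X,Z$ are of type $(1,0)$.) Then $(G,J,g)$ is Strominger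 Kähler-like if and only if there are integers $0\le r,s\le n$, an orthonormal basis $X_1,\dots,X_s$ of $\mathfrak n$, an orthonormal basis $\varepsilon_1,\dots,\varepsilon_{2n}$ of $\mathfrak g$ with $J\varepsilon_i=\varepsilon_{n+i}$ for $1\le i\le n$ and $$\mathfrak n+J\mathfrak n=\mathrm{span}\{\varepsilon_{r+1},\dots,\varepsilon_n;\ \varepsilon_{n+r+1},\dots,\varepsilon_{2n}\},$$ and constants $\lambda_1,\dots,\lambda_s>0$, such that the only non-zero Lie brackets among the $\varepsilon$'s are, up to skew-symmetry, $$[\varepsilon_i,\varepsilon_{n+i}]=\lambda_iX_i,\qquad 1\le i\le s.$$ Moreover, whenever such data exist: $n-r\le s\le\min\{r,2(n-r)\}$; $\mathfrak g$ is at most $2$-step nilpotent, i.e. $[\mathfrak g,[\mathfrak g,\mathfrak g]]=0$; $J$ is abelian, i.e. $[Jx,Jy]=[x,y]$ for all $x,y\in\mathfrak g$; and $g$ is Kähler (its form $\omega(X,Y)=\langle JX,Y\rangle$ is closed) if and only if $s=0$ and $r=n$. -/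

import Mathlib

open Bundle VectorField
open scoped Manifold ContDiff

noncomputable section

instance instLEInftyMinSmoothnessRealThree : ENat.LEInfty (minSmoothness ℝ 3) :=
  ⟨by
    rw [minSmoothness_of_isRCLikeNormedField]
    exact ENat.LEInfty.out⟩

namespace HermitianGeometry

section Manifold

variable {E : Type*} [NormedAddCommGroup E] [NormedSpace ℝ E]
  {M : Type*} [TopologicalSpace M] [ChartedSpace E M]

/-- The tangent space of a (boundaryless) real manifold `M` modelled on `E`. -/
abbrev Tan (E : Type*) [NormedAddCommGroup E] [NormedSpace ℝ E]
    {M : Type*} [TopologicalSpace M] [ChartedSpace E M] (x : M) : Type _ :=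
  TangentSpace 𝓘(ℝ, E) x

/-- A (not necessarily smooth) field of endomorphisms of the tangent spaces of `M`. -/
abbrev EndField (E : Type*) [NormedAddCommGroup E] [NormedSpace ℝ E]
    (M : Type*) [TopologicalSpace M] [ChartedSpace E M] : Type _ :=
  (x : M) → Tan E x →L[ℝ] Tan E x

/-- A smooth Riemannian metric `g` on `M`; `g.inner x v w` is `g(v, w)` for `v, w` tangent at `x`. -/
abbrev Metric (E : Type*) [NormedAddCommGroup E] [NormedSpace ℝ E]
    (M : Type*) [TopologicalSpace M] [ChartedSpace E M] [IsManifold 𝓘(ℝ, E) ∞ M] : Type _ :=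
  ContMDiffRiemannianMetric 𝓘(ℝ, E) ∞ E (fun x : M ↦ TangentSpace 𝓘(ℝ, E) x)

/-- An affine connection on `M`. Caution: `cov Y x v` is the covariant derivative `∇_v Y` at the
point `x` of the vector field `Y` in the direction `v`. -/
abbrev Connection (E : Type*) [NormedAddCommGroup E] [NormedSpace ℝ E]
    (M : Type*) [TopologicalSpace M] [ChartedSpace E M] [IsManifold 𝓘(ℝ, E) ∞ M] : Type _ :=
  CovariantDerivative 𝓘(ℝ, E) E (fun x : M ↦ TangentSpace 𝓘(ℝ, E) x)

/-- The vector field `X` on `M` is smooth (of class `C^∞`). -/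
def SmoothField [IsManifold 𝓘(ℝ, E) ∞ M] (X : (x : M) → Tan E x) : Prop :=
  ContMDiff 𝓘(ℝ, E) 𝓘(ℝ, E).tangent ∞
    (fun x ↦ (TotalSpace.mk x (X x) : TangentBundle 𝓘(ℝ, E) M))

/-- A complex structure on `M`: a smooth field of endomorphisms `J` of the tangent spaces with
`J² = -1` whose Nijenhuis tensor vanishes, i.e. an integrable almost complex structure. -/
structure IsComplexStructure [IsManifold 𝓘(ℝ, E) ∞ M] (J : EndField E M) : Prop where
  smooth : ∀ X : (x : M) → Tan E x, SmoothField X → SmoothField (fun x ↦ J x (X x))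
  sq : ∀ (x : M) (v : Tan E x), J x (J x v) = -v
  nijenhuis : ∀ X Y : (x : M) → Tan E x, SmoothField X → SmoothField Y → ∀ x : M,
    mlieBracket 𝓘(ℝ, E) (fun y ↦ J y (X y)) (fun y ↦ J y (Y y)) x
      - J x (mlieBracket 𝓘(ℝ, E) (fun y ↦ J y (X y)) Y x)
      - J x (mlieBracket 𝓘(ℝ, E) X (fun y ↦ J y (Y y)) x)
      - mlieBracket 𝓘(ℝ, E) X Y x = 0

/-- The Riemannian metric of `M` is compatible with `J`, i.e. `g(Jv, Jw) = g(v, w)`. -/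
def IsHermitianMetric [IsManifold 𝓘(ℝ, E) ∞ M] (g : Metric E M)
    (J : EndField E M) : Prop :=
  ∀ (x : M) (v w : Tan E x), g.inner x (J x v) (J x w) = g.inner x v w

/-- A Strominger (also called Bismut) connection of `(M, J, g)`: a Hermitian connection, i.e.
`∇g = 0` and `∇J = 0`, whose torsion `g(T(u, v), w)` is totally skew-symmetric (skew-symmetry in
`u, v` is automatic). On a Hermitian manifold there is exactly one such connection. -/
structure IsStrominger [FiniteDimensional ℝ E] [IsManifold 𝓘(ℝ, E) ∞ M]
    (g : Metric E M) (J : EndField E M) (cov : Connection E M) : Prop where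
  metric : ∀ Y Z : (x : M) → Tan E x, SmoothField Y → SmoothField Z → ∀ (x : M) (v : Tan E x),
    mvfderiv 𝓘(ℝ, E) (fun y ↦ g.inner y (Y y) (Z y)) x v
      = g.inner x (cov Y x v) (Z x) + g.inner x (Y x) (cov Z x v)
  parallel : ∀ Y : (x : M) → Tan E x, SmoothField Y → ∀ (x : M) (v : Tan E x),
    cov (fun y ↦ J y (Y y)) x v = J x (cov Y x v)
  torsion_skew : ∀ (x : M) (u v w : Tan E x),
    g.inner x (cov.torsion x u v) w = -g.inner x (cov.torsion x u w) v

/-- The curvature `R(X, Y) Z = ∇_X ∇_Y Z - ∇_Y ∇_X Z - ∇_[X, Y] Z`, at the point `x`. -/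
def curvature [IsManifold 𝓘(ℝ, E) ∞ M] (cov : Connection E M)
    (X Y Z : (x : M) → Tan E x) (x : M) : Tan E x :=
  cov (fun y ↦ cov Z y (Y y)) x (X x) - cov (fun y ↦ cov Z y (X y)) x (Y x)
    - cov Z x (mlieBracket 𝓘(ℝ, E) X Y x)

/-- A connection is Kähler-like if its curvature has the symmetries of the curvature of a Kähler
metric: the first Bianchi identity `R(X, Y)Z + R(Y, Z)X + R(Z, X)Y = 0` and
`g(R(X, Y)JZ, JW) = g(R(X, Y)Z, W)`. For a Hermitian connection, the second condition is automatic
and the first one says that the complex multilinear extension of the 4-tensor `R` satisfies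
`R(X, Y, Z, W) = R(Z, Y, X, W)` for `X, Z` of type `(1, 0)`. -/
structure IsKahlerLike [IsManifold 𝓘(ℝ, E) ∞ M]
    (g : Metric E M) (J : EndField E M) (cov : Connection E M) : Prop where
  bianchi : ∀ X Y Z : (x : M) → Tan E x, SmoothField X → SmoothField Y → SmoothField Z → ∀ x : M,
    curvature cov X Y Z x + curvature cov Y Z X x + curvature cov Z X Y x = 0
  type_condition : ∀ X Y Z W : (x : M) → Tan E x,
    SmoothField X → SmoothField Y → SmoothField Z → SmoothField W → ∀ x : M,
    g.inner x (curvature cov X Y (fun y ↦ J y (Z y)) x) (J x (W x))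
      = g.inner x (curvature cov X Y Z x) (W x)

/-- The Hermitian manifold `(M, J, g)` is Strominger Kähler-like: its Strominger connection is
Kähler-like. -/
def IsStromingerKahlerLike [FiniteDimensional ℝ E] [IsManifold 𝓘(ℝ, E) ∞ M]
    (g : Metric E M) (J : EndField E M) : Prop :=
  ∃ cov : Connection E M,
    IsStrominger g J cov ∧ IsKahlerLike g J cov

/-- The fundamental 2-form `ω(X, Y) = g(JX, Y)`. -/
def fundamentalForm [IsManifold 𝓘(ℝ, E) ∞ M] (g : Metric E M)
    (J : EndField E M) (X Y : (x : M) → Tan E x) (x : M) : ℝ :=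
  g.inner x (J x (X x)) (Y x)

/-- The Hermitian metric is Kähler: `dω = 0`, where `dω` is expanded on vector fields. -/
def IsKahler [IsManifold 𝓘(ℝ, E) ∞ M] (g : Metric E M)
    (J : EndField E M) : Prop :=
  ∀ X Y Z : (x : M) → Tan E x, SmoothField X → SmoothField Y → SmoothField Z → ∀ x : M,
    mvfderiv 𝓘(ℝ, E) (fundamentalForm g J Y Z) x (X x)
      + mvfderiv 𝓘(ℝ, E) (fundamentalForm g J Z X) x (Y x)
      + mvfderiv 𝓘(ℝ, E) (fundamentalForm g J X Y) x (Z x)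
      - fundamentalForm g J (mlieBracket 𝓘(ℝ, E) X Y) Z x
      - fundamentalForm g J (mlieBracket 𝓘(ℝ, E) Y Z) X x
      - fundamentalForm g J (mlieBracket 𝓘(ℝ, E) Z X) Y x = 0

end Manifold

section LieGroup

variable {E : Type*} [NormedAddCommGroup E] [NormedSpace ℝ E]
  {G : Type*} [TopologicalSpace G] [ChartedSpace E G] [Group G]

/-- The endomorphism field `J` commutes with the differentials of all left translations. -/
def IsLeftInvariantEndField (J : EndField E G) : Prop :=
  ∀ (a b : G) (v : Tan E b),
    J (a * b) (mfderiv 𝓘(ℝ, E) 𝓘(ℝ, E) (fun y : G ↦ a * y) b v)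
      = mfderiv 𝓘(ℝ, E) 𝓘(ℝ, E) (fun y : G ↦ a * y) b (J b v)

/-- The metric `g` is left-invariant: all left translations of `G` are isometries. -/
def IsLeftInvariantMetric [LieGroup 𝓘(ℝ, E) ∞ G] (g : Metric E G) : Prop :=
  ∀ (a b : G) (v w : Tan E b),
    g.inner (a * b) (mfderiv 𝓘(ℝ, E) 𝓘(ℝ, E) (fun y : G ↦ a * y) b v)
        (mfderiv 𝓘(ℝ, E) 𝓘(ℝ, E) (fun y : G ↦ a * y) b w)
      = g.inner b v w

/-- The Lie algebra `𝔤` of `G`: the tangent space at `1`, with the bracket of left-invariant vector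
fields. -/
abbrev LieAlg (E : Type*) [NormedAddCommGroup E] [NormedSpace ℝ E]
    (G : Type*) [TopologicalSpace G] [ChartedSpace E G] [Group G] : Type _ :=
  GroupLieAlgebra 𝓘(ℝ, E) G

/-- The Lie group `G` is nilpotent: its Lie algebra is nilpotent. -/
def IsNilpotentLieGroup (E : Type*) [NormedAddCommGroup E] [NormedSpace ℝ E] [CompleteSpace E]
    (G : Type*) [TopologicalSpace G] [ChartedSpace E G] [Group G] [LieGroup 𝓘(ℝ, E) ∞ G] : Prop :=
  LieRing.IsNilpotent (LieAlg E G)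

/-- The derived algebra `[𝔤, 𝔤]` of `𝔤`, as a subspace. -/
def derivedSubspace (E : Type*) [NormedAddCommGroup E] [NormedSpace ℝ E] [CompleteSpace E]
    (G : Type*) [TopologicalSpace G] [ChartedSpace E G] [Group G] [LieGroup 𝓘(ℝ, E) ∞ G] :
    Submodule ℝ (LieAlg E G) :=
  (⁅(⊤ : LieIdeal ℝ (LieAlg E G)), (⊤ : LieIdeal ℝ (LieAlg E G))⁆).toSubmodule

/-- The complex structure `J` is abelian: `[Jx, Jy] = [x, y]` on `𝔤`, i.e. the space of elements of
type `(1, 0)` is an abelian subalgebra of the complexification of `𝔤`. -/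
def IsAbelianComplexStructure (J : EndField E G) : Prop :=
  ∀ x y : LieAlg E G, ⁅(J 1 x : LieAlg E G), (J 1 y : LieAlg E G)⁆ = ⁅x, y⁆

/-- The Lie algebra `𝔤` (of real dimension `2n`) has the asserted form with parameters `r` and `s`.
The orthonormal basis `ε_1, …, ε_n` (`Sum.inl`), `ε_{n+1}, …, ε_{2n}` (`Sum.inr`) of `𝔤` and the
orthonormal basis `X_1, …, X_s` of `[𝔤, 𝔤]` are indexed from `0`. -/
def HasNormalForm [CompleteSpace E] [LieGroup 𝓘(ℝ, E) ∞ G]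
    (g : Metric E G) (J : EndField E G) (n r s : ℕ) : Prop :=
  r ≤ n ∧ ∃ (hs : s ≤ n) (ε : Module.Basis (Fin n ⊕ Fin n) ℝ (LieAlg E G))
    (X : Fin s → LieAlg E G) (lam : Fin s → ℝ),
    (∀ a b : Fin n ⊕ Fin n, g.inner 1 (ε a) (ε b) = if a = b then 1 else 0) ∧
    (∀ i : Fin n, J 1 (ε (Sum.inl i)) = ε (Sum.inr i)) ∧
    (∀ i j : Fin s, g.inner 1 (X i) (X j) = if i = j then 1 else 0) ∧
    Submodule.span ℝ (Set.range X) = derivedSubspace E G ∧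
    derivedSubspace E G ⊔ (derivedSubspace E G).map (J 1 : LieAlg E G →ₗ[ℝ] LieAlg E G)
      = Submodule.span ℝ {v | ∃ i : Fin n, r ≤ i.val ∧ (v = ε (Sum.inl i) ∨ v = ε (Sum.inr i))} ∧
    (∀ i : Fin s, 0 < lam i) ∧
    (∀ i : Fin s,
      ⁅ε (Sum.inl (Fin.castLE hs i)), ε (Sum.inr (Fin.castLE hs i))⁆ = lam i • X i) ∧
    (∀ i : Fin n, s ≤ i.val → ⁅ε (Sum.inl i), ε (Sum.inr i)⁆ = 0) ∧
    (∀ i j : Fin n, i ≠ j → ⁅ε (Sum.inl i), ε (Sum.inr j)⁆ = 0) ∧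
    (∀ i j : Fin n, ⁅ε (Sum.inl i), ε (Sum.inl j)⁆ = 0) ∧
    (∀ i j : Fin n, ⁅ε (Sum.inr i), ε (Sum.inr j)⁆ = 0)

end LieGroup

end HermitianGeometry

end

open scoped ComplexConjugate InnerProductSpace
open Bundle VectorField
open scoped Manifold ContDiff

noncomputable section

/-! ### Types of the bracket and of the connection on a Hermitian vector space -/

section

/-! On left-invariant fields the problem is linear algebra on `𝔤`: a Strominger connection becomes a
bilinear map `Γ`, the same at every point by `IsStromingerForm.unique`. Identify `𝔤` with a
Hermitian space `V`, and `V` with the (1,0) vectors. Then `A` is the bracket of (1,0) vectors, `ρ`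
the connection in (1,0) directions, `t` its torsion, and `ρ = t + τ`, where `-τ x` is the adjoint of
the nilpotent action `θ x` on (0,1) vectors (`θ_adjoint`).

The Bianchi identity makes the curvature pair symmetric, so its (2,0) part vanishes and `ρ` is a
representation of the nilpotent Lie algebra `(V, A)`. Comparison with the representation `τ` and
with the Jacobi identity of `A` shows that `t` is itself a Lie bracket on which `τ` and `ρ` act by
derivations (`t_jacobi`, `τ_t`, `ρ_t`). Hence the Lee vector `ξ`, which represents the trace of `ρ`,
is killed by all adjoints `ρadj x`. Equality of two Ricci traces (`sum_norm_ρadj_sub`) then makes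
`ξ` parallel; parallel vectors are central, because their adjoint action is both skew and nilpotent.
The same equality now says that `ρ` and `ρadj` have equal total norm on every vector, so a common
eigenvector given by Lie's theorem is also one for the adjoints, and `ρ` is diagonal in an
orthonormal basis `b` with weights `χ`.

Nilpotency of `τ` and the weights of `t` give `χ k = -⟪θ (b k) (b k), ·⟫`, and the Bianchi identity
makes the vectors `θ (b k) (b k)` orthogonal for the real inner product. A non-zero `t (b i) (b k)`
with non-zero weights would make one of them the sum of two others, which orthogonality forbids. So
`A = 0`, and only the brackets `[b i, I b i]` survive; normalizing them gives the normal form.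

Conversely, in a normal form the connection rotates the planes of `e i`, `f i` by commuting
rotations, and the Bianchi identity reduces to an identity in dimension two. Nilpotency forces the
`X i` to be central and orthogonal to these planes, whence the bounds on `s`. As the definitions
quantify over all smooth fields, connection, torsion and curvature are computed in the left
trivialization (`coeff_curvature`). -/

lemma Complex.smul_eq_re_add_im {U : Type*} [AddCommGroup U] [Module ℂ U] [Module ℝ U]
    [IsScalarTower ℝ ℂ U] (c : ℂ) (u : U) : c • u = c.re • u + c.im • (Complex.I • u) := by
  rw [← algebraMap_smul ℂ c.re u, ← algebraMap_smul ℂ c.im, ← mul_smul, ← add_smul,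
    Complex.coe_algebraMap, Complex.re_add_im]

/-- A real-linear map commuting with multiplication by `Complex.I` is complex-linear. -/
def LinearMap.toComplexLinear {V W : Type*} [AddCommGroup V] [Module ℂ V] [AddCommGroup W]
    [Module ℂ W] [Module ℝ V] [Module ℝ W] [IsScalarTower ℝ ℂ V] [IsScalarTower ℝ ℂ W]
    (f : V →ₗ[ℝ] W) (hf : ∀ x, f (Complex.I • x) = Complex.I • f x) : V →ₗ[ℂ] W where
  toFun := f
  map_add' := f.map_add
  map_smul' c x := by
    rw [RingHom.id_apply, Complex.smul_eq_re_add_im c x, Complex.smul_eq_re_add_im c (f x)]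
    simp [hf]

/-- A nilpotent real Lie algebra structure on a Hermitian vector space `V` whose complex structure
(multiplication by `Complex.I`) is integrable, with its Strominger connection `Γ`. -/
structure StromingerLieData (V : Type*) [NormedAddCommGroup V] [InnerProductSpace ℂ V] where
  br : V →ₗ[ℝ] V →ₗ[ℝ] V
  br_self : ∀ x, br x x = 0
  jacobi : ∀ x y z, br x (br y z) = br (br x y) z + br y (br x z)
  nijenhuis : ∀ x y, br (Complex.I • x) (Complex.I • y)
    = br x y + Complex.I • (br (Complex.I • x) y + br x (Complex.I • y))
  chain : ℕ → Submodule ℝ V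
  chain_zero : chain 0 = ⊤
  br_mem_chain : ∀ k x y, y ∈ chain k → br x y ∈ chain (k + 1)
  chain_eventually : ∃ k, chain k = ⊥
  Γ : V →ₗ[ℝ] V →ₗ[ℂ] V
  Γ_skew : ∀ x y z, ⟪Γ x y, z⟫_ℂ = -⟪y, Γ x z⟫_ℂ
  torsion_skew : ∀ x y z, (⟪Γ x y - Γ y x - br x y, z⟫_ℂ).re
    = -(⟪Γ x z - Γ z x - br x z, y⟫_ℂ).re

namespace StromingerLieData

variable {V : Type*} [NormedAddCommGroup V] [InnerProductSpace ℂ V] (D : StromingerLieData V)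

lemma I_smul_I_smul {V : Type*} [AddCommGroup V] [Module ℂ V] (x : V) :
    Complex.I • Complex.I • x = -x := by
  rw [smul_smul, Complex.I_mul_I, neg_one_smul]

lemma br_comm (x y : V) : D.br x y = -D.br y x := by
  have h := D.br_self (x + y)
  simp only [map_add, LinearMap.add_apply, D.br_self, zero_add, add_zero] at h
  exact eq_neg_of_add_eq_zero_right h

/-- The torsion of the Strominger connection. -/
def tor (x y : V) : V := D.Γ x y - D.Γ y x - D.br x y

lemma re_tor_right_comm (x y z : V) : (⟪D.tor x y, z⟫_ℂ).re = -(⟪D.tor x z, y⟫_ℂ).re :=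
  D.torsion_skew x y z

/-- The component of the bracket of type `(1, 0)` on vectors of type `(1, 0)`. -/
def A : V →ₗ[ℂ] V →ₗ[ℂ] V :=
  LinearMap.toComplexLinear
    { toFun := fun x => LinearMap.toComplexLinear
        (D.br x - (D.br (Complex.I • x)).comp ((LinearMap.lsmul ℂ V Complex.I).restrictScalars ℝ))
        (fun y => by
          simp only [LinearMap.sub_apply, LinearMap.comp_apply, LinearMap.coe_restrictScalars,
            LinearMap.lsmul_apply, D.nijenhuis x y, I_smul_I_smul, map_neg, smul_sub, smul_add]
          abel)
      map_add' := fun x x' => by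
        ext y
        simp [LinearMap.toComplexLinear]
        abel
      map_smul' := fun c x => by
        ext y
        simp [LinearMap.toComplexLinear, smul_comm Complex.I c, smul_sub] }
    (fun x => by
      ext y
      simp [LinearMap.toComplexLinear, D.nijenhuis x y, I_smul_I_smul]
      abel)

lemma A_apply (x y : V) : D.A x y = D.br x y - D.br (Complex.I • x) (Complex.I • y) := rfl

lemma I_smul_A (x y : V) : Complex.I • D.A x y = D.br (Complex.I • x) y + D.br x (Complex.I • y) := by
  simp only [D.A_apply, D.nijenhuis, smul_sub, smul_add, I_smul_I_smul]
  abel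

lemma A_self (x : V) : D.A x x = 0 := by simp [A_apply, D.br_self]

/-- The Strominger connection in directions of type `(1, 0)`. -/
def ρ : V →ₗ[ℂ] V →ₗ[ℂ] V :=
  LinearMap.toComplexLinear
    { toFun := fun x => D.Γ x - Complex.I • D.Γ (Complex.I • x)
      map_add' := fun x x' => by simp only [map_add, smul_add]; abel
      map_smul' := fun c x => by
        ext y
        simp [smul_comm Complex.I c, smul_sub] }
    (fun x => by
      ext y
      simp [I_smul_I_smul, smul_sub]
      abel)

lemma ρ_apply (x y : V) : D.ρ x y = D.Γ x y - Complex.I • D.Γ (Complex.I • x) y := rfl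

/-- The torsion of the Strominger connection on vectors of type `(1, 0)`. -/
def t : V →ₗ[ℂ] V →ₗ[ℂ] V := D.ρ - D.ρ.flip - D.A

lemma t_apply' (x y : V) : D.t x y = D.ρ x y - D.ρ y x - D.A x y := rfl

lemma t_apply (x y : V) : D.t x y = D.tor x y - D.tor (Complex.I • x) (Complex.I • y) := by
  simp only [t_apply', ρ_apply, A_apply, tor, map_smul]
  abel

lemma t_comm (x y : V) : D.t x y = -D.t y x := by
  have := D.A_self (x + y)
  simp only [map_add, LinearMap.add_apply, A_self, zero_add, add_zero] at this
  simp only [t_apply', eq_neg_of_add_eq_zero_right this]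
  abel

/-- Minus the adjoint of the action of `V` (type `(1, 0)`) on vectors of type `(0, 1)`. -/
def τ : V →ₗ[ℂ] V →ₗ[ℂ] V := D.ρ - D.t

lemma A_eq (x y : V) : D.A x y = D.t x y + D.τ x y - D.τ y x := by
  have := D.t_comm x y
  simp only [τ, LinearMap.sub_apply]
  have h := D.t_apply' x y
  rw [D.t_comm y x, h]
  abel

lemma ρ_eq (x y : V) : D.ρ x y = D.t x y + D.τ x y := by
  simp [τ]

lemma ρ_eq' (x y : V) : D.ρ x y = D.A x y + D.τ y x := by
  rw [ρ_eq, A_eq]; abel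

/-- The action of vectors of type `(1, 0)` on vectors of type `(0, 1)`. -/
def θ (x : V) : V →ₗ[ℂ] V :=
  LinearMap.toComplexLinear
    (D.br x + ((LinearMap.lsmul ℂ V Complex.I).restrictScalars ℝ).comp (D.br (Complex.I • x)))
    (fun y => by
      simp [D.nijenhuis x y, I_smul_I_smul]
      abel)

lemma θ_apply (x y : V) : D.θ x y = D.br x y + Complex.I • D.br (Complex.I • x) y := rfl

lemma re_inner_I_left (x y : V) : (⟪Complex.I • x, y⟫_ℂ).re = (⟪x, y⟫_ℂ).im := by
  simp

lemma re_inner_I_right (x y : V) : (⟪x, Complex.I • y⟫_ℂ).re = -(⟪x, y⟫_ℂ).im := by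
  simp

lemma ρ_adjoint (x y z : V) :
    ⟪D.ρ x y, z⟫_ℂ = ⟪y, -D.Γ x z - Complex.I • D.Γ (Complex.I • x) z⟫_ℂ := by
  simp only [ρ_apply, inner_sub_left, inner_sub_right, inner_smul_left, inner_smul_right,
    D.Γ_skew, inner_neg_right, Complex.conj_I]
  ring

lemma inner_eq_of_re {a b c d : V} (h : ∀ z : ℂ, (⟪a, z • b⟫_ℂ).re = (⟪c, z • d⟫_ℂ).re) :
    ⟪a, b⟫_ℂ = ⟪c, d⟫_ℂ := by
  apply Complex.ext
  · simpa using h 1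
  · have := h Complex.I
    rw [re_inner_I_right, re_inner_I_right] at this
    linarith

/-- Total skewness of the torsion turns its mixed component, which separates `θ` from the
connection, into the adjoint of `t`. Through this adjunction nilpotency passes from brackets to `τ`.
-/
lemma θ_adjoint (x y z : V) : ⟪D.θ x y, z⟫_ℂ = -⟪y, D.τ x z⟫_ℂ := by
  rw [← inner_neg_right]
  apply inner_eq_of_re
  intro c
  have : c • -D.τ x z = -D.τ x (c • z) := by simp
  rw [this]
  generalize c • z = w
  clear this c z
  have h1 : -D.τ x w = D.t x w - D.ρ x w := by simp [τ]
  have h2 : D.θ x y = D.Γ x y + Complex.I • D.Γ (Complex.I • x) y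
      - D.tor x y - Complex.I • D.tor (Complex.I • x) y := by
    simp only [θ_apply, tor, smul_sub, map_smul, I_smul_I_smul]
    abel
  rw [h1, h2, inner_sub_right, ← inner_conj_symm y (D.ρ x w), ρ_adjoint, t_apply, inner_conj_symm]
  simp only [inner_sub_left, inner_sub_right, inner_add_left, Complex.sub_re, Complex.add_re,
    inner_neg_left]
  have e1 : (⟪y, D.tor x w⟫_ℂ).re = -(⟪D.tor x y, w⟫_ℂ).re := by
    rw [← inner_conj_symm, Complex.conj_re, D.re_tor_right_comm]
  have e2 : (⟪y, D.tor (Complex.I • x) (Complex.I • w)⟫_ℂ).re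
      = (⟪Complex.I • D.tor (Complex.I • x) y, w⟫_ℂ).re := by
    rw [← inner_conj_symm, Complex.conj_re, D.re_tor_right_comm, re_inner_I_left,
      re_inner_I_right]
    ring
  rw [e1, e2]
  simp [re_inner_I_left]
  ring

end StromingerLieData

end

/-! ### Nilpotency, the Bianchi identity and the torsion bracket -/

section

namespace StromingerLieData

variable {V : Type*} [NormedAddCommGroup V] [InnerProductSpace ℂ V] (D : StromingerLieData V)

lemma A_comm (x y : V) : D.A x y = -D.A y x := by
  have := D.A_self (x + y)
  simp only [map_add, LinearMap.add_apply, A_self, zero_add, add_zero] at this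
  exact eq_neg_of_add_eq_zero_right this

lemma A_jacobi (x y z : V) : D.A x (D.A y z) = D.A (D.A x y) z + D.A y (D.A x z) := by
  rw [A_apply _ x, A_apply _ (D.A x y), A_apply _ y (D.A x z), I_smul_A, I_smul_A, I_smul_A]
  simp only [A_apply, map_sub, map_add, LinearMap.sub_apply, LinearMap.add_apply]
  rw [D.jacobi x y z, D.jacobi x (Complex.I • y) (Complex.I • z),
    D.jacobi (Complex.I • x) (Complex.I • y) z, D.jacobi (Complex.I • x) y (Complex.I • z)]
  abel

/-- The terms of the chain need not be complex subspaces, so the induction has to carry the multiple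
by `I` as well. -/
lemma A_pow_mem_chain (x : V) (k : ℕ) (y : V) :
    (D.A x ^ k) y ∈ D.chain k ∧ Complex.I • (D.A x ^ k) y ∈ D.chain k := by
  induction k with
  | zero => simp [D.chain_zero]
  | succ k ih =>
    rw [pow_succ', Module.End.mul_apply]
    refine ⟨?_, ?_⟩
    · rw [A_apply]
      exact sub_mem (D.br_mem_chain _ _ _ ih.1) (D.br_mem_chain _ _ _ ih.2)
    · rw [I_smul_A]
      exact add_mem (D.br_mem_chain _ _ _ ih.1) (D.br_mem_chain _ _ _ ih.2)

lemma isNilpotent_A (x : V) : IsNilpotent (D.A x) := by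
  obtain ⟨k, hk⟩ := D.chain_eventually
  refine ⟨k, LinearMap.ext fun y => ?_⟩
  simpa [hk] using (D.A_pow_mem_chain x k y).1

lemma θ_pow_mem_chain (x : V) (k : ℕ) (y : V) :
    ∃ u ∈ D.chain k, ∃ v ∈ D.chain k, (D.θ x ^ k) y = u + Complex.I • v := by
  induction k with
  | zero => exact ⟨y, by simp [D.chain_zero], 0, zero_mem _, by simp⟩
  | succ k ih =>
    obtain ⟨u, hu, v, hv, h⟩ := ih
    rw [pow_succ', Module.End.mul_apply, h, map_add, map_smul, θ_apply, θ_apply]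
    refine ⟨D.br x u - D.br (Complex.I • x) v, sub_mem (D.br_mem_chain _ _ _ hu)
      (D.br_mem_chain _ _ _ hv), D.br (Complex.I • x) u + D.br x v,
      add_mem (D.br_mem_chain _ _ _ hu) (D.br_mem_chain _ _ _ hv), ?_⟩
    simp only [smul_add, I_smul_I_smul]
    abel

lemma isNilpotent_θ (x : V) : IsNilpotent (D.θ x) := by
  obtain ⟨k, hk⟩ := D.chain_eventually
  refine ⟨k, LinearMap.ext fun y => ?_⟩
  obtain ⟨u, hu, v, hv, h⟩ := D.θ_pow_mem_chain x k y
  rw [hk, Submodule.mem_bot] at hu hv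
  simpa [hu, hv] using h

lemma inner_θ_pow (x : V) (k : ℕ) (y z : V) :
    ⟪(D.θ x ^ k) y, z⟫_ℂ = (-1) ^ k * ⟪y, (D.τ x ^ k) z⟫_ℂ := by
  induction k generalizing y z with
  | zero => simp
  | succ k ih =>
    rw [pow_succ', pow_succ (D.τ x), Module.End.mul_apply, Module.End.mul_apply, θ_adjoint, ih]
    ring

lemma isNilpotent_τ (x : V) : IsNilpotent (D.τ x) := by
  obtain ⟨k, hk⟩ := D.isNilpotent_θ x
  refine ⟨k, LinearMap.ext fun z => ext_inner_left ℂ fun y => ?_⟩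
  have := D.inner_θ_pow x k y z
  rw [hk] at this
  simpa using this.symm

/-- The (1,0) vectors form a subalgebra of the complexification, and `θ` is its action on the
quotient by that subalgebra, identified with the (0,1) vectors. -/
lemma θ_A (x y z : V) : D.θ (D.A x y) z = D.θ x (D.θ y z) - D.θ y (D.θ x z) := by
  have key : ∀ x y, D.θ x (D.θ y z) = D.br x (D.br y z) + Complex.I • D.br (Complex.I • x) (D.br y z)
      + (Complex.I • D.br x (D.br (Complex.I • y) z)
        - D.br (Complex.I • x) (D.br (Complex.I • y) z)) := by
    intro x y
    rw [D.θ_apply y, map_add, map_smul, θ_apply, θ_apply, smul_add, I_smul_I_smul]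
    abel
  rw [key, key, θ_apply, I_smul_A, A_apply]
  simp only [map_sub, map_add, LinearMap.sub_apply, LinearMap.add_apply]
  rw [D.jacobi x y, D.jacobi (Complex.I • x) y, D.jacobi x (Complex.I • y),
    D.jacobi (Complex.I • x) (Complex.I • y)]
  simp only [smul_add]
  abel

lemma τ_A (x y z : V) : D.τ (D.A x y) z = D.τ x (D.τ y z) - D.τ y (D.τ x z) := by
  refine ext_inner_left ℂ fun w => ?_
  have h := D.θ_adjoint (D.A x y) w z
  rw [θ_A, inner_sub_left, θ_adjoint, θ_adjoint, θ_adjoint, θ_adjoint] at h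
  rw [inner_sub_right]
  linear_combination h

/-- The curvature of the Strominger connection. -/
def R (x y : V) : V →ₗ[ℂ] V := ⁅D.Γ x, D.Γ y⁆ - D.Γ (D.br x y)

lemma R_apply (x y z : V) : D.R x y z = D.Γ x (D.Γ y z) - D.Γ y (D.Γ x z) - D.Γ (D.br x y) z := rfl

lemma R_comm (x y z : V) : D.R x y z = -D.R y x z := by
  rw [R_apply, R_apply, D.br_comm x y, map_neg, LinearMap.neg_apply]; abel

lemma R_skew (x y z w : V) : ⟪D.R x y z, w⟫_ℂ = -⟪z, D.R x y w⟫_ℂ := by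
  simp only [R_apply, inner_sub_left, inner_sub_right, D.Γ_skew, neg_neg]; ring

lemma re_R_skew (x y z w : V) : (⟪D.R x y z, w⟫_ℂ).re = -(⟪D.R x y w, z⟫_ℂ).re := by
  rw [R_skew, Complex.neg_re, ← inner_conj_symm, Complex.conj_re]

/-- The Strominger connection satisfies the first Bianchi identity. -/
def IsKahlerLike : Prop := ∀ x y z, D.R x y z + D.R y z x + D.R z x y = 0

variable {D} (hD : D.IsKahlerLike)
include hD

/-- The classical argument for Riemannian curvature: four instances of the Bianchi identity combined
with the two skew symmetries. -/
lemma re_R_pair (x y z w : V) : (⟪D.R x y z, w⟫_ℂ).re = (⟪D.R z w x, y⟫_ℂ).re := by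
  have b : ∀ x y z w, (⟪D.R x y z, w⟫_ℂ).re + (⟪D.R y z x, w⟫_ℂ).re + (⟪D.R z x y, w⟫_ℂ).re = 0 := by
    intro x y z w
    have := congrArg (fun v => (⟪v, w⟫_ℂ).re) (hD x y z)
    simpa [inner_add_left] using this
  have s : ∀ x y z w, (⟪D.R x y z, w⟫_ℂ).re = -(⟪D.R y x z, w⟫_ℂ).re := by
    intro x y z w; rw [R_comm]; simp
  have b1 := b x y z w
  have b2 := b y z w x
  have b3 := b z w x y
  have b4 := b w x y z
  rw [D.re_R_skew y z w x] at b2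
  rw [D.re_R_skew z w x y] at b3
  linarith [D.re_R_skew w y z x, D.re_R_skew x z w y, D.re_R_skew w x y z, D.re_R_skew x y w z,
    D.re_R_skew z w x y, s z x y w, s w y x z]

/-- The endomorphism `R z w` is complex-linear; pair symmetry moves this invariance to the other two
slots. -/
lemma R_I_I (x y : V) : D.R (Complex.I • x) (Complex.I • y) = D.R x y := by
  refine LinearMap.ext fun z => ext_inner_right ℂ fun w => inner_eq_of_re fun c => ?_
  generalize c • w = w
  rw [re_R_pair hD, re_R_pair hD x y]
  simp

/-- The defect of this identity is the (2,0) part of the curvature, which `R_I_I` kills. -/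
lemma ρ_A (x y z : V) : D.ρ (D.A x y) z = D.ρ x (D.ρ y z) - D.ρ y (D.ρ x z) := by
  have h1 := LinearMap.congr_fun (R_I_I hD x y) z
  have h2 := LinearMap.congr_fun (R_I_I hD x (Complex.I • y)) z
  rw [I_smul_I_smul] at h2
  simp only [R_apply, map_neg, LinearMap.neg_apply] at h1 h2
  rw [ρ_apply, I_smul_A, A_apply]
  simp only [ρ_apply, map_sub, map_add, LinearMap.sub_apply, LinearMap.add_apply, map_smul,
    smul_sub, smul_add, I_smul_I_smul]
  linear_combination (norm := module) h1 - Complex.I • h2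

omit hD in
lemma derivation_skew (x z w : V) : D.τ x (D.t z w) - D.t z (D.τ x w) - D.t (D.τ x z) w
    = -(D.τ x (D.t w z) - D.t w (D.τ x z) - D.t (D.τ x w) z) := by
  rw [D.t_comm w z, D.t_comm w (D.τ x z), D.t_comm (D.τ x w) z, map_neg]
  abel

/-- Let `δ(x; z, w)` be the failure of `τ x` to be a derivation of `t`. Substituting `ρ = t + τ` in
`ρ_A` and removing the terms cancelled by `τ_A` relates `δ` to the Jacobiator of `t`. -/
lemma derivation_sub (x z w : V) : D.τ x (D.t z w) - D.t z (D.τ x w) - D.t (D.τ x z) w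
    - (D.τ z (D.t x w) - D.t x (D.τ z w) - D.t (D.τ z x) w)
    = D.t (D.t x z) w + D.t (D.t z w) x + D.t (D.t w x) z := by
  have h := ρ_A hD x z w
  have h' := D.τ_A x z w
  simp only [ρ_eq, map_add] at h
  have e : D.t (D.A x z) w = D.t (D.t x z) w + D.t (D.τ x z) w - D.t (D.τ z x) w := by
    rw [A_eq]; simp
  rw [e, h'] at h
  rw [D.t_comm (D.t z w) x, D.t_comm (D.t w x) z, D.t_comm w x, map_neg]
  linear_combination (norm := module) -h

omit hD in
-- This is the Jacobi identity of `A` after `A x y = t x y + τ x y - τ y x`; the terms quadratic in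
-- `τ` cancel by `τ_A`.
lemma derivation_cyclic (x z w : V) :
    D.τ x (D.t z w) - D.t z (D.τ x w) - D.t (D.τ x z) w
    + (D.τ z (D.t w x) - D.t w (D.τ z x) - D.t (D.τ z w) x)
    + (D.τ w (D.t x z) - D.t x (D.τ w z) - D.t (D.τ w x) z)
    = D.t (D.t x z) w + D.t (D.t z w) x + D.t (D.t w x) z := by
  have h := D.A_jacobi x z w
  rw [D.A_comm x (D.A z w), D.A_comm z (D.A x w), D.A_eq (D.A z w), D.A_eq (D.A x z),
    D.A_eq (D.A x w), τ_A, τ_A, τ_A] at h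
  simp only [A_eq, map_add, map_sub, LinearMap.add_apply, LinearMap.sub_apply] at h
  rw [D.t_comm z (D.τ x w), D.t_comm w (D.τ z x), D.t_comm x (D.τ w z)]
  rw [D.t_comm x w, map_neg, map_neg, LinearMap.neg_apply] at h
  linear_combination (norm := module) h

/-- With `j` the Jacobiator, the cyclic sum of `derivation_sub` says that `3 j` is twice the cyclic
sum of `δ`, since `δ` is skew in its last two arguments; `derivation_cyclic` says that this cyclic
sum is `j`. So `2 j = 3 j`. -/
lemma t_jacobi (x z w : V) : D.t (D.t x z) w + D.t (D.t z w) x + D.t (D.t w x) z = 0 := by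
  have h1 := derivation_sub hD x z w
  have h2 := derivation_sub hD z w x
  have h3 := derivation_sub hD w x z
  have h4 := D.derivation_cyclic x z w
  have s1 := D.derivation_skew z x w
  have s2 := D.derivation_skew w z x
  have s3 := D.derivation_skew x w z
  have : (2 : ℂ) • (D.t (D.t x z) w + D.t (D.t z w) x + D.t (D.t w x) z)
      = (3 : ℂ) • (D.t (D.t x z) w + D.t (D.t z w) x + D.t (D.t w x) z) := by
    linear_combination (norm := module) h1 + h2 + h3 + s1 + s2 + s3 - (2 : ℂ) • h4
  generalize D.t (D.t x z) w + D.t (D.t z w) x + D.t (D.t w x) z = j at this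
  linear_combination (norm := module) -this

/-- Once the Jacobiator vanishes, `δ` is symmetric in its first two arguments and skew in its last
two, hence zero. -/
lemma τ_t (x z w : V) : D.τ x (D.t z w) = D.t (D.τ x z) w + D.t z (D.τ x w) := by
  have h1 := derivation_sub hD x z w
  have h2 := derivation_sub hD z w x
  have h3 := derivation_sub hD w x z
  have j1 := t_jacobi hD x z w
  have j2 := t_jacobi hD z w x
  have j3 := t_jacobi hD w x z
  have s1 := D.derivation_skew z x w
  have s2 := D.derivation_skew w z x
  have s3 := D.derivation_skew x w z
  rw [j1] at h1
  rw [j2] at h2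
  rw [j3] at h3
  have : (2 : ℂ) • (D.τ x (D.t z w) - (D.t (D.τ x z) w + D.t z (D.τ x w))) = 0 := by
    linear_combination (norm := module) h1 - h2 + h3 + s1 - s2 + s3
  rw [← sub_eq_zero]
  exact (smul_eq_zero.1 this).resolve_left two_ne_zero

lemma ρ_t (x z w : V) : D.ρ x (D.t z w) = D.t (D.ρ x z) w + D.t z (D.ρ x w) := by
  have j := t_jacobi hD x z w
  rw [D.t_comm (D.t z w) x, D.t_comm (D.t w x) z, D.t_comm w x, map_neg] at j
  simp only [ρ_eq, map_add, LinearMap.add_apply, τ_t hD]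
  linear_combination (norm := module) -j

end StromingerLieData

end

/-! ### The Lee vector, and common norms of `ρ` and its adjoint -/

section

namespace StromingerLieData

variable {V : Type*} [NormedAddCommGroup V] [InnerProductSpace ℂ V] (D : StromingerLieData V)

lemma im_inner_swap (x y : V) : (⟪x, y⟫_ℂ).im = -(⟪y, x⟫_ℂ).im := by
  rw [← inner_conj_symm, Complex.conj_im]

lemma re_inner_swap (x y : V) : (⟪x, y⟫_ℂ).re = (⟪y, x⟫_ℂ).re := by
  rw [← inner_conj_symm, Complex.conj_re]

/-- Of skewness only `ker N² ⊆ ker N` matters: it lowers the nilpotency index step by step to one.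
-/
lemma eq_zero_of_skew_of_nilpotent {W : Type*} [AddCommGroup W] (N : W → W) (k : ℕ)
    (hk : ∀ y, N^[k] y = 0) (h2 : ∀ y, N (N y) = 0 → N y = 0) (y : W) : N y = 0 := by
  induction k with
  | zero => have := hk (N y); simpa using this
  | succ k ih =>
    cases k with
    | zero => simpa using hk y
    | succ k =>
      apply ih
      intro z
      rw [Function.iterate_succ_apply']
      apply h2
      have := hk z
      rwa [Function.iterate_succ_apply', Function.iterate_succ_apply'] at this

/-- Vectors which are parallel for the Strominger connection are central. -/
lemma br_eq_zero_of_parallel (x : V) (hx : ∀ y, D.Γ y x = 0) (y : V) : D.br x y = 0 := by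
  -- When `x` is parallel, its adjoint action is `Γ x` minus the torsion with `x` inserted, and both
  -- are skew for the real inner product.
  have hskew : ∀ y z, (⟪D.br x y, z⟫_ℂ).re = -(⟪y, D.br x z⟫_ℂ).re := by
    intro y z
    have h : ∀ y, D.br x y = D.Γ x y - D.tor x y := by intro y; simp [tor, hx]
    rw [h, h, inner_sub_left, inner_sub_right, Complex.sub_re, Complex.sub_re, D.re_tor_right_comm,
      D.Γ_skew, re_inner_swap y (D.tor x z)]
    simp
    ring
  obtain ⟨k, hk⟩ := D.chain_eventually
  refine eq_zero_of_skew_of_nilpotent (fun y => D.br x y) k (fun y => ?_)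
    (fun y hy => ?_) y
  · have : ∀ j, (fun y => D.br x y)^[j] y ∈ D.chain j := by
      intro j
      induction j with
      | zero => simp [D.chain_zero]
      | succ j ih =>
        rw [Function.iterate_succ_apply']
        exact D.br_mem_chain _ _ _ ih
    simpa [hk] using this k
  · have := hskew y (D.br x y)
    rw [hy, inner_zero_right, ← inner_conj_symm, Complex.conj_re] at this
    have h' := hskew (D.br x y) y
    rw [hy, inner_zero_left] at h'
    rw [← inner_self_eq_zero (𝕜 := ℂ)]
    apply Complex.ext
    · simpa using h'.symm
    · simp [inner_self_eq_norm_sq_to_K, ← Complex.ofReal_pow]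

/-- The formal adjoint of `ρ x`. -/
def ρadj (x : V) : V →ₗ[ℂ] V := -D.Γ x - Complex.I • D.Γ (Complex.I • x)

lemma ρadj_apply (x y : V) :
    D.ρadj x y = -D.Γ x y - Complex.I • D.Γ (Complex.I • x) y := rfl

lemma inner_ρ_left (x y z : V) : ⟪D.ρ x y, z⟫_ℂ = ⟪y, D.ρadj x z⟫_ℂ := D.ρ_adjoint x y z

lemma inner_ρadj_left (x y z : V) : ⟪D.ρadj x y, z⟫_ℂ = ⟪y, D.ρ x z⟫_ℂ := by
  rw [← inner_conj_symm, ← inner_ρ_left, inner_conj_symm]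

lemma two_smul_Γ (x y : V) : (2 : ℂ) • D.Γ x y = D.ρ x y - D.ρadj x y := by
  rw [ρ_apply, ρadj_apply]; module

lemma ρadj_smul (c : ℂ) (x y : V) : D.ρadj (c • x) y = conj c • D.ρadj x y := by
  refine ext_inner_left ℂ fun z => ?_
  rw [← inner_ρ_left, map_smul, LinearMap.smul_apply, inner_smul_left, inner_ρ_left,
    inner_smul_right]

lemma ρadj_add (x x' y : V) : D.ρadj (x + x') y = D.ρadj x y + D.ρadj x' y := by
  simp [ρadj]; abel

lemma trace_A (x : V) : LinearMap.trace ℂ V (D.A x) = 0 :=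
  (LinearMap.isNilpotent_trace_of_isNilpotent (D.isNilpotent_A x)).eq_zero

lemma trace_τ (x : V) : LinearMap.trace ℂ V (D.τ x) = 0 :=
  (LinearMap.isNilpotent_trace_of_isNilpotent (D.isNilpotent_τ x)).eq_zero

lemma trace_ρ_eq_trace_t (x : V) : LinearMap.trace ℂ V (D.ρ x) = LinearMap.trace ℂ V (D.t x) := by
  have : D.ρ x = D.t x + D.τ x := LinearMap.ext (D.ρ_eq x)
  rw [this, map_add, trace_τ, add_zero]

variable [FiniteDimensional ℂ V]

/-- The Lee vector, up to a universal constant. -/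
def ξ : V := ∑ i, D.θ (stdOrthonormalBasis ℂ V i) (stdOrthonormalBasis ℂ V i)

/-- By `ρ_eq'`, the operator `ρ x` differs from the traceless `A x` by `y ↦ τ y x`, whose trace is
read off from `θ_adjoint`. -/
lemma trace_ρ (x : V) : LinearMap.trace ℂ V (D.ρ x) = -⟪D.ξ, x⟫_ℂ := by
  have : LinearMap.trace ℂ V (D.ρ x) - LinearMap.trace ℂ V (D.A x) = -⟪D.ξ, x⟫_ℂ := by
    rw [LinearMap.trace_eq_sum_inner _ (stdOrthonormalBasis ℂ V),
      LinearMap.trace_eq_sum_inner _ (stdOrthonormalBasis ℂ V), ← Finset.sum_sub_distrib, ξ,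
      sum_inner, ← Finset.sum_neg_distrib]
    refine Finset.sum_congr rfl fun i _ => ?_
    rw [ρ_eq', inner_add_right, θ_adjoint, neg_neg, add_sub_cancel_left]
  rwa [trace_A, sub_zero] at this

variable {D} (hD : D.IsKahlerLike)
include hD

/-- As `ρ x` is a derivation of `t`, the operator `t (ρ x z)` is a commutator and has trace zero.
The traces of `t` and `ρ` agree, so `ξ` is orthogonal to every `ρ x z`. -/
lemma ρadj_ξ (x : V) : D.ρadj x D.ξ = 0 := by
  refine ext_inner_left ℂ fun z => ?_
  rw [← inner_ρ_left, inner_zero_right, ← inner_conj_symm]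
  have h : LinearMap.trace ℂ V (D.t (D.ρ x z)) = 0 := by
    have : D.t (D.ρ x z) = D.ρ x * D.t z - D.t z * D.ρ x := by
      refine LinearMap.ext fun w => ?_
      have := ρ_t hD x z w
      simp [this]
    rw [this, map_sub, LinearMap.trace_mul_comm, sub_self]
  rw [← trace_ρ_eq_trace_t, trace_ρ, neg_eq_zero] at h
  rw [h, map_zero]

omit hD [FiniteDimensional ℂ V] in
lemma re_R_I (x y : V) : (⟪D.R x (Complex.I • x) y, Complex.I • y⟫_ℂ).re
    = (‖D.ρadj x y‖ ^ 2 - ‖D.ρ x y‖ ^ 2) / 2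
      + (⟪D.Γ (D.br x (Complex.I • x)) y, y⟫_ℂ).im := by
  have e1 : ‖D.ρ x y‖ ^ 2 = (⟪D.Γ x y, D.Γ x y⟫_ℂ).re
      + (⟪D.Γ (Complex.I • x) y, D.Γ (Complex.I • x) y⟫_ℂ).re
      + 2 * (⟪D.Γ x y, D.Γ (Complex.I • x) y⟫_ℂ).im := by
    rw [← inner_self_eq_norm_sq (𝕜 := ℂ), ρ_apply]
    simp only [inner_sub_left, inner_sub_right, RCLike.re_to_complex, Complex.sub_re,
      inner_smul_right, inner_smul_left]
    simp [im_inner_swap (D.Γ (Complex.I • x) y) (D.Γ x y)]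
    ring
  have e2 : ‖D.ρadj x y‖ ^ 2 = (⟪D.Γ x y, D.Γ x y⟫_ℂ).re
      + (⟪D.Γ (Complex.I • x) y, D.Γ (Complex.I • x) y⟫_ℂ).re
      - 2 * (⟪D.Γ x y, D.Γ (Complex.I • x) y⟫_ℂ).im := by
    rw [← inner_self_eq_norm_sq (𝕜 := ℂ), ρadj_apply]
    simp only [inner_sub_left, inner_sub_right, RCLike.re_to_complex, Complex.sub_re,
      inner_smul_right, inner_smul_left, inner_neg_left, inner_neg_right]
    simp [im_inner_swap (D.Γ (Complex.I • x) y) (D.Γ x y)]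
    ring
  rw [e1, e2, R_apply, inner_sub_left, inner_sub_left, Complex.sub_re, Complex.sub_re,
    D.Γ_skew x (D.Γ (Complex.I • x) y), D.Γ_skew (Complex.I • x) (D.Γ x y)]
  simp only [map_smul, Complex.neg_re, re_inner_I_right]
  rw [im_inner_swap (D.Γ (Complex.I • x) y) (D.Γ x y)]
  ring

omit hD in
lemma im_trace_ρ (x : V) : (LinearMap.trace ℂ V (D.ρ x)).im = (LinearMap.trace ℂ V (D.Γ x)).im := by
  have h : (LinearMap.trace ℂ V (D.Γ (Complex.I • x))).re = 0 := by
    rw [LinearMap.trace_eq_sum_inner _ (stdOrthonormalBasis ℂ V), Complex.re_sum]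
    refine Finset.sum_eq_zero fun i _ => ?_
    have := congrArg Complex.re (D.Γ_skew (Complex.I • x) (stdOrthonormalBasis ℂ V i)
      (stdOrthonormalBasis ℂ V i))
    rw [re_inner_swap, Complex.neg_re] at this
    linarith
  have : D.ρ x = D.Γ x - Complex.I • D.Γ (Complex.I • x) := rfl
  rw [this, map_sub, map_smul]
  simp [h]

/-- The sum over `i` of the real parts of `⟪R (b i) (I b i) y, I y⟫` is computed twice: by `re_R_I`,
and, after pair symmetry, as a trace of `R y (I y)`, to which the commutator of `Γ`'s contributes
nothing. -/
lemma sum_norm_ρadj_sub (y : V) :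
    ∑ i, (‖D.ρadj (stdOrthonormalBasis ℂ V i) y‖ ^ 2 - ‖D.ρ (stdOrthonormalBasis ℂ V i) y‖ ^ 2)
      = 2 * (⟪y, D.A D.ξ y⟫_ℂ).re := by
  set b := stdOrthonormalBasis ℂ V
  have hθ : ∀ x, D.br x (Complex.I • x) = Complex.I • D.θ x x := by
    intro x
    rw [θ_apply, D.br_self, zero_add, I_smul_I_smul, D.br_comm]
  have h1 : ∑ i, (⟪D.R (b i) (Complex.I • b i) y, Complex.I • y⟫_ℂ).re = (⟪D.ξ, D.θ y y⟫_ℂ).re := by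
    have : ∀ i, (⟪D.R (b i) (Complex.I • b i) y, Complex.I • y⟫_ℂ).re
        = (⟪b i, D.R y (Complex.I • y) (b i)⟫_ℂ).im := by
      intro i
      rw [re_R_pair hD, re_inner_I_right, im_inner_swap, neg_neg]
    simp only [this]
    rw [← Complex.im_sum, ← LinearMap.trace_eq_sum_inner, R, map_sub, LinearMap.trace_lie, zero_sub,
      Complex.neg_im, ← im_trace_ρ, trace_ρ, hθ, inner_smul_right]
    simp
  have h2 : ∑ i, (⟪D.Γ (D.br (b i) (Complex.I • b i)) y, y⟫_ℂ).im
      = (⟪D.Γ (Complex.I • D.ξ) y, y⟫_ℂ).im := by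
    simp only [hθ, ξ, Finset.smul_sum, map_sum, LinearMap.sum_apply, sum_inner, Complex.im_sum]
    rfl
  have h3 : (⟪y, D.ρ D.ξ y⟫_ℂ).re = -(⟪D.Γ (Complex.I • D.ξ) y, y⟫_ℂ).im := by
    have := congrArg Complex.re (D.Γ_skew D.ξ y y)
    rw [re_inner_swap, Complex.neg_re] at this
    rw [ρ_apply, inner_sub_right, Complex.sub_re, re_inner_I_right, im_inner_swap y]
    linarith
  have h4 : (⟪y, D.ρ D.ξ y⟫_ℂ).re = (⟪y, D.A D.ξ y⟫_ℂ).re - (⟪D.ξ, D.θ y y⟫_ℂ).re := by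
    rw [ρ_eq', inner_add_right, Complex.add_re, re_inner_swap D.ξ, θ_adjoint]
    simp
  simp only [re_R_I, Finset.sum_add_distrib, ← Finset.sum_div] at h1
  linarith

omit hD in
lemma eq_zero_of_basis (f : V → V) (hf : ∀ i, f (stdOrthonormalBasis ℂ V i) = 0)
    (hadd : ∀ x y, f (x + y) = f x + f y) (hsmul : ∀ c : ℂ, ∀ x, f x = 0 → f (c • x) = 0) (x : V) :
    f x = 0 := by
  have : x ∈ Submodule.span ℂ (Set.range (stdOrthonormalBasis ℂ V)) := by
    rw [← OrthonormalBasis.coe_toBasis, Module.Basis.span_eq]; trivial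
  induction this using Submodule.span_induction with
  | mem x hx => obtain ⟨i, rfl⟩ := hx; exact hf i
  | zero => have := hadd 0 0; simpa using this
  | add x y _ _ hx hy => rw [hadd, hx, hy, add_zero]
  | smul c x _ hx => exact hsmul c x hx

/-- At `y = ξ` the right side of `sum_norm_ρadj_sub` and the adjoint norms vanish, leaving a sum of
squares equal to zero. -/
lemma ρ_ξ (x : V) : D.ρ x D.ξ = 0 := by
  have h := sum_norm_ρadj_sub hD D.ξ
  simp only [A_self, ρadj_ξ hD, inner_zero_right, norm_zero] at h
  have h0 : ∑ i, ‖D.ρ (stdOrthonormalBasis ℂ V i) D.ξ‖ ^ 2 = 0 := by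
    simpa using h
  rw [Finset.sum_eq_zero_iff_of_nonneg (fun i _ => by positivity)] at h0
  refine eq_zero_of_basis (fun x => D.ρ x D.ξ) (fun i => ?_) (by simp) (by simp +contextual) x
  simpa using h0 i (Finset.mem_univ i)

lemma Γ_ξ (x : V) : D.Γ x D.ξ = 0 := by
  have := D.two_smul_Γ x D.ξ
  rw [ρ_ξ hD, ρadj_ξ hD, sub_zero] at this
  exact (smul_eq_zero.1 this).resolve_left two_ne_zero

lemma A_ξ (x : V) : D.A D.ξ x = 0 := by
  rw [A_apply, D.br_eq_zero_of_parallel _ (Γ_ξ hD), D.br_eq_zero_of_parallel, sub_zero]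
  intro y
  rw [map_smul, Γ_ξ hD, smul_zero]

lemma sum_norm_ρadj (y : V) :
    ∑ i, ‖D.ρadj (stdOrthonormalBasis ℂ V i) y‖ ^ 2
      = ∑ i, ‖D.ρ (stdOrthonormalBasis ℂ V i) y‖ ^ 2 := by
  have := sum_norm_ρadj_sub hD y
  rw [A_ξ hD, inner_zero_right, Finset.sum_sub_distrib] at this
  simpa [sub_eq_zero] using this

/-- The component of `ρadj x e` along `e` is forced and has the norm of `ρ x e`. By Pythagoras the
remaining component measures the excess of norm, and `sum_norm_ρadj` makes the total excess zero. -/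
lemma ρadj_eigenvector {e : V} (he : ‖e‖ = 1) {χ : V → ℂ} (h : ∀ x, D.ρ x e = χ x • e) (x : V) :
    D.ρadj x e = conj (χ x) • e := by
  have hee : ⟪e, e⟫_ℂ = 1 := by rw [inner_self_eq_norm_sq_to_K, he]; simp
  have hinner : ∀ x, ⟪e, D.ρadj x e⟫_ℂ = conj (χ x) := by
    intro x
    rw [← inner_ρ_left, h, inner_smul_left, hee, mul_one]
  have hpy : ∀ x, ‖D.ρadj x e‖ ^ 2 - ‖D.ρ x e‖ ^ 2 = ‖D.ρadj x e - conj (χ x) • e‖ ^ 2 := by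
    intro x
    rw [@norm_sub_sq ℂ, inner_smul_right, ← inner_conj_symm, hinner, h, norm_smul, norm_smul, he]
    have := Complex.sq_norm (χ x)
    rw [Complex.normSq_apply] at this
    simp
    linarith
  have hs : ∑ i, ‖D.ρadj (stdOrthonormalBasis ℂ V i) e
      - conj (χ (stdOrthonormalBasis ℂ V i)) • e‖ ^ 2 = 0 := by
    simp only [← hpy]
    rw [Finset.sum_sub_distrib, sum_norm_ρadj hD, sub_self]
  rw [Finset.sum_eq_zero_iff_of_nonneg (fun i _ => by positivity)] at hs
  rw [← sub_eq_zero, ← hinner x]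
  refine eq_zero_of_basis (fun x => D.ρadj x e - ⟪e, D.ρadj x e⟫_ℂ • e) (fun i => ?_)
    (fun x y => ?_) (fun c x hx => ?_) x
  · simpa [hinner] using hs i (Finset.mem_univ i)
  · simp only [ρadj_add, inner_add_right, add_smul]; abel
  · simp only [ρadj_smul, inner_smul_right, mul_smul, ← smul_sub, hx, smul_zero]

end StromingerLieData

end

/-! ### Diagonalization of `ρ` and its weights -/

section

/-- **Lie's theorem** for a representation of a solvable Lie algebra. -/
lemma LieHom.exists_common_eigenvector {L W : Type*} [LieRing L] [LieAlgebra ℂ L]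
    [LieAlgebra.IsSolvable L] [AddCommGroup W] [Module ℂ W] [FiniteDimensional ℂ W] [Nontrivial W]
    (f : L →ₗ[ℂ] Module.End ℂ W) (hf : ∀ x y w, f ⁅x, y⁆ w = f x (f y w) - f y (f x w)) :
    ∃ χ : L → ℂ, ∃ w : W, w ≠ 0 ∧ ∀ x, f x w = χ x • w := by
  let : LieRingModule L W :=
    { bracket := fun x w => f x w
      add_lie := by intro x y m; simp
      lie_add := by intro x m n; simp
      leibniz_lie := by
        intro x y m
        change f x (f y m) = f ⁅x, y⁆ m + f y (f x m)
        rw [hf]; abel }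
  let : LieModule ℂ L W :=
    { smul_lie := by intro c x m; change f (c • x) m = c • f x m; simp
      lie_smul := by intro c x m; change f x (c • m) = c • f x m; simp }
  obtain ⟨χ, hχ⟩ := LieModule.exists_nontrivial_weightSpace_of_isSolvable ℂ L W
  obtain ⟨⟨w, hw⟩, hw0⟩ := exists_ne (0 : LieModule.weightSpace W χ)
  refine ⟨χ, w, fun h => hw0 (Subtype.ext h), fun x => ?_⟩
  rw [LieModule.mem_weightSpace] at hw
  exact hw x

namespace StromingerLieData

variable {V : Type*} [NormedAddCommGroup V] [InnerProductSpace ℂ V] {D : StromingerLieData V}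
  [FiniteDimensional ℂ V] (hD : D.IsKahlerLike)

include hD

/-- Engel's criterion makes `(V, A)` nilpotent, hence solvable, and `ρ_A` makes `ρ` a representation
of it, so Lie's theorem applies on `F`. -/
lemma exists_eigenvector_mem (F : Submodule ℂ V) (hF : F ≠ ⊥) (hinv : ∀ x, ∀ y ∈ F, D.ρ x y ∈ F) :
    ∃ e ∈ F, ‖e‖ = 1 ∧ ∃ χ : V → ℂ, ∀ x, D.ρ x e = χ x • e := by
  let : LieRing V :=
    { (inferInstance : AddCommGroup V) with
      bracket := fun x y => D.A x y
      add_lie := by intro x y z; simp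
      lie_add := by intro x y z; simp
      lie_self := D.A_self
      leibniz_lie := D.A_jacobi }
  let : LieAlgebra ℂ V :=
    { (inferInstance : Module ℂ V) with
      lie_smul := by intro c x y; exact map_smul (D.A x) c y }
  have : LieRing.IsNilpotent V := by
    rw [LieAlgebra.isNilpotent_iff_forall (R := ℂ)]
    exact D.isNilpotent_A
  have : Nontrivial F := Submodule.nontrivial_iff_ne_bot.2 hF
  obtain ⟨χ, ⟨w, hwF⟩, hw0, hw⟩ := LieHom.exists_common_eigenvector (L := V) (W := F)
    { toFun := fun x => (D.ρ x).restrict (hinv x)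
      map_add' := by intro x y; ext z; simp
      map_smul' := by intro c x; ext z; simp }
    (by
      intro x y w
      ext
      exact ρ_A hD x y w)
  have hw' : w ≠ 0 := fun h => hw0 (Subtype.ext h)
  refine ⟨(‖w‖⁻¹ : ℂ) • w, F.smul_mem _ hwF, ?_, χ, fun x => ?_⟩
  · exact_mod_cast norm_smul_inv_norm (𝕜 := ℂ) hw'
  · have := congrArg Subtype.val (hw x)
    rw [map_smul, smul_comm]
    exact congrArg _ this

/-- Eigenvectors already found are eigenvectors of the adjoints too, so the orthogonal complement of
their span is `ρ`-invariant and contains a further one. -/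
lemma exists_orthonormal_eigenvectors (k : ℕ) (hk : k ≤ Module.finrank ℂ V) :
    ∃ v : Fin k → V, Orthonormal ℂ v ∧ ∀ i, ∃ χ : V → ℂ, ∀ x, D.ρ x (v i) = χ x • v i := by
  induction k with
  | zero => exact ⟨Fin.elim0, by simp, fun i => i.elim0⟩
  | succ k ih =>
    obtain ⟨v, hv, hχ⟩ := ih (Nat.le_of_succ_le hk)
    set U := Submodule.span ℂ (Set.range v)
    have hU : Module.finrank ℂ U = k := by
      rw [finrank_span_eq_card hv.linearIndependent, Fintype.card_fin]
    have hF : Uᗮ ≠ ⊥ := by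
      intro h
      have := U.finrank_add_finrank_orthogonal
      rw [h, finrank_bot, hU] at this
      omega
    obtain ⟨e, heU, he, χ, hχe⟩ := exists_eigenvector_mem hD Uᗮ hF (by
      intro x y hy
      rw [Submodule.mem_orthogonal] at hy ⊢
      intro u hu
      rw [← inner_ρadj_left]
      apply hy
      induction hu using Submodule.span_induction with
      | mem u hu =>
        obtain ⟨i, rfl⟩ := hu
        obtain ⟨χ, hχ⟩ := hχ i
        rw [ρadj_eigenvector hD (hv.1 i) hχ]
        exact U.smul_mem _ (Submodule.subset_span ⟨i, rfl⟩)
      | zero => simp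
      | add u w _ _ hu hw => rw [map_add]; exact U.add_mem hu hw
      | smul c u _ hu => rw [map_smul]; exact U.smul_mem _ hu)
    have hperp : ∀ i, ⟪v i, e⟫_ℂ = 0 := fun i =>
      (Submodule.mem_orthogonal _ _).1 heU _ (Submodule.subset_span ⟨i, rfl⟩)
    refine ⟨Fin.snoc v e, ?_, fun i => ?_⟩
    · rw [orthonormal_iff_ite] at hv ⊢
      intro i j
      induction i using Fin.lastCases with
      | last =>
        induction j using Fin.lastCases with
        | last => simp [inner_self_eq_norm_sq_to_K, he]
        | cast j =>
          rw [Fin.snoc_last, Fin.snoc_castSucc, ← inner_conj_symm, hperp, map_zero, if_neg]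
          exact (Fin.castSucc_lt_last j).ne'
      | cast i =>
        induction j using Fin.lastCases with
        | last =>
          rw [Fin.snoc_last, Fin.snoc_castSucc, hperp, if_neg]
          exact (Fin.castSucc_lt_last i).ne
        | cast j => simp [hv i j]
    · induction i using Fin.lastCases with
      | last => exact ⟨χ, by simpa using hχe⟩
      | cast i => simpa using hχ i

lemma exists_eigenbasis : ∃ b : OrthonormalBasis (Fin (Module.finrank ℂ V)) ℂ V,
    ∃ χ : Fin (Module.finrank ℂ V) → V →ₗ[ℂ] ℂ, ∀ i x, D.ρ x (b i) = χ i x • b i := by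
  obtain ⟨v, hv, h⟩ := exists_orthonormal_eigenvectors hD _ le_rfl
  let b : OrthonormalBasis (Fin (Module.finrank ℂ V)) ℂ V := OrthonormalBasis.mk hv (by
    rw [hv.linearIndependent.span_eq_top_of_card_eq_finrank' (by simp)])
  have hb : ∀ i, b i = v i := fun i => by simp [b]
  refine ⟨b, fun i => (innerₛₗ ℂ (b i)).comp (D.ρ.flip (b i)), fun i x => ?_⟩
  obtain ⟨χ, hχ⟩ := h i
  have : χ x = ⟪b i, D.ρ x (b i)⟫_ℂ := by
    rw [hb, hχ, inner_smul_right, inner_self_eq_norm_sq_to_K, hv.1 i]; simp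
  simp only [LinearMap.comp_apply, LinearMap.flip_apply, innerₛₗ_apply_apply, ← this]
  rw [hb, hχ]

omit [FiniteDimensional ℂ V] hD in
lemma θ_eq_zero_of_parallel {z : V} (hz : ∀ y, D.Γ y z = 0) (y : V) : D.θ y z = 0 := by
  rw [θ_apply, D.br_comm, D.br_comm _ z, D.br_eq_zero_of_parallel z hz,
    D.br_eq_zero_of_parallel z hz]
  simp

omit [FiniteDimensional ℂ V] hD in
lemma A_eq_zero_of_parallel {z : V} (hz : ∀ y, D.Γ y z = 0) (y : V) : D.A z y = 0 := by
  rw [A_apply, D.br_eq_zero_of_parallel z hz, D.br_eq_zero_of_parallel, sub_zero]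
  intro w
  rw [map_smul, hz, smul_zero]

omit hD [FiniteDimensional ℂ V] in
lemma eq_zero_of_isNilpotent {f : V →ₗ[ℂ] V} (hf : IsNilpotent f) {v : V} (hv : v ≠ 0) {c : ℂ}
    (h : f v = c • v) : c = 0 := by
  obtain ⟨k, hk⟩ := hf
  have : ∀ j, (f ^ j) v = c ^ j • v := by
    intro j
    induction j with
    | zero => simp
    | succ j ih => rw [pow_succ', Module.End.mul_apply, ih, map_smul, h, smul_smul, pow_succ]
  have h' := this k
  rw [hk, LinearMap.zero_apply, eq_comm, smul_eq_zero] at h'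
  exact eq_zero_of_pow_eq_zero (h'.resolve_right hv)

section Eigenbasis

variable {ι : Type*} [Fintype ι] (b : OrthonormalBasis ι ℂ V) (χ : ι → V →ₗ[ℂ] ℂ)
  (hb : ∀ i x, D.ρ x (b i) = χ i x • b i)

include hb

lemma inner_ρ_eigenbasis (n : ι) (x v : V) : ⟪b n, D.ρ x v⟫_ℂ = χ n x * ⟪b n, v⟫_ℂ := by
  rw [← inner_ρadj_left, ρadj_eigenvector hD (b.orthonormal.1 n) (hb n), inner_smul_left]
  simp

lemma Γ_eigenbasis (i : ι) (x : V) : D.Γ x (b i) = (((χ i x).im : ℂ) * Complex.I) • b i := by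
  have h := D.two_smul_Γ x (b i)
  rw [ρadj_eigenvector hD (b.orthonormal.1 i) (hb i), hb, ← sub_smul, Complex.sub_conj] at h
  have : (2 : ℂ) • (D.Γ x (b i) - (((χ i x).im : ℂ) * Complex.I) • b i) = 0 := by
    rw [smul_sub, h, smul_smul]
    push_cast
    module
  rw [← sub_eq_zero]
  exact (smul_eq_zero.1 this).resolve_left two_ne_zero

lemma parallel_of_weight_eq_zero {n : ι} (hn : χ n = 0) (y : V) : D.Γ y (b n) = 0 := by
  rw [Γ_eigenbasis hD b χ hb, hn]; simp

lemma weight_t {μ ν : V →ₗ[ℂ] ℂ} {v w : V} (hv : ∀ x, D.ρ x v = μ x • v)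
    (hw : ∀ x, D.ρ x w = ν x • w) (x : V) : D.ρ x (D.t v w) = (μ + ν) x • D.t v w := by
  rw [ρ_t hD, hv, hw]; simp [add_smul]

lemma weight_eq_of_inner_ne_zero {μ : V →ₗ[ℂ] ℂ} {v : V} (hv : ∀ x, D.ρ x v = μ x • v) {n : ι}
    (h : ⟪b n, v⟫_ℂ ≠ 0) : χ n = μ := by
  ext x
  have := inner_ρ_eigenbasis hD b χ hb n x v
  rw [hv, inner_smul_right] at this
  exact (mul_right_cancel₀ h this).symm

lemma inner_θ_eigenbasis [DecidableEq ι] (i j n : ι) : ⟪b n, D.θ (b i) (b j)⟫_ℂ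
    = conj (⟪b j, D.t (b i) (b n)⟫_ℂ) - if j = n then conj (χ n (b i)) else 0 := by
  have : D.τ (b i) (b n) = D.ρ (b i) (b n) - D.t (b i) (b n) := by rw [ρ_eq]; abel
  rw [← inner_conj_symm, θ_adjoint, this, inner_sub_right, hb, inner_smul_right,
    b.inner_eq_ite]
  split_ifs <;> simp

/-- Since `t (b i) (b i) = 0`, the number `χ i (b i)` is an eigenvalue of the nilpotent operator `τ
(b i)`. -/
lemma weight_self (i : ι) : χ i (b i) = 0 := by
  refine eq_zero_of_isNilpotent (D.isNilpotent_τ (b i)) (v := b i) (b.orthonormal.ne_zero i) ?_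
  have h : D.t (b i) (b i) = 0 := by
    rw [t_apply', A_self]; simp
  have := D.ρ_eq (b i) (b i)
  rw [h, zero_add, hb] at this
  exact this.symm

/-- The vectors `t (b i) ^ m (b j)` have weights `χ j + m χ i`. There are finitely many weights, so
the string stops; on its last non-zero vector `τ (b i)` agrees with `ρ (b i)` and acts by `χ j (b
i)`, which nilpotency makes zero. -/
lemma weight_apply_eq_zero {i : ι} (hi : χ i ≠ 0) (j : ι) : χ j (b i) = 0 := by
  classical
  have hv : ∀ m : ℕ, ∀ x, D.ρ x ((D.t (b i) ^ m) (b j))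
      = (χ j + (m : ℂ) • χ i) x • (D.t (b i) ^ m) (b j) := by
    intro m
    induction m with
    | zero => intro x; simp [hb]
    | succ m ih =>
      intro x
      rw [pow_succ', Module.End.mul_apply, weight_t hD b χ hb (hb i) ih]
      congr 1
      simp
      ring
  have hex : ∃ m : ℕ, (D.t (b i) ^ m) (b j) = 0 := by
    by_contra! hne
    have hn : ∀ m : ℕ, ∃ n, χ n = χ j + (m : ℂ) • χ i := by
      intro m
      by_contra! hn
      apply hne m
      rw [← b.sum_repr' ((D.t (b i) ^ m) (b j))]
      refine Finset.sum_eq_zero fun n _ => ?_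
      rw [show ⟪b n, (D.t (b i) ^ m) (b j)⟫_ℂ = 0 from ?_, zero_smul]
      by_contra h
      exact hn n (weight_eq_of_inner_ne_zero hD b χ hb (hv m) h)
    choose n hn using hn
    obtain ⟨m, m', hmm, heq⟩ := Finite.exists_ne_map_eq_of_infinite n
    have h1 := hn m
    rw [heq, hn m', add_right_inj, ← sub_eq_zero, ← sub_smul, smul_eq_zero, sub_eq_zero] at h1
    exact hmm (by exact_mod_cast (h1.resolve_right hi).symm)
  obtain ⟨m, hm⟩ : ∃ m, Nat.find hex = m + 1 := by
    refine Nat.exists_eq_succ_of_ne_zero fun h => ?_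
    have := Nat.find_spec hex
    rw [h] at this
    exact b.orthonormal.ne_zero j (by simpa using this)
  have h0 : (D.t (b i) ^ (m + 1)) (b j) = 0 := hm ▸ Nat.find_spec hex
  have h1 : (D.t (b i) ^ m) (b j) ≠ 0 := Nat.find_min hex (by omega)
  refine eq_zero_of_isNilpotent (D.isNilpotent_τ (b i)) h1 ?_
  have := D.ρ_eq (b i) ((D.t (b i) ^ m) (b j))
  rw [← Module.End.mul_apply (D.t (b i)), ← pow_succ', h0, zero_add, hv] at this
  rw [← this]
  simp [weight_self hD b χ hb]

/-- The weight `χ i + χ n` of `t (b i) (b n)` differs from `χ i`, so this vector has no component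
along `b i`. -/
lemma inner_θ_self_eq_zero {n : ι} (hn : χ n ≠ 0) (i : ι) : ⟪b n, D.θ (b i) (b i)⟫_ℂ = 0 := by
  classical
  rw [inner_θ_eigenbasis hD b χ hb]
  have h1 : ⟪b i, D.t (b i) (b n)⟫_ℂ = 0 := by
    by_contra h
    have := weight_eq_of_inner_ne_zero hD b χ hb (weight_t hD b χ hb (hb i) (hb n)) h
    exact hn (by simpa using this)
  rw [h1]
  split_ifs with h
  · subst h; simp [weight_self hD b χ hb]
  · simp

/-- Checked on each `b n`. If `χ n = 0`, then `b n` is parallel, `A (b n) = 0`, and the formula is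
`ρ_eq'` with `θ_adjoint`; otherwise both sides vanish. -/
lemma weight_eq_neg_inner (k : ι) (v : V) : χ k v = -⟪D.θ (b k) (b k), v⟫_ℂ := by
  have hkey : ∀ v, (∀ y, D.A v y = 0) → χ k v = -⟪D.θ (b k) (b k), v⟫_ℂ := by
    intro v hv
    have h := inner_ρ_eigenbasis hD b χ hb k v (b k)
    rw [ρ_eq', hv, zero_add, inner_self_eq_norm_sq_to_K, b.orthonormal.1 k] at h
    rw [θ_adjoint, neg_neg, h]
    simp
  conv_lhs => rw [← b.sum_repr' v]
  conv_rhs => rw [← b.sum_repr' v]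
  rw [map_sum, inner_sum, ← Finset.sum_neg_distrib]
  refine Finset.sum_congr rfl fun n _ => ?_
  rw [map_smul, inner_smul_right]
  by_cases hn : χ n = 0
  · rw [hkey _ (A_eq_zero_of_parallel (parallel_of_weight_eq_zero hD b χ hb hn))]
    simp
  · have h0 : ⟪D.θ (b k) (b k), b n⟫_ℂ = 0 := by
      rw [← inner_conj_symm, inner_θ_self_eq_zero hD b χ hb hn, map_zero]
    rw [weight_apply_eq_zero hD b χ hb hn, h0]
    simp

/-- The diagonal operators `Γ x` commute, so `R x y = -Γ [x, y]` on the basis. The `b k` component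
of the Bianchi identity for `b i`, `I b i`, `b k` then gives `Im χ k [b i, I b i] = 0`. -/
lemma re_inner_θ_self {i k : ι} (hik : i ≠ k) :
    (⟪D.θ (b k) (b k), D.θ (b i) (b i)⟫_ℂ).re = 0 := by
  have hθ : ∀ x, D.br x (Complex.I • x) = Complex.I • D.θ x x := by
    intro x
    rw [θ_apply, D.br_self, zero_add, I_smul_I_smul, D.br_comm]
  have hR : ∀ x y j, D.R x y (b j) = -D.Γ (D.br x y) (b j) := by
    intro x y j
    rw [R_apply, Γ_eigenbasis hD b χ hb j y, Γ_eigenbasis hD b χ hb j x, map_smul, map_smul,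
      Γ_eigenbasis hD b χ hb j y, Γ_eigenbasis hD b χ hb j x]
    module
  have h := hD (b i) (Complex.I • b i) (b k)
  rw [map_smul, hR, hR, hR, Γ_eigenbasis hD b χ hb, Γ_eigenbasis hD b χ hb,
    Γ_eigenbasis hD b χ hb, hθ] at h
  have h2 := congrArg (fun v => ⟪b k, v⟫_ℂ) h
  have hbi : ⟪b k, b i⟫_ℂ = 0 := b.orthonormal.2 hik.symm
  have hbk : ⟪b k, b k⟫_ℂ = 1 := by
    rw [inner_self_eq_norm_sq_to_K, b.orthonormal.1 k]; simp
  simp only [inner_add_right, inner_neg_right, inner_smul_right, hbi, hbk, inner_zero_right,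
    mul_zero, neg_zero, add_zero, mul_one, neg_eq_zero, mul_eq_zero, Complex.I_ne_zero, or_false,
    Complex.ofReal_eq_zero] at h2
  rw [map_smul, weight_eq_neg_inner hD b χ hb] at h2
  simpa using h2

/-- A non-zero component along `b n` forces `χ n = χ i + χ k`, so `θ (b n) (b n)` is the sum of the
corresponding vectors for `i` and `k`. Its orthogonality to the one for `i` makes the latter, hence
`χ i`, zero. -/
lemma t_eigenbasis_eq_zero {i k : ι} (hi : χ i ≠ 0) (hk : χ k ≠ 0) : D.t (b i) (b k) = 0 := by
  have hq : ∀ {j}, χ j ≠ 0 → D.θ (b j) (b j) ≠ 0 := by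
    intro j hj h0
    apply hj
    ext v
    rw [weight_eq_neg_inner hD b χ hb, h0]
    simp
  by_cases hik : i = k
  · subst hik
    rw [t_apply', A_self]; simp
  rw [← b.sum_repr' (D.t (b i) (b k))]
  refine Finset.sum_eq_zero fun n _ => ?_
  rw [show ⟪b n, D.t (b i) (b k)⟫_ℂ = 0 from ?_, zero_smul]
  by_contra h
  have hw := weight_eq_of_inner_ne_zero hD b χ hb (weight_t hD b χ hb (hb i) (hb k)) h
  have hni : n ≠ i := by rintro rfl; exact hk (by simpa using hw)
  have hsum : D.θ (b n) (b n) = D.θ (b i) (b i) + D.θ (b k) (b k) := by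
    refine ext_inner_right ℂ fun v => ?_
    have := LinearMap.congr_fun hw v
    rw [LinearMap.add_apply, weight_eq_neg_inner hD b χ hb, weight_eq_neg_inner hD b χ hb,
      weight_eq_neg_inner hD b χ hb] at this
    rw [inner_add_left]
    linear_combination -this
  have h1 := re_inner_θ_self hD b χ hb hni.symm
  rw [hsum, inner_add_left, Complex.add_re, re_inner_θ_self hD b χ hb hik, add_zero] at h1
  apply hq hi
  rw [← inner_self_eq_zero (𝕜 := ℂ)]
  apply Complex.ext
  · simpa using h1
  · simp [inner_self_eq_norm_sq_to_K, ← Complex.ofReal_pow]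

/-- A vector of weight zero is parallel, hence central. If both weights are non-zero, then `t (b i)
(b k)`, `χ k (b i)` and `χ i (b k)` all vanish. -/
lemma A_eigenbasis (i k : ι) : D.A (b i) (b k) = 0 := by
  by_cases hi : χ i = 0
  · exact A_eq_zero_of_parallel (parallel_of_weight_eq_zero hD b χ hb hi) _
  by_cases hk : χ k = 0
  · rw [A_comm, A_eq_zero_of_parallel (parallel_of_weight_eq_zero hD b χ hb hk), neg_zero]
  have := D.t_apply' (b i) (b k)
  rw [t_eigenbasis_eq_zero hD b χ hb hi hk, hb, hb, weight_apply_eq_zero hD b χ hb hi,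
    weight_apply_eq_zero hD b χ hb hk] at this
  simpa using this.symm

lemma A_eq_zero (x y : V) : D.A x y = 0 := by
  have h : D.A = 0 := by
    refine b.toBasis.ext fun i => b.toBasis.ext fun k => ?_
    simpa using A_eigenbasis hD b χ hb i k
  rw [h]; rfl

lemma θ_eigenbasis {i j : ι} (hij : i ≠ j) : D.θ (b i) (b j) = 0 := by
  classical
  by_cases hi : χ i = 0
  · rw [θ_apply, D.br_eq_zero_of_parallel _ (parallel_of_weight_eq_zero hD b χ hb hi),
      D.br_eq_zero_of_parallel, smul_zero, add_zero]
    intro y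
    rw [map_smul, parallel_of_weight_eq_zero hD b χ hb hi, smul_zero]
  rw [← b.sum_repr' (D.θ (b i) (b j))]
  refine Finset.sum_eq_zero fun n _ => ?_
  rw [show ⟪b n, D.θ (b i) (b j)⟫_ℂ = 0 from ?_, zero_smul]
  rw [inner_θ_eigenbasis hD b χ hb, weight_apply_eq_zero hD b χ hb hi]
  by_cases hn : χ n = 0
  · rw [t_apply', A_eq_zero hD b χ hb, hb, hb, hn]
    have : ⟪b j, b i⟫_ℂ = 0 := b.orthonormal.2 hij.symm
    simp [inner_smul_right, this]
  · rw [t_eigenbasis_eq_zero hD b χ hb hi hn]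
    simp

end Eigenbasis

/-- The structure of nilpotent Lie algebras with a Hermitian structure whose Strominger connection
is Kähler-like. -/
theorem exists_normal_basis : ∃ (b : OrthonormalBasis (Fin (Module.finrank ℂ V)) ℂ V)
    (q : Fin (Module.finrank ℂ V) → V),
    (∀ i j, D.br (b i) (b j) = 0) ∧ (∀ i j, D.br (Complex.I • b i) (Complex.I • b j) = 0) ∧
    (∀ i j, i ≠ j → D.br (b i) (Complex.I • b j) = 0) ∧
    (∀ i, D.br (b i) (Complex.I • b i) = q i) ∧
    (∀ i j, i ≠ j → (⟪q i, q j⟫_ℂ).re = 0) ∧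
    (∀ i j, q i ≠ 0 → ⟪b i, q j⟫_ℂ = 0) := by
  obtain ⟨b, χ, hb⟩ := exists_eigenbasis hD
  have hA : ∀ x y, D.br (Complex.I • x) (Complex.I • y) = D.br x y := fun x y => by
    have := D.A_apply x y
    rw [A_eq_zero hD b χ hb] at this
    exact (sub_eq_zero.1 this.symm).symm
  have hθ : ∀ x, D.br x (Complex.I • x) = Complex.I • D.θ x x := by
    intro x
    rw [θ_apply, D.br_self, zero_add, I_smul_I_smul, D.br_comm]
  -- `θ (b i) (b j) = 0` and `θ (b j) (b i) = 0` express the same bracket with opposite signs, so it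
  -- vanishes.
  have h1 : ∀ i j, i ≠ j → D.br (b i) (b j) = Complex.I • D.br (b i) (Complex.I • b j) := by
    intro i j hij
    have h := θ_eigenbasis hD b χ hb hij
    have h' := hA (Complex.I • b i) (b j)
    rw [I_smul_I_smul, map_neg, LinearMap.neg_apply] at h'
    rw [θ_apply, ← h', smul_neg] at h
    exact add_neg_eq_zero.1 h
  have h2 : ∀ i j, i ≠ j → D.br (b i) (b j) = -(Complex.I • D.br (b i) (Complex.I • b j)) := by
    intro i j hij
    have h := θ_eigenbasis hD b χ hb hij.symm
    rw [θ_apply, D.br_comm, D.br_comm _ (b i), smul_neg] at h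
    rw [← sub_eq_zero, sub_neg_eq_add, ← neg_eq_zero, neg_add]
    exact h
  have h3 : ∀ i j, D.br (b i) (b j) = 0 := by
    intro i j
    by_cases hij : i = j
    · rw [hij, D.br_self]
    · have h := h2 i j hij
      rw [← h1 i j hij] at h
      rw [eq_neg_iff_add_eq_zero, ← two_smul ℂ] at h
      exact (smul_eq_zero.1 h).resolve_left two_ne_zero
  refine ⟨b, fun i => Complex.I • D.θ (b i) (b i), h3, fun i j => by rw [hA, h3],
    fun i j hij => ?_, fun i => hθ _, fun i j hij => ?_, fun i j hi => ?_⟩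
  · have h := h1 i j hij
    rw [h3, eq_comm, smul_eq_zero] at h
    exact h.resolve_left Complex.I_ne_zero
  · have := re_inner_θ_self hD b χ hb hij.symm
    simpa [inner_smul_left, inner_smul_right, ← mul_assoc] using this
  · have hi' : χ i ≠ 0 := by
      intro h
      apply hi
      dsimp only
      rw [θ_eq_zero_of_parallel (parallel_of_weight_eq_zero hD b χ hb h), smul_zero]
    rw [inner_smul_right, inner_θ_self_eq_zero hD b χ hb hi', mul_zero]

end StromingerLieData

end

/-! ### Compatible metric and complex structure as a Hermitian space -/

section

/-- `B` is a positive definite symmetric form on `L` for which the complex structure `J` is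
orthogonal. -/
structure IsHermitianPair {L : Type*} [AddCommGroup L] [Module ℝ L] (B : L →ₗ[ℝ] L →ₗ[ℝ] ℝ)
    (J : L →ₗ[ℝ] L) : Prop where
  symm : ∀ x y, B x y = B y x
  pos : ∀ x, x ≠ 0 → 0 < B x x
  sq : ∀ x, J (J x) = -x
  orth : ∀ x y, B (J x) (J y) = B x y

namespace IsHermitianPair

variable {L : Type*} [AddCommGroup L] [Module ℝ L] {B : L →ₗ[ℝ] L →ₗ[ℝ] ℝ} {J : L →ₗ[ℝ] L}

lemma apply_J_left (h : IsHermitianPair B J) (x y : L) : B (J x) y = -B x (J y) := by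
  have := h.orth x (J y)
  rw [h.sq, map_neg] at this
  linarith

lemma eq_zero_of_forall (h : IsHermitianPair B J) {x : L} (hx : ∀ y, B x y = 0) : x = 0 := by
  by_contra hne
  exact (h.pos x hne).ne' (hx x)

lemma ext_left (h : IsHermitianPair B J) {x y : L} (hxy : ∀ z, B x z = B y z) : x = y := by
  rw [← sub_eq_zero]
  exact h.eq_zero_of_forall fun z => by rw [map_sub, LinearMap.sub_apply, hxy, sub_self]

theorem exists_unitary [FiniteDimensional ℝ L] (h : IsHermitianPair B J) {n : ℕ}
    (hn : Module.finrank ℝ L = 2 * n) :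
    ∃ Φ : L ≃ₗ[ℝ] EuclideanSpace ℂ (Fin n), (∀ x, Φ (J x) = Complex.I • Φ x) ∧
      ∀ x y, (⟪Φ x, Φ y⟫_ℂ).re = B x y := by
  have hJJ : J * J = (-1 : Module.End ℝ L) := by
    ext x
    simpa using h.sq x
  let act : Module ℂ L := Module.compHom L (Complex.liftAux J hJJ).toRingHom
  have hsmul : ∀ (c : ℂ) (x : L), c • x = c.re • x + c.im • J x := by
    intro c x
    change (Complex.liftAux J hJJ c) x = _
    rw [Complex.liftAux_apply]
    simp [Algebra.algebraMap_eq_smul_one]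
  have : IsScalarTower ℝ ℂ L := ⟨fun r c x => by simp [hsmul, smul_add, smul_smul]⟩
  let core : InnerProductSpace.Core ℂ L :=
    -- The sign of the imaginary part makes the form conjugate-linear in its first argument.
    { inner := fun x y => ⟨B x y, B (J x) y⟩
      conj_inner_symm := fun x y => by
        apply Complex.ext
        · exact h.symm y x
        · change -B (J y) x = B (J x) y
          rw [h.apply_J_left x y, h.symm]
      re_inner_nonneg := fun x => by
        change 0 ≤ B x x
        by_cases hx : x = 0
        · simp [hx]
        · exact (h.pos x hx).le
      add_left := fun x y z => by
        apply Complex.ext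
        · change B (x + y) z = B x z + B y z
          simp
        · change B (J (x + y)) z = B (J x) z + B (J y) z
          simp
      smul_left := fun x y c => by
        apply Complex.ext
        · change B (c • x) y = _
          simp [hsmul]
        · change B (J (c • x)) y = _
          simp [hsmul, h.sq]
      definite := fun x hx => by
        by_contra hne
        exact (h.pos x hne).ne' (congrArg Complex.re hx) }
  let : NormedAddCommGroup L := core.toNormedAddCommGroup
  let : InnerProductSpace ℂ L := InnerProductSpace.ofCore core.toCore
  have : FiniteDimensional ℂ L := FiniteDimensional.right ℝ ℂ L
  have hfin : Module.finrank ℂ L = n := by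
    have := Module.finrank_mul_finrank ℝ ℂ L
    rw [hn, Complex.finrank_real_complex] at this
    omega
  let e := ((stdOrthonormalBasis ℂ L).reindex (finCongr hfin)).repr
  refine ⟨{ e.toLinearEquiv with map_smul' := fun r x => ?_ }, fun x => ?_, fun x y => ?_⟩
  · change e (r • x) = r • e x
    have : r • x = (r : ℂ) • x := by simp [hsmul]
    rw [this, map_smul, Complex.coe_smul]
  · change e (J x) = Complex.I • e x
    rw [← map_smul, hsmul]
    simp
  · change (⟪e x, e y⟫_ℂ).re = B x y
    rw [e.inner_map_map]
    rfl

end IsHermitianPair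

end

/-! ### Uniqueness of the algebraic Strominger connection -/

section

/-- `Γ` is the Strominger connection, on left-invariant fields, of the metric `B` and the complex
structure `J` on a Lie algebra. -/
structure IsStromingerForm {L : Type*} [LieRing L] [LieAlgebra ℝ L] (B : L →ₗ[ℝ] L →ₗ[ℝ] ℝ)
    (J : L →ₗ[ℝ] L) (Γ : L →ₗ[ℝ] L →ₗ[ℝ] L) : Prop where
  skew : ∀ x y z, B (Γ x y) z = -B y (Γ x z)
  comm : ∀ x y, Γ x (J y) = J (Γ x y)
  torsion_skew : ∀ x y z, B (Γ x y - Γ y x - ⁅x, y⁆) z = -B (Γ x z - Γ z x - ⁅x, z⁆) y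

/-- The curvature of a left-invariant connection is `R(x, y) = [Γ x, Γ y] - Γ [x, y]`. -/
def invariantCurvature {L : Type*} [LieRing L] [LieAlgebra ℝ L] (Γ : L →ₗ[ℝ] L →ₗ[ℝ] L)
    (x y z : L) : L :=
  Γ x (Γ y z) - Γ y (Γ x z) - Γ ⁅x, y⁆ z

variable {L : Type*} [LieRing L] [LieAlgebra ℝ L] {B : L →ₗ[ℝ] L →ₗ[ℝ] ℝ} {J : L →ₗ[ℝ] L}

/-- The difference of two such connections is a totally skew trilinear form for which moving `J` to
another slot costs a sign. Moving it once around the three slots gives the form with a `J` inserted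
equal to its own negative. -/
theorem IsStromingerForm.unique (h : IsHermitianPair B J) {Γ Γ' : L →ₗ[ℝ] L →ₗ[ℝ] L}
    (hΓ : IsStromingerForm B J Γ) (hΓ' : IsStromingerForm B J Γ') : Γ = Γ' := by
  set b : L → L → L → ℝ := fun x y z => B (Γ x y) z - B (Γ' x y) z with hb
  have h1 : ∀ x y z, b x y z = -b x z y := by
    intro x y z
    simp only [hb]
    rw [hΓ.skew, hΓ'.skew, h.symm y, h.symm y]
    ring
  have h2 : ∀ x y z, b y x z = -b z x y := by
    intro x y z
    have e1 := hΓ.torsion_skew x y z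
    have e2 := hΓ'.torsion_skew x y z
    have e3 := h1 x y z
    simp only [hb, map_sub, LinearMap.sub_apply] at *
    linarith
  have hJ : ∀ x y z, b x (J y) z = -b x y (J z) := by
    intro x y z
    simp only [hb]
    rw [hΓ.comm, hΓ'.comm, h.apply_J_left, h.apply_J_left]
    ring
  have h3 : ∀ x y z, b x y z = 0 := by
    have key : ∀ x y z, b x y (J z) = 0 := by
      intro x y z
      have e2 := h1 x y (J z)
      have e3 := hJ x z y
      have e4 := h2 y (J x) z
      have e5 := hJ z y x
      have e7 := h2 z x (J y)
      have e8 := h2 y x (J z)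
      have e9 := h1 (J z) y x
      have e10 := h2 x (J z) y
      have e12 := hJ y x z
      have e13 := h1 y (J x) z
      have e14 := h1 (J y) x z
      have e16 := h1 z x (J y)
      have e18 := h2 x (J y) z
      have e19 := h2 z y (J x)
      have e20 := h1 (J x) y z
      linarith
    intro x y z
    have := key x y (-J z)
    rwa [map_neg, h.sq, neg_neg] at this
  refine LinearMap.ext fun x => LinearMap.ext fun y => h.ext_left fun z => ?_
  exact sub_eq_zero.1 (h3 x y z)

lemma real_span_sup_map_smul {V : Type*} [AddCommGroup V] [Module ℂ V] (T : Set V)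
    (I' : V →ₗ[ℝ] V) (hI : ∀ x, I' x = Complex.I • x) :
    Submodule.span ℝ T ⊔ (Submodule.span ℝ T).map I'
      = (Submodule.span ℂ T).restrictScalars ℝ := by
  apply le_antisymm
  · refine sup_le (Submodule.span_le_restrictScalars ℝ ℂ T) ?_
    rw [Submodule.map_span, Submodule.span_le]
    rintro _ ⟨x, hx, rfl⟩
    rw [hI]
    exact Submodule.smul_mem _ _ (Submodule.subset_span hx)
  · intro x (hx : x ∈ Submodule.span ℂ T)
    induction hx using Submodule.span_induction with
    | mem x h => exact Submodule.mem_sup_left (Submodule.subset_span h)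
    | zero => exact Submodule.zero_mem _
    | add x y hx hy ihx ihy => exact Submodule.add_mem _ ihx ihy
    | smul c x hx ih =>
      rw [Complex.smul_eq_re_add_im]
      refine Submodule.add_mem _ (Submodule.smul_mem _ _ ih) (Submodule.smul_mem _ _ ?_)
      obtain ⟨y, hy, z, hz, rfl⟩ := Submodule.mem_sup.1 ih
      obtain ⟨w, hw, rfl⟩ := hz
      rw [smul_add, hI, smul_smul, Complex.I_mul_I, neg_one_smul]
      refine Submodule.add_mem _ (Submodule.mem_sup_right ⟨y, hy, hI y⟩) ?_
      exact Submodule.mem_sup_left (Submodule.neg_mem _ hw)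

end

/-! ### Transport of the structure theorem to the Lie algebra -/

section

variable {L : Type*} [LieRing L] [LieAlgebra ℝ L] {B : L →ₗ[ℝ] L →ₗ[ℝ] ℝ} {J : L →ₗ[ℝ] L}

/-- The transport of a Strominger connection on a nilpotent Lie algebra with complex structure to
a Hermitian vector space. -/
def IsStromingerForm.toLieData [LieRing.IsNilpotent L] {Γ : L →ₗ[ℝ] L →ₗ[ℝ] L}
    (hΓ : IsStromingerForm B J Γ)
    (hnij : ∀ x y : L, ⁅J x, J y⁆ = ⁅x, y⁆ + J (⁅J x, y⁆ + ⁅x, J y⁆))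
    {V : Type*} [NormedAddCommGroup V] [InnerProductSpace ℂ V] (Φ : L ≃ₗ[ℝ] V)
    (hΦJ : ∀ x, Φ (J x) = Complex.I • Φ x) (hΦB : ∀ x y, (⟪Φ x, Φ y⟫_ℂ).re = B x y) :
    StromingerLieData V :=
  have hI : ∀ v, Φ.symm (Complex.I • v) = J (Φ.symm v) := fun v => by
    rw [LinearEquiv.symm_apply_eq, hΦJ, LinearEquiv.apply_symm_apply]
  have hB : ∀ x v, (⟪Φ x, v⟫_ℂ).re = B x (Φ.symm v) := fun x v => by
    rw [← hΦB, LinearEquiv.apply_symm_apply]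
  { br := LinearMap.mk₂ ℝ (fun v w => Φ ⁅Φ.symm v, Φ.symm w⁆) (by simp) (by simp) (by simp)
      (by simp)
    br_self := fun x => by simp
    jacobi := fun x y z => by simp
    nijenhuis := fun x y => by
      simp only [LinearMap.mk₂_apply, hI, hnij, map_add, hΦJ, smul_add]
    chain := fun k => (LieModule.lowerCentralSeries ℝ L L k).toSubmodule.map (Φ : L →ₗ[ℝ] V)
    chain_zero := by simp
    br_mem_chain := fun k x y hy => by
      obtain ⟨z, hz, rfl⟩ := hy
      refine ⟨⁅Φ.symm x, z⁆, ?_, by simp⟩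
      rw [LieModule.lowerCentralSeries_succ]
      exact LieSubmodule.lie_mem_lie (LieSubmodule.mem_top _) hz
    chain_eventually := by
      obtain ⟨k, hk⟩ := LieModule.IsNilpotent.nilpotent ℝ L L
      exact ⟨k, by simp [hk]⟩
    Γ :=
      { toFun := fun v => LinearMap.toComplexLinear
          (Φ.toLinearMap ∘ₗ Γ (Φ.symm v) ∘ₗ Φ.symm.toLinearMap)
          (fun w => by simp [hI, hΓ.comm, hΦJ])
        map_add' := fun v w => LinearMap.ext fun u => by
          simp [LinearMap.toComplexLinear]
        map_smul' := fun r v => LinearMap.ext fun u => by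
          simp [LinearMap.toComplexLinear] }
    Γ_skew := fun x y z => by
      have key : ∀ y z, (⟪Φ (Γ (Φ.symm x) (Φ.symm y)), z⟫_ℂ).re
          = -(⟪y, Φ (Γ (Φ.symm x) (Φ.symm z))⟫_ℂ).re := fun y z => by
        rw [hB, hΓ.skew, ← hΦB, LinearEquiv.apply_symm_apply]
      change ⟪Φ (Γ (Φ.symm x) (Φ.symm y)), z⟫_ℂ = -⟪y, Φ (Γ (Φ.symm x) (Φ.symm z))⟫_ℂ
      apply Complex.ext
      · exact key y z
      · have := key y (Complex.I • z)
        rw [hI, hΓ.comm, hΦJ, inner_smul_right, inner_smul_right] at this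
        simp only [Complex.mul_re, Complex.I_re, Complex.I_im, zero_mul, one_mul, zero_sub] at this
        rw [Complex.neg_im]
        linarith
    torsion_skew := fun x y z => by
      have key : ∀ y z, (⟪Φ (Γ (Φ.symm x) (Φ.symm y)) - Φ (Γ (Φ.symm y) (Φ.symm x))
          - Φ ⁅Φ.symm x, Φ.symm y⁆, z⟫_ℂ).re = B (Γ (Φ.symm x) (Φ.symm y)
            - Γ (Φ.symm y) (Φ.symm x) - ⁅Φ.symm x, Φ.symm y⁆) (Φ.symm z) := fun y z => by
        rw [← map_sub, ← map_sub, hB]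
      exact (key y z).trans ((hΓ.torsion_skew _ _ _).trans (congrArg Neg.neg (key z y).symm)) }

theorem IsStromingerForm.exists_normal_basis [FiniteDimensional ℝ L] [LieRing.IsNilpotent L]
    {Γ : L →ₗ[ℝ] L →ₗ[ℝ] L} (h : IsHermitianPair B J) (hΓ : IsStromingerForm B J Γ)
    (hnij : ∀ x y : L, ⁅J x, J y⁆ = ⁅x, y⁆ + J (⁅J x, y⁆ + ⁅x, J y⁆))
    (hR : ∀ x y z, invariantCurvature Γ x y z + invariantCurvature Γ y z x
      + invariantCurvature Γ z x y = 0)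
    {n : ℕ} (hn : Module.finrank ℝ L = 2 * n) :
    ∃ (Φ : L ≃ₗ[ℝ] EuclideanSpace ℂ (Fin n))
      (b : OrthonormalBasis (Fin n) ℂ (EuclideanSpace ℂ (Fin n)))
      (q : Fin n → EuclideanSpace ℂ (Fin n)),
      (∀ x, Φ (J x) = Complex.I • Φ x) ∧ (∀ x y, (⟪Φ x, Φ y⟫_ℂ).re = B x y) ∧
      (∀ x y, Φ ⁅x, y⁆ = ∑ k, ((⟪b k, Φ x⟫_ℂ).re * (⟪b k, Φ y⟫_ℂ).im
        - (⟪b k, Φ x⟫_ℂ).im * (⟪b k, Φ y⟫_ℂ).re) • q k) ∧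
      (∀ i j, i ≠ j → (⟪q i, q j⟫_ℂ).re = 0) ∧ (∀ i j, q i ≠ 0 → ⟪b i, q j⟫_ℂ = 0) := by
  obtain ⟨Φ, hΦJ, hΦB⟩ := h.exists_unitary hn
  set D := hΓ.toLieData hnij Φ hΦJ hΦB with hD
  have hbr : ∀ v w, D.br v w = Φ ⁅Φ.symm v, Φ.symm w⁆ := fun v w => rfl
  have hDΓ : ∀ v w, D.Γ v w = Φ (Γ (Φ.symm v) (Φ.symm w)) := fun v w => rfl
  have hK : D.IsKahlerLike := by
    intro x y z
    have := congrArg Φ (hR (Φ.symm x) (Φ.symm y) (Φ.symm z))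
    simpa [StromingerLieData.R_apply, hDΓ, hbr, invariantCurvature] using this
  obtain ⟨b, q, h1, h2, h3, h4, h5, h6⟩ := StromingerLieData.exists_normal_basis hK
  have hfin : Module.finrank ℂ (EuclideanSpace ℂ (Fin n)) = n := by simp
  have hb : ∀ i, b.reindex (finCongr hfin) i = b ((finCongr hfin).symm i) := fun i => by simp
  refine ⟨Φ, b.reindex (finCongr hfin), q ∘ (finCongr hfin).symm, hΦJ, hΦB, fun x y => ?_,
    fun i j hij => h5 _ _ (by simpa using hij), fun i j hi => by rw [hb]; exact h6 _ _ hi⟩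
  have h3' : ∀ i j, i ≠ j → D.br (Complex.I • b i) (b j) = 0 := fun i j hij => by
    rw [D.br_comm, h3 j i hij.symm, neg_zero]
  have hxy : Φ ⁅x, y⁆ = D.br (Φ x) (Φ y) := by simp [hbr]
  have hexp : ∀ v, v = ∑ i, ((⟪b i, v⟫_ℂ).re • b i + (⟪b i, v⟫_ℂ).im • Complex.I • b i) := by
    intro v
    conv_lhs => rw [← b.sum_repr' v]
    exact Finset.sum_congr rfl fun i _ => Complex.smul_eq_re_add_im _ _
  rw [hxy, ← (finCongr hfin).sum_comp]
  simp only [hb, Function.comp_apply, Equiv.symm_apply_apply]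
  conv_lhs => rw [hexp (Φ x), hexp (Φ y)]
  simp only [map_sum, LinearMap.sum_apply]
  refine Finset.sum_congr rfl fun i _ => ?_
  rw [Finset.sum_eq_single i]
  · simp only [map_add, LinearMap.add_apply, map_smul, LinearMap.smul_apply, h1, h2, h4,
      D.br_comm (Complex.I • b i) (b i), smul_zero, zero_add, add_zero, smul_neg]
    module
  · intro j _ hj
    simp [h1, h2, h3 j i hj, h3' j i hj]
  · simp

end

/-! ### Adapted bases and existence of the normal form -/

section

/-- In a Hermitian space with orthonormal basis `b`, the vectors `b i` orthogonal to a given subspace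
can be completed, together with a basis of that subspace, to an adapted orthonormal basis. -/
theorem OrthonormalBasis.exists_adapted {V : Type*} [NormedAddCommGroup V] [InnerProductSpace ℂ V]
    [FiniteDimensional ℂ V] {n s : ℕ} (hn : Module.finrank ℂ V = n) (c : Fin s → V)
    (hc : Orthonormal ℂ c) (N : Submodule ℂ V) (hcN : ∀ i, ∀ x ∈ N, ⟪c i, x⟫_ℂ = 0) :
    ∃ (r : ℕ) (hs : s ≤ n) (e : OrthonormalBasis (Fin n) ℂ V), r ≤ n ∧
      (∀ i, e (Fin.castLE hs i) = c i) ∧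
      Submodule.span ℂ {v | ∃ i : Fin n, r ≤ i.val ∧ v = e i} = N := by
  have hdim : Module.finrank ℂ N + Module.finrank ℂ Nᗮ = n := by
    rw [Submodule.finrank_add_finrank_orthogonal, hn]
  have hc' : ∀ i, c i ∈ Nᗮ := fun i => by
    rw [Submodule.mem_orthogonal']
    exact hcN i
  have hsd : s ≤ Module.finrank ℂ Nᗮ := by
    have h : LinearIndependent ℂ (fun i => (⟨c i, hc' i⟩ : Nᗮ)) :=
      LinearIndependent.of_comp Nᗮ.subtype hc.linearIndependent
    simpa using h.fintype_card_le_finrank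
  set d := Module.finrank ℂ N with hd
  set r := Module.finrank ℂ Nᗮ with hr
  have hs : s ≤ n := by omega
  let u := stdOrthonormalBasis ℂ N
  let v : Fin n → V := fun i => if h : i.val < s then c ⟨i, h⟩ else
    if h' : r ≤ i.val then (u ⟨i.val - r, by omega⟩ : V) else 0
  have hv1 : ∀ (i : Fin n) (h : i.val < s), v i = c ⟨i, h⟩ := fun i h => by simp [v, h]
  have hv2 : ∀ (i : Fin n) (h : r ≤ i.val), v i = u ⟨i.val - r, by omega⟩ := fun i h => by
    simp [v, h, show ¬ i.val < s by omega]
  have horth : Orthonormal ℂ ({i : Fin n | i.val < s ∨ r ≤ i.val}.domRestrict v) := by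
    rw [orthonormal_iff_ite]
    rintro ⟨i, hi⟩ ⟨j, hj⟩
    simp only [Set.domRestrict_apply, Subtype.mk.injEq]
    have hcc := orthonormal_iff_ite.1 hc
    have huu := orthonormal_iff_ite.1 u.orthonormal
    rcases hi with hi | hi <;> rcases hj with hj | hj
    · rw [hv1 i hi, hv1 j hj, hcc]
      simp [Fin.ext_iff]
    · rw [hv1 i hi, hv2 j hj, hcN _ _ (Subtype.coe_prop _), if_neg]
      rintro rfl
      omega
    · rw [hv2 i hi, hv1 j hj, ← inner_conj_symm, hcN _ _ (Subtype.coe_prop _), map_zero, if_neg]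
      rintro rfl
      omega
    · rw [hv2 i hi, hv2 j hj, ← Submodule.coe_inner, huu]
      simp only [Fin.ext_iff]
      congr 1
      apply propext
      omega
  obtain ⟨e, he⟩ := horth.exists_orthonormalBasis_extension_of_card_eq (by simp [hn])
  refine ⟨r, hs, e, by omega, fun i => ?_, le_antisymm ?_ ?_⟩
  · rw [he _ (Or.inl i.isLt), hv1 _ i.isLt]
    rfl
  · rw [Submodule.span_le]
    rintro _ ⟨i, hi, rfl⟩
    rw [he i (Or.inr hi), hv2 i hi]
    exact Subtype.coe_prop _
  · intro x hx
    have hsum : x = ∑ j, (u.repr ⟨x, hx⟩ j) • (u j : V) := by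
      have := congrArg N.subtype (u.sum_repr ⟨x, hx⟩)
      simpa using this.symm
    rw [hsum]
    refine Submodule.sum_mem _ fun j _ => Submodule.smul_mem _ _ (Submodule.subset_span ?_)
    have hj := j.isLt
    refine ⟨⟨j.val + r, by omega⟩, by simp, ?_⟩
    rw [he _ (Or.inr (by simp)), hv2 _ (by simp)]
    simp

variable {L : Type*} [LieRing L] [LieAlgebra ℝ L] {B : L →ₗ[ℝ] L →ₗ[ℝ] ℝ} {J : L →ₗ[ℝ] L}

/-- The derived algebra, as a subspace. -/
abbrev LieAlgebra.derivedSubmodule (L : Type*) [LieRing L] [LieAlgebra ℝ L] : Submodule ℝ L :=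
  (⁅(⊤ : LieIdeal ℝ L), (⊤ : LieIdeal ℝ L)⁆).toSubmodule

lemma LieAlgebra.lie_mem_derivedSubmodule (x y : L) : ⁅x, y⁆ ∈ LieAlgebra.derivedSubmodule L :=
  LieSubmodule.lie_mem_lie (LieSubmodule.mem_top x) (LieSubmodule.mem_top y)

lemma LieAlgebra.derivedSubmodule_le {W : Submodule ℝ L} (h : ∀ x y : L, ⁅x, y⁆ ∈ W) :
    LieAlgebra.derivedSubmodule L ≤ W := by
  rw [LieAlgebra.derivedSubmodule, LieSubmodule.lieIdeal_oper_eq_linear_span, Submodule.span_le]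
  rintro _ ⟨x, y, rfl⟩
  exact h _ _

/-- A Lie algebra `L` with inner product `B` and complex structure `J` has a basis in normal form with
parameters `r` and `s`. -/
def LieHasNormalForm (B : L →ₗ[ℝ] L →ₗ[ℝ] ℝ) (J : L →ₗ[ℝ] L) (n r s : ℕ) : Prop :=
  r ≤ n ∧ ∃ (hs : s ≤ n) (ε : Module.Basis (Fin n ⊕ Fin n) ℝ L)
    (X : Fin s → L) (lam : Fin s → ℝ),
    (∀ a b : Fin n ⊕ Fin n, B (ε a) (ε b) = if a = b then 1 else 0) ∧
    (∀ i : Fin n, J (ε (Sum.inl i)) = ε (Sum.inr i)) ∧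
    (∀ i j : Fin s, B (X i) (X j) = if i = j then 1 else 0) ∧
    Submodule.span ℝ (Set.range X) = LieAlgebra.derivedSubmodule L ∧
    LieAlgebra.derivedSubmodule L ⊔ (LieAlgebra.derivedSubmodule L).map J
      = Submodule.span ℝ {v | ∃ i : Fin n, r ≤ i.val ∧ (v = ε (Sum.inl i) ∨ v = ε (Sum.inr i))} ∧
    (∀ i : Fin s, 0 < lam i) ∧
    (∀ i : Fin s,
      ⁅ε (Sum.inl (Fin.castLE hs i)), ε (Sum.inr (Fin.castLE hs i))⁆ = lam i • X i) ∧
    (∀ i : Fin n, s ≤ i.val → ⁅ε (Sum.inl i), ε (Sum.inr i)⁆ = 0) ∧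
    (∀ i j : Fin n, i ≠ j → ⁅ε (Sum.inl i), ε (Sum.inr j)⁆ = 0) ∧
    (∀ i j : Fin n, ⁅ε (Sum.inl i), ε (Sum.inl j)⁆ = 0) ∧
    (∀ i j : Fin n, ⁅ε (Sum.inr i), ε (Sum.inr j)⁆ = 0)

theorem IsStromingerForm.exists_normalForm [FiniteDimensional ℝ L] [LieRing.IsNilpotent L]
    {Γ : L →ₗ[ℝ] L →ₗ[ℝ] L} (h : IsHermitianPair B J) (hΓ : IsStromingerForm B J Γ)
    (hnij : ∀ x y : L, ⁅J x, J y⁆ = ⁅x, y⁆ + J (⁅J x, y⁆ + ⁅x, J y⁆))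
    (hR : ∀ x y z, invariantCurvature Γ x y z + invariantCurvature Γ y z x
      + invariantCurvature Γ z x y = 0)
    {n : ℕ} (hn : Module.finrank ℝ L = 2 * n) :
    ∃ r s : ℕ, LieHasNormalForm B J n r s := by
  obtain ⟨Φ, b, q, hΦJ, hΦB, hbr, hq, hbq⟩ := hΓ.exists_normal_basis h hnij hR hn
  classical
  -- `σ` enumerates the non-zero brackets. Their `b i` are orthogonal to the complex span `N` of all
  -- `q`, which becomes `𝔫 + J𝔫`, so both fit in one adapted basis.
  let σ := (Fintype.equivFin {i // q i ≠ 0}).symm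
  set s := Fintype.card {i // q i ≠ 0}
  set N := Submodule.span ℂ (Set.range q) with hN
  obtain ⟨r, hs, e, hr, heb, heN⟩ := OrthonormalBasis.exists_adapted (n := n)
    (by simp) (fun i : Fin s => b (σ i)) (b.orthonormal.comp _ (Subtype.val_injective.comp
      σ.injective)) N (fun i x hx => by
      induction hx using Submodule.span_induction with
      | mem x h =>
        obtain ⟨j, rfl⟩ := h
        exact hbq _ _ (σ i).2
      | zero => simp
      | add x y _ _ hx hy => rw [inner_add_right, hx, hy, add_zero]
      | smul c x _ hx => rw [inner_smul_right, hx, mul_zero])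
  have hsum : ∀ x y, Φ ⁅x, y⁆ = ∑ k : Fin s, ((⟪e (Fin.castLE hs k), Φ x⟫_ℂ).re
      * (⟪e (Fin.castLE hs k), Φ y⟫_ℂ).im - (⟪e (Fin.castLE hs k), Φ x⟫_ℂ).im
      * (⟪e (Fin.castLE hs k), Φ y⟫_ℂ).re) • q (σ k) := by
    intro x y
    simp only [heb]
    rw [hbr, σ.sum_comp (fun k : {i // q i ≠ 0} => ((⟪b k, Φ x⟫_ℂ).re * (⟪b k, Φ y⟫_ℂ).im
      - (⟪b k, Φ x⟫_ℂ).im * (⟪b k, Φ y⟫_ℂ).re) • q k)]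
    rw [← Finset.sum_subtype (Finset.univ.filter fun k => q k ≠ 0) (by simp) (fun k =>
      ((⟪b k, Φ x⟫_ℂ).re * (⟪b k, Φ y⟫_ℂ).im - (⟪b k, Φ x⟫_ℂ).im * (⟪b k, Φ y⟫_ℂ).re) • q k)]
    exact (Finset.sum_filter_of_ne (p := fun k => q k ≠ 0) fun k _ hk hqk =>
      hk (by rw [hqk, smul_zero])).symm
  let f : Fin n ⊕ Fin n → EuclideanSpace ℂ (Fin n) :=
    Sum.elim (fun i => e i) (fun i => Complex.I • e i)
  have hee := orthonormal_iff_ite.1 e.orthonormal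
  have hf : ∀ a b, B (Φ.symm (f a)) (Φ.symm (f b)) = if a = b then 1 else 0 := by
    intro a b
    rw [← hΦB, LinearEquiv.apply_symm_apply, LinearEquiv.apply_symm_apply]
    rcases a with i | i <;> rcases b with j | j <;>
      simp [f, hee] <;> split_ifs <;> simp
  have hli : LinearIndependent ℝ (fun a => Φ.symm (f a)) :=
    LinearMap.linearIndependent_of_isOrthoᵢ (B := B)
      (fun a b hab => (hf a b).trans (if_neg hab))
      (fun a (ha : B (Φ.symm (f a)) (Φ.symm (f a)) = 0) => by simp [hf] at ha)
  let ε := basisOfLinearIndependentOfCardEqFinrank' _ hli (by simp [hn]; omega)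
  have hε : ∀ a, Φ (ε a) = f a := fun a => by simp [ε]
  have hf1 : ∀ i j, ⟪e i, f (Sum.inl j)⟫_ℂ = if i = j then 1 else 0 := fun i j => hee i j
  have hf2 : ∀ i j, ⟪e i, f (Sum.inr j)⟫_ℂ = if i = j then Complex.I else 0 := fun i j => by
    simp [f, hee]
  have hbrq : ∀ i : Fin s, Φ ⁅ε (Sum.inl (Fin.castLE hs i)), ε (Sum.inr (Fin.castLE hs i))⁆
      = q (σ i) := by
    intro i
    rw [hsum, hε, hε, Finset.sum_eq_single i]
    · simp [hf1, hf2]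
    · intro j _ hj
      simp [hf1, hj]
    · simp
  have hDq : (LieAlgebra.derivedSubmodule L).map (Φ : L →ₗ[ℝ] EuclideanSpace ℂ (Fin n))
      = Submodule.span ℝ (Set.range q) := by
    apply le_antisymm
    · rw [Submodule.map_le_iff_le_comap]
      refine LieAlgebra.derivedSubmodule_le fun x y => ?_
      change Φ ⁅x, y⁆ ∈ Submodule.span ℝ (Set.range q)
      rw [hbr]
      exact Submodule.sum_mem _ fun k _ => Submodule.smul_mem _ _ (Submodule.subset_span ⟨k, rfl⟩)
    · rw [Submodule.span_le]
      rintro _ ⟨k, rfl⟩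
      by_cases hk : q k = 0
      · rw [hk]
        exact Submodule.zero_mem _
      · refine ⟨_, LieAlgebra.lie_mem_derivedSubmodule _ _, (hbrq (σ.symm ⟨k, hk⟩)).trans ?_⟩
        rw [Equiv.apply_symm_apply]
  -- Each non-zero bracket splits into its norm, the constant, and its direction, the vector `X i`.
  refine ⟨r, s, hr, hs, ε, fun i => Φ.symm ((‖q (σ i)‖⁻¹ : ℝ) • q (σ i)), fun i => ‖q (σ i)‖,
    fun a b => by simpa [ε] using hf a b, fun i => ?_, fun i j => ?_, ?_, ?_,
    fun i => norm_pos_iff.2 (σ i).2, fun i => ?_, fun i hi => ?_, fun i j hij => ?_, fun i j => ?_,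
    fun i j => ?_⟩
  · apply Φ.injective
    rw [hΦJ, hε, hε]
    rfl
  · simp only [map_smul, LinearMap.smul_apply, smul_eq_mul]
    rw [← hΦB, LinearEquiv.apply_symm_apply, LinearEquiv.apply_symm_apply]
    split_ifs with hij
    · subst hij
      have := (norm_pos_iff.2 (σ i).2).ne'
      have h2 : (⟪q (σ i), q (σ i)⟫_ℂ).re = ‖q (σ i)‖ ^ 2 := inner_self_eq_norm_sq (𝕜 := ℂ) _
      rw [h2]
      field_simp
    · rw [hq _ _ (fun h => hij (σ.injective (Subtype.ext h))), mul_zero, mul_zero]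
  · apply Submodule.map_injective_of_injective
      (f := (Φ : L →ₗ[ℝ] EuclideanSpace ℂ (Fin n))) Φ.injective
    rw [hDq, Submodule.map_span]
    apply le_antisymm
    · rw [Submodule.span_le]
      rintro _ ⟨_, ⟨i, rfl⟩, rfl⟩
      refine (congrArg (· ∈ Submodule.span ℝ (Set.range q)) (Φ.apply_symm_apply _)).mpr ?_
      exact Submodule.smul_mem _ _ (Submodule.subset_span ⟨_, rfl⟩)
    · rw [Submodule.span_le]
      rintro _ ⟨k, rfl⟩
      by_cases hk : q k = 0
      · rw [hk]
        exact Submodule.zero_mem _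
      · have : q k = ‖q k‖ • Φ (Φ.symm ((‖q k‖⁻¹ : ℝ) • q k)) := by
          rw [Φ.apply_symm_apply, smul_inv_smul₀ (norm_ne_zero_iff.2 hk)]
        rw [this]
        refine Submodule.smul_mem _ _ (Submodule.subset_span ⟨_, ⟨σ.symm ⟨k, hk⟩, rfl⟩, ?_⟩)
        simp
  · apply Submodule.map_injective_of_injective
      (f := (Φ : L →ₗ[ℝ] EuclideanSpace ℂ (Fin n))) Φ.injective
    let I' : EuclideanSpace ℂ (Fin n) →ₗ[ℝ] EuclideanSpace ℂ (Fin n) :=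
      LinearMap.lsmul ℂ _ Complex.I |>.restrictScalars ℝ
    have hI' : ∀ x, I' x = Complex.I • x := fun x => rfl
    have hcomp : (Φ : L →ₗ[ℝ] EuclideanSpace ℂ (Fin n)) ∘ₗ J
        = I' ∘ₗ (Φ : L →ₗ[ℝ] EuclideanSpace ℂ (Fin n)) := LinearMap.ext hΦJ
    rw [Submodule.map_sup, ← Submodule.map_comp, hcomp, Submodule.map_comp, hDq,
      real_span_sup_map_smul _ _ hI', ← hN, ← heN, ← real_span_sup_map_smul _ _ hI',
      Submodule.map_span, Submodule.map_span, ← Submodule.span_union]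
    congr 1
    ext v
    constructor
    · rintro (⟨i, hi, rfl⟩ | ⟨_, ⟨i, hi, rfl⟩, rfl⟩)
      · exact ⟨_, ⟨i, hi, Or.inl rfl⟩, hε _⟩
      · exact ⟨_, ⟨i, hi, Or.inr rfl⟩, hε _⟩
    · rintro ⟨_, ⟨i, hi, rfl | rfl⟩, rfl⟩
      · exact Or.inl ⟨i, hi, hε _⟩
      · exact Or.inr ⟨_, ⟨i, hi, rfl⟩, (hε (Sum.inr i)).symm⟩
  all_goals apply Φ.injective
  · rw [hbrq, map_smul, LinearEquiv.apply_symm_apply, smul_inv_smul₀ (norm_ne_zero_iff.2 (σ i).2)]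
  all_goals
    rw [hsum, hε, hε, map_zero]
    refine Finset.sum_eq_zero fun k _ => ?_
  · have : Fin.castLE hs k ≠ i := by
      rintro rfl
      have := k.isLt
      simp at hi
      omega
    simp [hf1, hf2, this]
  · by_cases hki : Fin.castLE hs k = i
    · simp [hf1, hf2, hki, hij]
    · simp [hf1, hf2, hki]
  · simp only [hf1]
    split_ifs <;> simp
  · simp only [hf2]
    split_ifs <;> simp

end

/-! ### The bracket of a normal form -/

section

lemma LieRing.IsNilpotent.eq_zero_of_lie_eq_smul {L : Type*} [LieRing L] [LieAlgebra ℝ L]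
    [LieRing.IsNilpotent L] {x y : L} {c : ℝ} (hy : y ≠ 0) (h : ⁅x, y⁆ = c • y) : c = 0 := by
  obtain ⟨k, hk⟩ := LieModule.isNilpotent_toEnd_of_isNilpotent ℝ L L x
  have hpow : ∀ k : ℕ, (LieModule.toEnd ℝ L L x ^ k) y = c ^ k • y := by
    intro k
    induction k with
    | zero => simp
    | succ k ih =>
      rw [pow_succ', Module.End.mul_apply, ih, map_smul, LieModule.toEnd_apply_apply, h, smul_smul,
        pow_succ]
  have := hpow k
  rw [hk, LinearMap.zero_apply, eq_comm, smul_eq_zero] at this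
  exact eq_zero_of_pow_eq_zero (this.resolve_right hy)

/-- The data of a normal form of a Lie algebra with inner product and complex structure. -/
structure LieNormalForm {L : Type*} [LieRing L] [LieAlgebra ℝ L] (B : L →ₗ[ℝ] L →ₗ[ℝ] ℝ)
    (J : L →ₗ[ℝ] L) (n r s : ℕ) where
  r_le : r ≤ n
  s_le : s ≤ n
  ε : Module.Basis (Fin n ⊕ Fin n) ℝ L
  X : Fin s → L
  lam : Fin s → ℝ
  orth : ∀ a b : Fin n ⊕ Fin n, B (ε a) (ε b) = if a = b then 1 else 0
  J_inl : ∀ i : Fin n, J (ε (Sum.inl i)) = ε (Sum.inr i)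
  X_orth : ∀ i j : Fin s, B (X i) (X j) = if i = j then 1 else 0
  span_X : Submodule.span ℝ (Set.range X) = LieAlgebra.derivedSubmodule L
  sup_map_J : LieAlgebra.derivedSubmodule L ⊔ (LieAlgebra.derivedSubmodule L).map J
      = Submodule.span ℝ {v | ∃ i : Fin n, r ≤ i.val ∧ (v = ε (Sum.inl i) ∨ v = ε (Sum.inr i))}
  lam_pos : ∀ i : Fin s, 0 < lam i
  lie_eq : ∀ i : Fin s,
    ⁅ε (Sum.inl (Fin.castLE s_le i)), ε (Sum.inr (Fin.castLE s_le i))⁆ = lam i • X i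
  lie_eq_zero : ∀ i : Fin n, s ≤ i.val → ⁅ε (Sum.inl i), ε (Sum.inr i)⁆ = 0
  lie_of_ne : ∀ i j : Fin n, i ≠ j → ⁅ε (Sum.inl i), ε (Sum.inr j)⁆ = 0
  lie_inl : ∀ i j : Fin n, ⁅ε (Sum.inl i), ε (Sum.inl j)⁆ = 0
  lie_inr : ∀ i j : Fin n, ⁅ε (Sum.inr i), ε (Sum.inr j)⁆ = 0

lemma LieHasNormalForm.nonempty {L : Type*} [LieRing L] [LieAlgebra ℝ L] {B : L →ₗ[ℝ] L →ₗ[ℝ] ℝ}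
    {J : L →ₗ[ℝ] L} {n r s : ℕ} (h : LieHasNormalForm B J n r s) :
    Nonempty (LieNormalForm B J n r s) := by
  obtain ⟨hr, hs, ε, X, lam, h1, h2, h3, h4, h5, h6, h7, h8, h9, h10, h11⟩ := h
  exact ⟨⟨hr, hs, ε, X, lam, h1, h2, h3, h4, h5, h6, h7, h8, h9, h10, h11⟩⟩

namespace LieNormalForm

variable {L : Type*} [LieRing L] [LieAlgebra ℝ L] {B : L →ₗ[ℝ] L →ₗ[ℝ] ℝ} {J : L →ₗ[ℝ] L}
  {n r s : ℕ} (F : LieNormalForm B J n r s)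

/-- The basis vector `ε_i` for `i < s`. -/
abbrev e (i : Fin s) : L := F.ε (Sum.inl (Fin.castLE F.s_le i))

/-- The basis vector `ε_{n+i}` for `i < s`. -/
abbrev f (i : Fin s) : L := F.ε (Sum.inr (Fin.castLE F.s_le i))

lemma repr_eq (x : L) (a : Fin n ⊕ Fin n) : F.ε.repr x a = B (F.ε a) x := by
  conv_rhs => rw [← F.ε.sum_repr x, map_sum]
  simp only [map_smul, F.orth, smul_eq_mul, mul_ite, mul_one, mul_zero, Finset.sum_ite_eq,
    Finset.mem_univ, if_true]

lemma e_e (i j : Fin s) : B (F.e i) (F.e j) = if i = j then 1 else 0 := by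
  simp [F.orth]

lemma f_f (i j : Fin s) : B (F.f i) (F.f j) = if i = j then 1 else 0 := by
  simp [F.orth]

lemma e_f (i j : Fin s) : B (F.e i) (F.f j) = 0 := by
  simp [F.orth]

lemma f_e (i j : Fin s) : B (F.f i) (F.e j) = 0 := by
  simp [F.orth]

lemma lie_inr_inl_of_ne (i j : Fin n) (hij : i ≠ j) :
    ⁅F.ε (Sum.inr i), F.ε (Sum.inl j)⁆ = 0 := by
  rw [← lie_skew, F.lie_of_ne j i hij.symm, neg_zero]

theorem lie_apply (x y : L) : ⁅x, y⁆ = ∑ i, (F.lam i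
    * (B (F.e i) x * B (F.f i) y - B (F.f i) x * B (F.e i) y)) • F.X i := by
  have hxy : ⁅x, y⁆ = ∑ i : Fin n, (B (F.ε (Sum.inl i)) x * B (F.ε (Sum.inr i)) y
      - B (F.ε (Sum.inr i)) x * B (F.ε (Sum.inl i)) y)
        • ⁅F.ε (Sum.inl i), F.ε (Sum.inr i)⁆ := by
    conv_lhs => rw [← F.ε.sum_repr x, ← F.ε.sum_repr y]
    simp only [F.repr_eq, Fintype.sum_sum_type, add_lie, lie_add, sum_lie, lie_sum, smul_lie,
      lie_smul, F.lie_inl, F.lie_inr, smul_zero, Finset.sum_const_zero, zero_add, add_zero]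
    rw [← Finset.sum_add_distrib]
    refine Finset.sum_congr rfl fun i _ => ?_
    rw [Finset.sum_eq_single i, Finset.sum_eq_single i, ← lie_skew (F.ε (Sum.inr i))]
    · module
    · intro j _ hj
      rw [F.lie_of_ne j i hj, smul_zero]
    · simp
    · intro j _ hj
      rw [F.lie_inr_inl_of_ne j i hj, smul_zero]
    · simp
  rw [hxy]
  have hinj : Function.Injective (Fin.castLE F.s_le) := Fin.castLE_injective _
  rw [← Finset.sum_subset (Finset.subset_univ (Finset.univ.map ⟨_, hinj⟩)), Finset.sum_map]
  · refine Finset.sum_congr rfl fun i _ => ?_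
    simp only [Function.Embedding.coeFn_mk]
    rw [F.lie_eq, smul_smul, mul_comm]
  · intro i _ hi
    rw [F.lie_eq_zero i, smul_zero]
    by_contra hlt
    exact hi (Finset.mem_map.2 ⟨⟨i, by omega⟩, Finset.mem_univ _, rfl⟩)

lemma X_ne_zero (i : Fin s) : F.X i ≠ 0 := fun h => by
  have := F.X_orth i i
  simp [h] at this

lemma linearIndependent_X : LinearIndependent ℝ F.X :=
  LinearMap.linearIndependent_of_isOrthoᵢ (B := B)
    (fun a b hab => (F.X_orth a b).trans (if_neg hab))
    (fun a (ha : B (F.X a) (F.X a) = 0) => by simp [F.X_orth] at ha)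

lemma finrank_derived (F : LieNormalForm B J n r s) : Module.finrank ℝ (LieAlgebra.derivedSubmodule L) = s := by
  rw [← F.span_X, finrank_span_eq_card F.linearIndependent_X, Fintype.card_fin]

lemma lie_X_e (i : Fin s) (x : L) : ⁅x, F.e i⁆ = -(F.lam i * B (F.f i) x) • F.X i := by
  rw [F.lie_apply, Finset.sum_eq_single i]
  · rw [F.f_e, F.e_e, if_pos rfl]
    congr 1
    ring
  · intro j _ hj
    rw [F.f_e, F.e_e, if_neg hj]
    simp
  · simp

lemma lie_X_f (i : Fin s) (x : L) : ⁅x, F.f i⁆ = (F.lam i * B (F.e i) x) • F.X i := by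
  rw [F.lie_apply, Finset.sum_eq_single i]
  · rw [F.e_f, F.f_f, if_pos rfl]
    congr 1
    ring
  · intro j _ hj
    rw [F.e_f, F.f_f, if_neg hj]
    simp
  · simp

/-- `X i` is a multiple of a bracket of `e i` and `f i`, both of which commute with the vectors of
index `k`; apply Jacobi. -/
lemma X_lie_of_ne {i : Fin s} {k : Fin n} (h : k ≠ Fin.castLE F.s_le i) :
    ⁅F.X i, F.ε (Sum.inl k)⁆ = 0 ∧ ⁅F.X i, F.ε (Sum.inr k)⁆ = 0 := by
  have hX : F.X i = (F.lam i)⁻¹ • ⁅F.e i, F.f i⁆ := by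
    rw [F.lie_eq, smul_smul, inv_mul_cancel₀ (F.lam_pos i).ne', one_smul]
  constructor
  · rw [hX, smul_lie, lie_lie, F.lie_inl, F.lie_inr_inl_of_ne _ _ h.symm, lie_zero, lie_zero,
      sub_zero, smul_zero]
  · rw [hX, smul_lie, lie_lie, F.lie_inr, F.lie_of_ne _ _ h.symm, lie_zero, lie_zero,
      sub_zero, smul_zero]

variable [LieRing.IsNilpotent L]

/-- Up to the factor `-λ i`, this inner product is the eigenvalue of the nilpotent operator `ad (f
i)` on `X i`. -/
lemma B_e_X_self (i : Fin s) : B (F.e i) (F.X i) = 0 := by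
  have h : ⁅F.f i, F.X i⁆ = (-(F.lam i * B (F.e i) (F.X i))) • F.X i := by
    rw [← lie_skew, F.lie_X_f, neg_smul]
  have := LieRing.IsNilpotent.eq_zero_of_lie_eq_smul (F.X_ne_zero i) h
  simpa [(F.lam_pos i).ne'] using this

lemma B_f_X_self (i : Fin s) : B (F.f i) (F.X i) = 0 := by
  have h : ⁅F.e i, F.X i⁆ = (F.lam i * B (F.f i) (F.X i)) • F.X i := by
    rw [← lie_skew, F.lie_X_e, neg_smul, neg_neg]
  have := LieRing.IsNilpotent.eq_zero_of_lie_eq_smul (F.X_ne_zero i) h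
  simpa [(F.lam_pos i).ne'] using this

lemma X_lie (i : Fin s) (y : L) : ⁅F.X i, y⁆ = 0 := by
  have h1 : ∀ a, ⁅F.X i, F.ε a⁆ = 0 := by
    rintro (k | k) <;> by_cases hk : k = Fin.castLE F.s_le i
    · rw [hk]
      exact (F.lie_X_e i _).trans (by rw [F.B_f_X_self]; simp)
    · exact (F.X_lie_of_ne hk).1
    · rw [hk]
      exact (F.lie_X_f i _).trans (by rw [F.B_e_X_self]; simp)
    · exact (F.X_lie_of_ne hk).2
  rw [← F.ε.sum_repr y, lie_sum]
  exact Finset.sum_eq_zero fun a _ => by rw [lie_smul, h1, smul_zero]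

/-- The bracket of the central `X j` with `f i` is this inner product times a non-zero multiple of
`X i`. -/
lemma B_e_X (i j : Fin s) : B (F.e i) (F.X j) = 0 := by
  have h := F.lie_X_f i (F.X j)
  rw [F.X_lie, eq_comm, smul_eq_zero] at h
  simpa [(F.lam_pos i).ne', F.X_ne_zero] using h

lemma B_f_X (i j : Fin s) : B (F.f i) (F.X j) = 0 := by
  have h := F.lie_X_e i (F.X j)
  rw [F.X_lie, eq_comm, smul_eq_zero] at h
  simpa [(F.lam_pos i).ne', F.X_ne_zero] using h

theorem lie_lie_eq_zero (F : LieNormalForm B J n r s) (x y z : L) : ⁅x, ⁅y, z⁆⁆ = 0 := by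
  rw [F.lie_apply y z, lie_sum]
  exact Finset.sum_eq_zero fun i _ => by rw [lie_smul, ← lie_skew, F.X_lie, neg_zero, smul_zero]

end LieNormalForm

end

/-! ### Bounds on `r` and `s`, and the connection of a normal form -/

section

namespace LieNormalForm

variable {L : Type*} [LieRing L] [LieAlgebra ℝ L] {B : L →ₗ[ℝ] L →ₗ[ℝ] ℝ} {J : L →ₗ[ℝ] L}
  {n r s : ℕ} (F : LieNormalForm B J n r s)

lemma J_e (i : Fin s) : J (F.e i) = F.f i := F.J_inl _

lemma J_f (h : IsHermitianPair B J) (i : Fin s) : J (F.f i) = -F.e i := by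
  rw [← F.J_e, h.sq]

lemma B_e_J (h : IsHermitianPair B J) (i : Fin s) (x : L) : B (F.e i) (J x) = -B (F.f i) x := by
  rw [← neg_eq_iff_eq_neg, ← h.apply_J_left, F.J_e]

lemma B_f_J (h : IsHermitianPair B J) (i : Fin s) (x : L) : B (F.f i) (J x) = B (F.e i) x := by
  rw [← F.J_e, h.orth]

theorem lie_J_J (F : LieNormalForm B J n r s) (h : IsHermitianPair B J) (x y : L) :
    ⁅J x, J y⁆ = ⁅x, y⁆ := by
  rw [F.lie_apply, F.lie_apply]
  refine Finset.sum_congr rfl fun i _ => ?_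
  rw [F.B_e_J h, F.B_e_J h, F.B_f_J h, F.B_f_J h]
  congr 1
  ring

/-- Each `e i` with `i < s` is orthogonal to `𝔫 + J𝔫`; if `r < s`, then `e r` would also lie in that
space. -/
theorem s_le_r [LieRing.IsNilpotent L] (F : LieNormalForm B J n r s) (h : IsHermitianPair B J) :
    s ≤ r := by
  by_contra! hrs
  have hmem : F.e ⟨r, hrs⟩ ∈ LieAlgebra.derivedSubmodule L
      ⊔ (LieAlgebra.derivedSubmodule L).map J := by
    rw [F.sup_map_J]
    exact Submodule.subset_span ⟨_, by simp, Or.inl rfl⟩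
  have hle : LieAlgebra.derivedSubmodule L ⊔ (LieAlgebra.derivedSubmodule L).map J
      ≤ LinearMap.ker (B (F.e ⟨r, hrs⟩)) := by
    rw [← F.span_X, Submodule.map_span, sup_le_iff, Submodule.span_le, Submodule.span_le]
    constructor
    · rintro _ ⟨i, rfl⟩
      exact F.B_e_X _ _
    · rintro _ ⟨_, ⟨i, rfl⟩, rfl⟩
      change B (F.e ⟨r, hrs⟩) (J (F.X i)) = 0
      rw [F.B_e_J h, F.B_f_X, neg_zero]
  have := hle hmem
  rw [LinearMap.mem_ker, F.e_e] at this
  simp at this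

lemma finrank_sup_map_J (F : LieNormalForm B J n r s) :
    Module.finrank ℝ ↥(LieAlgebra.derivedSubmodule L ⊔ (LieAlgebra.derivedSubmodule L).map J)
      = 2 * (n - r) := by
  have hr := F.r_le
  let v : Fin (n - r) ⊕ Fin (n - r) → Fin n ⊕ Fin n :=
    Sum.map (fun i => ⟨r + i, by omega⟩) (fun i => ⟨r + i, by omega⟩)
  have hv : Function.Injective v := by
    apply Function.Injective.sumMap <;>
    · intro i j hij
      simpa [Fin.ext_iff] using hij
  have hset : {w | ∃ i : Fin n, r ≤ i.val ∧ (w = F.ε (Sum.inl i) ∨ w = F.ε (Sum.inr i))}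
      = Set.range (F.ε ∘ v) := by
    ext w
    constructor
    · rintro ⟨i, hi, rfl | rfl⟩
      · exact ⟨Sum.inl ⟨i - r, by omega⟩, by simp [v, hi]⟩
      · exact ⟨Sum.inr ⟨i - r, by omega⟩, by simp [v, hi]⟩
    · rintro ⟨i | i, rfl⟩
      · exact ⟨⟨r + i, by omega⟩, by simp, Or.inl rfl⟩
      · exact ⟨⟨r + i, by omega⟩, by simp, Or.inr rfl⟩
  rw [F.sup_map_J, hset, finrank_span_eq_card (F.ε.linearIndependent.comp v hv)]
  simp
  omega

variable [FiniteDimensional ℝ L]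

theorem s_le_two_mul (F : LieNormalForm B J n r s) : s ≤ 2 * (n - r) := by
  rw [← F.finrank_sup_map_J]
  conv_lhs => rw [← F.finrank_derived]
  exact Submodule.finrank_mono le_sup_left

/-- The space `𝔫 + J𝔫` has dimension `2 (n - r)`, and at most `2 s` since `𝔫` has dimension `s`. -/
theorem sub_le_s (F : LieNormalForm B J n r s) : n - r ≤ s := by
  have h1 := Submodule.finrank_add_le_finrank_add_finrank (LieAlgebra.derivedSubmodule L)
    ((LieAlgebra.derivedSubmodule L).map J)
  have h2 := Submodule.finrank_map_le J (LieAlgebra.derivedSubmodule L)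
  rw [F.finrank_sup_map_J] at h1
  rw [F.finrank_derived] at h1 h2
  omega

end LieNormalForm

namespace LieNormalForm

variable {L : Type*} [LieRing L] [LieAlgebra ℝ L] {B : L →ₗ[ℝ] L →ₗ[ℝ] ℝ} {J : L →ₗ[ℝ] L}
  {n r s : ℕ} (F : LieNormalForm B J n r s)

/-- The Strominger connection of a Lie algebra in normal form. -/
def connection : L →ₗ[ℝ] L →ₗ[ℝ] L :=
  ∑ i, (B (F.X i)).smulRight (F.lam i • ((B (F.f i)).smulRight (F.e i)
    - (B (F.e i)).smulRight (F.f i)))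

lemma connection_apply (x y : L) : F.connection x y = ∑ i, (F.lam i * B (F.X i) x)
    • (B (F.f i) y • F.e i - B (F.e i) y • F.f i) := by
  simp only [connection, LinearMap.sum_apply, LinearMap.smulRight_apply, LinearMap.smul_apply,
    LinearMap.sub_apply, smul_smul]
  exact Finset.sum_congr rfl fun i _ => by rw [mul_comm]

lemma B_connection (x y z : L) : B (F.connection x y) z
    = ∑ i, F.lam i * B (F.X i) x * (B (F.f i) y * B (F.e i) z - B (F.e i) y * B (F.f i) z) := by
  simp [connection_apply, LinearMap.sum_apply]

lemma B_lie (x y z : L) : B ⁅x, y⁆ z = ∑ i, F.lam i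
    * (B (F.e i) x * B (F.f i) y - B (F.f i) x * B (F.e i) y) * B (F.X i) z := by
  rw [F.lie_apply]
  simp [LinearMap.sum_apply]

/-- The torsion is the 3-form `-∑ λ i X i ∧ e i ∧ f i`, and rotations of the complex lines spanned
by `e i` commute with `J`. -/
theorem isStromingerForm (h : IsHermitianPair B J) : IsStromingerForm B J F.connection where
  skew x y z := by
    rw [h.symm y, F.B_connection, F.B_connection, ← Finset.sum_neg_distrib]
    exact Finset.sum_congr rfl fun i _ => by ring
  comm x y := by
    rw [F.connection_apply, F.connection_apply, map_sum]
    refine Finset.sum_congr rfl fun i _ => ?_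
    rw [map_smul, map_sub, map_smul, map_smul, F.B_e_J h, F.B_f_J h, F.J_e, F.J_f h]
    module
  torsion_skew x y z := by
    simp only [map_sub, LinearMap.sub_apply, F.B_connection, F.B_lie, ← Finset.sum_sub_distrib,
      ← Finset.sum_neg_distrib]
    exact Finset.sum_congr rfl fun i _ => by ring

lemma B_e_connection (i : Fin s) (x y : L) :
    B (F.e i) (F.connection x y) = F.lam i * B (F.X i) x * B (F.f i) y := by
  simp only [connection_apply, map_sum, map_smul, map_sub, F.e_e, F.e_f, smul_eq_mul]
  simp

lemma B_f_connection (i : Fin s) (x y : L) :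
    B (F.f i) (F.connection x y) = -(F.lam i * B (F.X i) x * B (F.e i) y) := by
  simp only [connection_apply, map_sum, map_smul, map_sub, F.f_e, F.f_f, smul_eq_mul]
  simp

lemma B_X_lie (i : Fin s) (x y : L) : B (F.X i) ⁅x, y⁆
    = F.lam i * (B (F.e i) x * B (F.f i) y - B (F.f i) x * B (F.e i) y) := by
  simp only [F.lie_apply x y, map_sum, map_smul, F.X_orth, smul_eq_mul]
  simp

/-- Rotations in orthogonal planes commute, so `R(x, y) = -Γ [x, y]`. In each plane the cyclic sum
of `(e ∧ f)(x, y)` times the rotated projection of `z` vanishes, as the plane has dimension two. -/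
theorem invariantCurvature_cyclic (x y z : L) : invariantCurvature F.connection x y z
    + invariantCurvature F.connection y z x + invariantCurvature F.connection z x y = 0 := by
  have hcomm : ∀ x y z, F.connection x (F.connection y z) = F.connection y (F.connection x z) := by
    intro x y z
    rw [F.connection_apply x, F.connection_apply y (F.connection x z)]
    refine Finset.sum_congr rfl fun i _ => ?_
    rw [F.B_e_connection, F.B_f_connection, F.B_e_connection, F.B_f_connection]
    module
  simp only [invariantCurvature, hcomm x y z, hcomm y z x, hcomm z x y, sub_self, zero_sub]
  rw [F.connection_apply, F.connection_apply, F.connection_apply, ← Finset.sum_neg_distrib,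
    ← Finset.sum_neg_distrib, ← Finset.sum_neg_distrib, ← Finset.sum_add_distrib,
    ← Finset.sum_add_distrib]
  refine Finset.sum_eq_zero fun i _ => ?_
  rw [F.B_X_lie, F.B_X_lie, F.B_X_lie]
  module

lemma lie_eq_zero_of_s_eq_zero (F : LieNormalForm B J n r 0) (x y : L) : ⁅x, y⁆ = 0 := by
  rw [F.lie_apply, Finset.univ_eq_empty, Finset.sum_empty]

/-- For a normal form with `s > 0` the fundamental form is not closed. -/
theorem exists_fundamental_ne_zero [LieRing.IsNilpotent L] (F : LieNormalForm B J n r s)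
    (h : IsHermitianPair B J) (hs : s ≠ 0) :
    ∃ x y z : L, B (J ⁅x, y⁆) z + B (J ⁅y, z⁆) x + B (J ⁅z, x⁆) y ≠ 0 := by
  let i : Fin s := ⟨0, Nat.pos_of_ne_zero hs⟩
  -- With `J (X i)` as third argument only the bracket of `e i` and `f i` survives, and the sum
  -- equals `λ i`.
  refine ⟨F.e i, F.f i, J (F.X i), ?_⟩
  have h1 : ⁅F.f i, J (F.X i)⁆ = 0 := by
    rw [← lie_skew, F.lie_X_f, F.B_e_J h, F.B_f_X]
    simp
  have h2 : ⁅J (F.X i), F.e i⁆ = 0 := by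
    rw [F.lie_X_e, F.B_f_J h, F.B_e_X]
    simp
  rw [h1, h2, F.lie_eq, map_smul, map_smul, LinearMap.smul_apply, h.orth, F.X_orth]
  simpa using (F.lam_pos i).ne'

end LieNormalForm

end

/-! ### Left trivialization of the tangent bundle -/

section

namespace HermitianGeometry

variable {E : Type*} [NormedAddCommGroup E] [NormedSpace ℝ E]
  {G : Type*} [TopologicalSpace G] [ChartedSpace E G] [Group G] [LieGroup 𝓘(ℝ, E) ∞ G]

lemma mdifferentiableAt_mul_left (a b : G) :
    MDifferentiableAt 𝓘(ℝ, E) 𝓘(ℝ, E) (fun y : G ↦ a * y) b :=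
  (contMDiff_mul_left (I := 𝓘(ℝ, E)) (n := ∞) (a := a)).mdifferentiableAt (by simp)

/-- The differential at `y` of the left translation by `y⁻¹`, with values in the model space of the
Lie algebra. -/
def leftLog (x : G) (w : Tan E x) : E :=
  mfderiv 𝓘(ℝ, E) 𝓘(ℝ, E) (fun y : G ↦ x⁻¹ * y) x w

lemma mfderiv_mul_left_comp (a b c : G) (v : E) :
    (mfderiv 𝓘(ℝ, E) 𝓘(ℝ, E) (fun y : G ↦ a * y) (b * c)
      (mfderiv 𝓘(ℝ, E) 𝓘(ℝ, E) (fun y : G ↦ b * y) c v : E) : E)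
      = (mfderiv 𝓘(ℝ, E) 𝓘(ℝ, E) (fun y : G ↦ (a * b) * y) c v : E) := by
  have h : (fun y : G ↦ (a * b) * y) = (fun y : G ↦ a * y) ∘ fun y : G ↦ b * y := by
    funext y
    exact mul_assoc a b y
  rw [h]
  have := mfderiv_comp (I := 𝓘(ℝ, E)) (I' := 𝓘(ℝ, E)) (I'' := 𝓘(ℝ, E)) c
    (mdifferentiableAt_mul_left (E := E) a (b * c)) (mdifferentiableAt_mul_left (E := E) b c)
  exact (congrArg (fun T : E →L[ℝ] E => T v) this).symm

lemma mfderiv_one_mul (c : G) (v : E) :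
    (mfderiv 𝓘(ℝ, E) 𝓘(ℝ, E) (fun y : G ↦ (1 : G) * y) c v : E) = v := by
  have h : (fun y : G ↦ (1 : G) * y) = id := by
    funext y
    exact one_mul y
  rw [h]
  exact congrArg (fun T : E →L[ℝ] E => T v) (mfderiv_id (I := 𝓘(ℝ, E)) (x := c))

lemma mfderiv_mul_left_congr {a a' b b' : G} (ha : a = a') (hb : b = b') (v : E) :
    (mfderiv 𝓘(ℝ, E) 𝓘(ℝ, E) (fun y : G ↦ a * y) b v : E)
      = (mfderiv 𝓘(ℝ, E) 𝓘(ℝ, E) (fun y : G ↦ a' * y) b' v : E) := by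
  subst ha hb
  rfl

/-- Left translation identifies the Lie algebra with each tangent space. -/
def leftEquiv (x : G) : LieAlg E G ≃ₗ[ℝ] Tan E x where
  toFun v := mulInvariantVectorField v x
  map_add' v w := (mfderiv 𝓘(ℝ, E) 𝓘(ℝ, E) (fun y : G ↦ x * y) 1).map_add v w
  map_smul' r v := (mfderiv 𝓘(ℝ, E) 𝓘(ℝ, E) (fun y : G ↦ x * y) 1).map_smul r v
  invFun := leftLog x
  left_inv v := by
    refine (mfderiv_mul_left_congr (E := E) rfl (mul_one x).symm _).trans ?_
    refine (mfderiv_mul_left_comp (E := E) x⁻¹ x 1 v).trans ?_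
    exact (mfderiv_mul_left_congr (E := E) (inv_mul_cancel x) rfl v).trans (mfderiv_one_mul (E := E) 1 v)
  right_inv w := by
    refine (mfderiv_mul_left_congr (E := E) rfl (inv_mul_cancel x).symm _).trans ?_
    refine (mfderiv_mul_left_comp (E := E) x x⁻¹ x w).trans ?_
    exact (mfderiv_mul_left_congr (E := E) (mul_inv_cancel x) rfl w).trans (mfderiv_one_mul (E := E) x w)

lemma leftEquiv_one (v : LieAlg E G) : leftEquiv (1 : G) v = v :=
  mfderiv_one_mul (E := E) 1 v

/-- The field is the tangent map of multiplication applied to the zero vector at `x` and the fixed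
vector `v` at `1`. -/
theorem contMDiff_leftEquiv (v : LieAlg E G) : SmoothField fun x : G ↦ leftEquiv x v := by
  let fg : G → TangentBundle 𝓘(ℝ, E) G := fun g ↦ TotalSpace.mk' E g 0
  have sfg : ContMDiff 𝓘(ℝ, E) 𝓘(ℝ, E).tangent ∞ fg := contMDiff_zeroSection _ _
  let fv : G → TangentBundle 𝓘(ℝ, E) G := fun _ ↦ TotalSpace.mk' E 1 v
  have sfv : ContMDiff 𝓘(ℝ, E) 𝓘(ℝ, E).tangent ∞ fv := contMDiff_const
  let F₁ : G → (TangentBundle 𝓘(ℝ, E) G × TangentBundle 𝓘(ℝ, E) G) := fun g ↦ (fg g, fv g)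
  have S₁ : ContMDiff 𝓘(ℝ, E) (𝓘(ℝ, E).tangent.prod 𝓘(ℝ, E).tangent) ∞ F₁ := sfg.prodMk sfv
  let F₂ : (TangentBundle 𝓘(ℝ, E) G × TangentBundle 𝓘(ℝ, E) G) →
      TangentBundle (𝓘(ℝ, E).prod 𝓘(ℝ, E)) (G × G) :=
    (equivTangentBundleProd 𝓘(ℝ, E) G 𝓘(ℝ, E) G).symm
  have S₂ : ContMDiff (𝓘(ℝ, E).tangent.prod 𝓘(ℝ, E).tangent) (𝓘(ℝ, E).prod 𝓘(ℝ, E)).tangent ∞ F₂ :=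
    contMDiff_equivTangentBundleProd_symm
  let F₃ : TangentBundle (𝓘(ℝ, E).prod 𝓘(ℝ, E)) (G × G) → TangentBundle 𝓘(ℝ, E) G :=
    tangentMap (𝓘(ℝ, E).prod 𝓘(ℝ, E)) 𝓘(ℝ, E) (fun (p : G × G) ↦ p.1 * p.2)
  have S₃ : ContMDiff (𝓘(ℝ, E).prod 𝓘(ℝ, E)).tangent 𝓘(ℝ, E).tangent ∞ F₃ := by
    apply ContMDiff.contMDiff_tangentMap (n := ∞) _ (m := ∞) le_rfl
    exact contMDiff_mul 𝓘(ℝ, E) ∞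
  have S := (S₃.comp S₂).comp S₁
  have hF : (fun g : G ↦ (TotalSpace.mk g (leftEquiv g v) :
      TangentBundle 𝓘(ℝ, E) G)) = (F₃ ∘ F₂) ∘ F₁ := by
    funext g
    have h1 : F₃ (F₂ (F₁ g)) = TotalSpace.mk (g * 1)
      (mfderiv (𝓘(ℝ, E).prod 𝓘(ℝ, E)) 𝓘(ℝ, E) (fun (p : G × G) ↦ p.1 * p.2) (g, 1) ((0 : E), v)) := rfl
    have h2 : (mfderiv (𝓘(ℝ, E).prod 𝓘(ℝ, E)) 𝓘(ℝ, E) (fun (p : G × G) ↦ p.1 * p.2) (g, 1) ((0 : E), v))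
       = mfderiv 𝓘(ℝ, E) 𝓘(ℝ, E) (fun y : G ↦ g * y) 1 v := by
      refine (mfderiv_prod_eq_add_apply
        ((contMDiff_mul 𝓘(ℝ, E) ∞).mdifferentiableAt (by simp))).trans ?_
      change mfderiv 𝓘(ℝ, E) 𝓘(ℝ, E) (fun y : G ↦ y * 1) g (0 : E)
        + mfderiv 𝓘(ℝ, E) 𝓘(ℝ, E) (fun y : G ↦ g * y) 1 v = _
      exact (congrArg (· + _) (map_zero (mfderiv 𝓘(ℝ, E) 𝓘(ℝ, E) (fun y : G ↦ y * 1) g))).trans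
        (zero_add _)
    refine TotalSpace.ext (mul_one g).symm (heq_of_eq ?_)
    exact h2.symm
  rw [SmoothField, hF]
  exact S

lemma IsLeftInvariantMetric.inner_leftEquiv {g : Metric E G} (h : IsLeftInvariantMetric g) (x : G)
    (v w : LieAlg E G) : g.inner x (leftEquiv x v) (leftEquiv x w) = g.inner 1 v w := by
  have key : ∀ (y z : G), y = z → ∀ a b : E, g.inner y a b = g.inner z a b := by
    rintro y _ rfl a b
    rfl
  exact (key x (x * 1) (mul_one x).symm _ _).trans (h x 1 v w)

lemma IsLeftInvariantEndField.apply_leftEquiv {J : EndField E G} (h : IsLeftInvariantEndField J)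
    (x : G) (v : LieAlg E G) : J x (leftEquiv x v) = leftEquiv x (J 1 v) := by
  have key : ∀ (y z : G), y = z → ∀ a : E, (J y a : E) = J z a := by
    rintro y _ rfl a
    rfl
  exact (key x (x * 1) (mul_one x).symm _).trans (h x 1 v)

lemma mlieBracket_leftEquiv [CompleteSpace E] (v w : LieAlg E G) (x : G) :
    mlieBracket 𝓘(ℝ, E) (fun y : G ↦ leftEquiv y v) (fun y : G ↦ leftEquiv y w) x
      = leftEquiv x ⁅v, w⁆ :=
  (congrFun (mulInvariantVector_mlieBracket v w) x).symm

/-- Left translation of tangent vectors to the identity is smooth on the tangent bundle. -/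
theorem contMDiff_leftLog : ContMDiff (M' := E) 𝓘(ℝ, E).tangent 𝓘(ℝ, E) ∞
    (fun p : TangentBundle 𝓘(ℝ, E) G ↦ leftLog p.1 p.2) := by
  -- Multiplying the zero vector at the inverse of the base point with `p` itself lands in the fibre
  -- over `1`.
  let fi : TangentBundle 𝓘(ℝ, E) G → TangentBundle 𝓘(ℝ, E) G := fun p ↦ TotalSpace.mk' E p.1⁻¹ 0
  have sfi : ContMDiff 𝓘(ℝ, E).tangent 𝓘(ℝ, E).tangent ∞ fi :=
    (contMDiff_zeroSection ℝ (TangentSpace 𝓘(ℝ, E) : G → Type _)).comp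
      ((contMDiff_inv 𝓘(ℝ, E) ∞).comp (contMDiff_proj _))
  have sid : ContMDiff 𝓘(ℝ, E).tangent 𝓘(ℝ, E).tangent ∞
      (fun p : TangentBundle 𝓘(ℝ, E) G ↦ p) := contMDiff_id
  let F₁ : TangentBundle 𝓘(ℝ, E) G → (TangentBundle 𝓘(ℝ, E) G × TangentBundle 𝓘(ℝ, E) G) :=
    fun p ↦ (fi p, p)
  have S₁ : ContMDiff 𝓘(ℝ, E).tangent (𝓘(ℝ, E).tangent.prod 𝓘(ℝ, E).tangent) ∞ F₁ :=
    sfi.prodMk sid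
  let F₂ : (TangentBundle 𝓘(ℝ, E) G × TangentBundle 𝓘(ℝ, E) G) →
      TangentBundle (𝓘(ℝ, E).prod 𝓘(ℝ, E)) (G × G) :=
    (equivTangentBundleProd 𝓘(ℝ, E) G 𝓘(ℝ, E) G).symm
  have S₂ : ContMDiff (𝓘(ℝ, E).tangent.prod 𝓘(ℝ, E).tangent) (𝓘(ℝ, E).prod 𝓘(ℝ, E)).tangent ∞ F₂ :=
    contMDiff_equivTangentBundleProd_symm
  let F₃ : TangentBundle (𝓘(ℝ, E).prod 𝓘(ℝ, E)) (G × G) → TangentBundle 𝓘(ℝ, E) G :=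
    tangentMap (𝓘(ℝ, E).prod 𝓘(ℝ, E)) 𝓘(ℝ, E) (fun (p : G × G) ↦ p.1 * p.2)
  have S₃ : ContMDiff (𝓘(ℝ, E).prod 𝓘(ℝ, E)).tangent 𝓘(ℝ, E).tangent ∞ F₃ := by
    apply ContMDiff.contMDiff_tangentMap (n := ∞) _ (m := ∞) le_rfl
    exact contMDiff_mul 𝓘(ℝ, E) ∞
  have S : ContMDiff 𝓘(ℝ, E).tangent 𝓘(ℝ, E).tangent ∞ ((F₃ ∘ F₂) ∘ F₁) := (S₃.comp S₂).comp S₁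
  have hF : (F₃ ∘ F₂) ∘ F₁ = fun p : TangentBundle 𝓘(ℝ, E) G ↦
      (TotalSpace.mk (1 : G) (leftLog (E := E) p.1 p.2) : TangentBundle 𝓘(ℝ, E) G) := by
    funext p
    have h2 : (mfderiv (𝓘(ℝ, E).prod 𝓘(ℝ, E)) 𝓘(ℝ, E) (fun (p : G × G) ↦ p.1 * p.2) (p.1⁻¹, p.1)
        ((0 : E), p.2)) = mfderiv 𝓘(ℝ, E) 𝓘(ℝ, E) (fun y : G ↦ p.1⁻¹ * y) p.1 p.2 := by
      refine (mfderiv_prod_eq_add_apply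
        ((contMDiff_mul 𝓘(ℝ, E) ∞).mdifferentiableAt (by simp))).trans ?_
      change mfderiv 𝓘(ℝ, E) 𝓘(ℝ, E) (fun y : G ↦ y * p.1) p.1⁻¹ (0 : E)
        + mfderiv 𝓘(ℝ, E) 𝓘(ℝ, E) (fun y : G ↦ p.1⁻¹ * y) p.1 p.2 = _
      exact (congrArg (· + _) (map_zero (mfderiv 𝓘(ℝ, E) 𝓘(ℝ, E) (fun y : G ↦ y * p.1)
        p.1⁻¹))).trans (zero_add _)
    exact TotalSpace.ext (inv_mul_cancel p.1) (heq_of_eq h2)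
  rw [hF] at S
  intro p
  have hp := S.contMDiffAt (x := p)
  rw [contMDiffAt_totalSpace] at hp
  refine hp.2.congr_of_eventuallyEq (Filter.Eventually.of_forall fun q => ?_)
  -- All values lie over `1`, where the trivialization given by the chart at `1` is the identity.
  have h1 : (1 : G) ∈ (extChartAt 𝓘(ℝ, E) (1 : G)).source := mem_extChartAt_source 1
  have h2 : tangentCoordChange 𝓘(ℝ, E) (1 : G) 1 1 (leftLog q.1 q.2) = leftLog q.1 q.2 :=
    tangentCoordChange_self h1
  exact h2.symm

end HermitianGeometry

end

/-! ### From the Strominger connection to the Lie algebra -/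

section

namespace HermitianGeometry

variable {E : Type*} [NormedAddCommGroup E] [NormedSpace ℝ E]
  {G : Type*} [TopologicalSpace G] [ChartedSpace E G] [Group G] [LieGroup 𝓘(ℝ, E) ∞ G]

/-- The inner product of the Lie algebra induced by a Riemannian metric. -/
def metricForm (g : Metric E G) : LieAlg E G →ₗ[ℝ] LieAlg E G →ₗ[ℝ] ℝ :=
  LinearMap.mk₂ ℝ (fun v w => g.inner 1 v w)
    (fun v v' w => congrArg (fun T : E →L[ℝ] ℝ => T w) ((g.inner 1).map_add v v'))
    (fun r v w => congrArg (fun T : E →L[ℝ] ℝ => T w) ((g.inner 1).map_smul r v))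
    (fun v w w' => (g.inner 1 v).map_add w w')
    (fun r v w => (g.inner 1 v).map_smul r w)

lemma metricForm_apply (g : Metric E G) (v w : LieAlg E G) : metricForm g v w = g.inner 1 v w := rfl

/-- The endomorphism of the Lie algebra induced by a field of endomorphisms. -/
def endForm (J : EndField E G) : LieAlg E G →ₗ[ℝ] LieAlg E G := (J 1 : LieAlg E G →ₗ[ℝ] LieAlg E G)

lemma endForm_apply (J : EndField E G) (v : LieAlg E G) : endForm J v = J 1 v := rfl

lemma hasNormalForm_iff [CompleteSpace E] (g : Metric E G) (J : EndField E G) (n r s : ℕ) :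
    HasNormalForm g J n r s ↔ LieHasNormalForm (metricForm g) (endForm J) n r s := Iff.rfl

lemma isHermitianPair {g : Metric E G} {J : EndField E G} (hJ : IsComplexStructure J)
    (hg : IsHermitianMetric g J) : IsHermitianPair (metricForm g) (endForm J) where
  symm v w := g.symm 1 v w
  pos v hv := g.pos 1 v hv
  sq v := hJ.sq 1 v
  orth v w := hg 1 v w

lemma mdifferentiableAt_leftEquiv (v : LieAlg E G) (x : G) :
    MDifferentiableAt 𝓘(ℝ, E) 𝓘(ℝ, E).tangent
      (fun y : G ↦ (TotalSpace.mk y (leftEquiv y v) : TangentBundle 𝓘(ℝ, E) G)) x :=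
  (contMDiff_leftEquiv v).mdifferentiableAt (by simp)

lemma leftEquiv_add_field (v w : LieAlg E G) : (fun y : G ↦ leftEquiv (E := E) y (v + w))
    = (fun y : G ↦ leftEquiv (E := E) y v) + fun y : G ↦ leftEquiv (E := E) y w := by
  funext y
  exact map_add (leftEquiv y) v w

lemma leftEquiv_smul_field (r : ℝ) (v : LieAlg E G) : (fun y : G ↦ leftEquiv (E := E) y (r • v))
    = r • fun y : G ↦ leftEquiv (E := E) y v := by
  funext y
  exact map_smul (leftEquiv y) r v

/-- A connection, evaluated at a point on left-invariant vector fields. -/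
def connectionForm (cov : Connection E G) (x : G) : LieAlg E G →ₗ[ℝ] LieAlg E G →ₗ[ℝ] LieAlg E G :=
  LinearMap.mk₂ ℝ (fun v w => (leftEquiv x).symm (cov (fun y => leftEquiv y w) x (leftEquiv x v)))
    (fun v v' w => by rw [map_add, map_add, map_add])
    (fun r v w => by rw [map_smul, map_smul, map_smul])
    (fun v w w' => by
      rw [leftEquiv_add_field, cov.isCovariantDerivativeOnUniv.add
        (mdifferentiableAt_leftEquiv w x) (mdifferentiableAt_leftEquiv w' x),
        add_apply, map_add])
    (fun r v w => by
      rw [leftEquiv_smul_field, cov.isCovariantDerivativeOnUniv.smul_const r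
        (mdifferentiableAt_leftEquiv w x), smul_apply, map_smul])

lemma leftEquiv_connectionForm (cov : Connection E G) (x : G) (v w : LieAlg E G) :
    leftEquiv x (connectionForm cov x v w) = cov (fun y => leftEquiv y w) x (leftEquiv x v) :=
  (leftEquiv x).apply_symm_apply _

variable [FiniteDimensional ℝ E] [CompleteSpace E] {g : Metric E G} {J : EndField E G}

/-- Inner products of left-invariant fields are constant, so the derivative in the metric condition
drops out. Invariance of `cov` is not assumed; hence the base point `x`. -/
theorem IsStrominger.isStromingerForm {cov : Connection E G} (hcov : IsStrominger g J cov)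
    (hJinv : IsLeftInvariantEndField J) (hginv : IsLeftInvariantMetric g) (x : G) :
    IsStromingerForm (metricForm g) (endForm J) (connectionForm cov x) where
  skew u v w := by
    have h := hcov.metric _ _ (contMDiff_leftEquiv v) (contMDiff_leftEquiv w) x (leftEquiv x u)
    have hc : (fun y : G ↦ g.inner y (leftEquiv y v) (leftEquiv y w))
        = fun _ ↦ g.inner (1 : G) v w := by
      funext y
      exact hginv.inner_leftEquiv y v w
    rw [hc, mvfderiv_const, zero_apply, ← leftEquiv_connectionForm,
      ← leftEquiv_connectionForm, hginv.inner_leftEquiv, hginv.inner_leftEquiv] at h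
    rw [metricForm_apply, metricForm_apply]
    linarith
  comm u v := by
    have h := hcov.parallel _ (contMDiff_leftEquiv v) x (leftEquiv x u)
    simp only [hJinv.apply_leftEquiv] at h
    rw [← leftEquiv_connectionForm, ← leftEquiv_connectionForm, hJinv.apply_leftEquiv] at h
    exact (leftEquiv x).injective h
  torsion_skew u v w := by
    have h := hcov.torsion_skew x (leftEquiv x u) (leftEquiv x v) (leftEquiv x w)
    have ht : ∀ v : LieAlg E G, cov.torsion x (leftEquiv x u) (leftEquiv x v)
        = leftEquiv x (connectionForm cov x u v - connectionForm cov x v u - ⁅u, v⁆) := fun v => by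
      have h1 := CovariantDerivative.torsion_apply (cov := cov)
        (X := fun y : G => leftEquiv y u) (Y := fun y : G => leftEquiv y v)
        (mdifferentiableAt_leftEquiv u x) (mdifferentiableAt_leftEquiv v x)
      rw [mlieBracket_leftEquiv, ← leftEquiv_connectionForm, ← leftEquiv_connectionForm,
        ← map_sub, ← map_sub] at h1
      exact h1
    rwa [ht, ht, hginv.inner_leftEquiv, hginv.inner_leftEquiv] at h

lemma lie_endForm_endForm (hJ : IsComplexStructure J) (hJinv : IsLeftInvariantEndField J)
    (v w : LieAlg E G) : ⁅endForm J v, endForm J w⁆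
      = ⁅v, w⁆ + endForm J (⁅endForm J v, w⁆ + ⁅v, endForm J w⁆) := by
  have h := hJ.nijenhuis _ _ (contMDiff_leftEquiv v) (contMDiff_leftEquiv w) 1
  simp only [hJinv.apply_leftEquiv] at h
  rw [mlieBracket_leftEquiv, mlieBracket_leftEquiv, mlieBracket_leftEquiv, mlieBracket_leftEquiv,
    leftEquiv_one, leftEquiv_one, leftEquiv_one, leftEquiv_one] at h
  rw [map_add]
  simp only [endForm_apply]
  rw [← sub_eq_zero, ← h]
  abel

/-- By algebraic uniqueness the coefficients of `cov` are the same at all points, so covariant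
derivatives of left-invariant fields are left-invariant and can be iterated. -/
theorem IsStrominger.curvature_leftEquiv {cov : Connection E G} (hcov : IsStrominger g J cov)
    (hJ : IsComplexStructure J) (hJinv : IsLeftInvariantEndField J)
    (hg : IsHermitianMetric g J) (hginv : IsLeftInvariantMetric g) (u v w : LieAlg E G) (x : G) :
    curvature cov (fun y => leftEquiv y u) (fun y => leftEquiv y v) (fun y => leftEquiv y w) x
      = leftEquiv x (invariantCurvature (connectionForm cov 1) u v w) := by
  have hconst : ∀ y, connectionForm cov y = connectionForm cov 1 := fun y =>
    (hcov.isStromingerForm hJinv hginv y).unique (isHermitianPair hJ hg)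
      (hcov.isStromingerForm hJinv hginv 1)
  have hcv : ∀ (v w : LieAlg E G) (y : G), cov (fun y => leftEquiv y w) y (leftEquiv y v)
      = leftEquiv y (connectionForm cov 1 v w) := fun v w y => by
    rw [← hconst y, leftEquiv_connectionForm]
  unfold curvature
  simp only [hcv, mlieBracket_leftEquiv]
  rw [invariantCurvature, map_sub, map_sub]

theorem IsStromingerKahlerLike.exists_hasNormalForm (h : IsStromingerKahlerLike g J)
    (hJ : IsComplexStructure J) (hJinv : IsLeftInvariantEndField J)
    (hg : IsHermitianMetric g J) (hginv : IsLeftInvariantMetric g)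
    (hnil : IsNilpotentLieGroup E G) {n : ℕ} (hn : Module.finrank ℝ E = 2 * n) :
    ∃ r s : ℕ, HasNormalForm g J n r s := by
  obtain ⟨cov, hcov, hK⟩ := h
  have : LieRing.IsNilpotent (LieAlg E G) := hnil
  have : FiniteDimensional ℝ (LieAlg E G) := inferInstanceAs (FiniteDimensional ℝ E)
  refine (hcov.isStromingerForm hJinv hginv 1).exists_normalForm (isHermitianPair hJ hg)
    (lie_endForm_endForm hJ hJinv) (fun u v w => ?_) hn
  have h := hK.bianchi _ _ _ (contMDiff_leftEquiv u) (contMDiff_leftEquiv v)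
    (contMDiff_leftEquiv w) 1
  rwa [hcov.curvature_leftEquiv hJ hJinv hg hginv, hcov.curvature_leftEquiv hJ hJinv hg hginv,
    hcov.curvature_leftEquiv hJ hJinv hg hginv, leftEquiv_one, leftEquiv_one, leftEquiv_one] at h

end HermitianGeometry

end

/-! ### Derivatives of functions along brackets of vector fields -/

section

section Derivative

variable {E : Type*} [NormedAddCommGroup E] [NormedSpace ℝ E]
  {M : Type*} [TopologicalSpace M] [ChartedSpace E M]
  {F₁ F₂ F₃ : Type*} [NormedAddCommGroup F₁] [NormedSpace ℝ F₁] [NormedAddCommGroup F₂]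
  [NormedSpace ℝ F₂] [NormedAddCommGroup F₃] [NormedSpace ℝ F₃]

lemma mvfderiv_bilinear (B : F₁ →L[ℝ] F₂ →L[ℝ] F₃) {f : M → F₁} {f' : M → F₂} {x : M}
    (hf : MDifferentiableAt 𝓘(ℝ, E) 𝓘(ℝ, F₁) f x) (hf' : MDifferentiableAt 𝓘(ℝ, E) 𝓘(ℝ, F₂) f' x)
    (v : TangentSpace 𝓘(ℝ, E) x) :
    mvfderiv 𝓘(ℝ, E) (fun y ↦ B (f y) (f' y)) x v
      = B (mvfderiv 𝓘(ℝ, E) f x v) (f' x) + B (f x) (mvfderiv 𝓘(ℝ, E) f' x v) := by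
  have h1 := hf.hasMFDerivAt
  have h2 := hf'.hasMFDerivAt
  have h3 : HasMFDerivAt 𝓘(ℝ, E) 𝓘(ℝ, F₃) (fun y ↦ B (f y) (f' y)) x
      (B.precompR E (f x) (mvfderiv 𝓘(ℝ, E) f' x) + B.precompL E (mvfderiv 𝓘(ℝ, E) f x) (f' x)) := by
    refine ⟨?_, ?_⟩
    · exact ((B.continuous.continuousAt.comp h1.1).clm_apply h2.1)
    · have h := B.hasFDerivWithinAt_of_bilinear h1.2 h2.2
      simp only [writtenInExtChartAt, extChartAt_model_space_eq_id, Function.comp_apply,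
        PartialEquiv.refl_coe, id_eq, extChartAt_to_inv] at h
      exact h
  have h4 : mvfderiv 𝓘(ℝ, E) (fun y ↦ B (f y) (f' y)) x
      = (B.precompR E (f x) (mvfderiv 𝓘(ℝ, E) f' x)
        + B.precompL E (mvfderiv 𝓘(ℝ, E) f x) (f' x) : E →L[ℝ] F₃) := h3.mfderiv
  rw [h4]
  exact add_comm _ _

lemma mvfderiv_clm (T : F₁ →L[ℝ] F₂) {f : M → F₁} {x : M}
    (hf : MDifferentiableAt 𝓘(ℝ, E) 𝓘(ℝ, F₁) f x) (v : TangentSpace 𝓘(ℝ, E) x) :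
    mvfderiv 𝓘(ℝ, E) (fun y ↦ T (f y)) x v = T (mvfderiv 𝓘(ℝ, E) f x v) := by
  have h3 : HasMFDerivAt 𝓘(ℝ, E) 𝓘(ℝ, F₂) (fun y ↦ T (f y)) x
      (T ∘L (mvfderiv 𝓘(ℝ, E) f x : E →L[ℝ] F₁)) := by
    refine ⟨T.continuous.continuousAt.comp hf.hasMFDerivAt.1, ?_⟩
    exact T.hasFDerivAt.comp_hasFDerivWithinAt _ hf.hasMFDerivAt.2
  exact congrArg (fun S : E →L[ℝ] F₂ => S v) h3.mfderiv

variable [IsManifold 𝓘(ℝ, E) ∞ M]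

lemma contMDiff_mvfderiv {f : M → F₁} (hf : ContMDiff 𝓘(ℝ, E) 𝓘(ℝ, F₁) ∞ f)
    {Y : (x : M) → HermitianGeometry.Tan E x} (hY : HermitianGeometry.SmoothField Y) :
    ContMDiff 𝓘(ℝ, E) 𝓘(ℝ, F₁) ∞ (fun x ↦ mvfderiv 𝓘(ℝ, E) f x (Y x)) := by
  have h1 : ContMDiff 𝓘(ℝ, E).tangent 𝓘(ℝ, F₁).tangent ∞ (tangentMap 𝓘(ℝ, E) 𝓘(ℝ, F₁) f) :=
    hf.contMDiff_tangentMap (m := ∞) le_rfl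
  exact (contMDiff_snd_tangentBundle_modelSpace F₁ 𝓘(ℝ, F₁)).comp (h1.comp hY)

/-- Compare the Jacobi identity for `X`, `Y`, `f W` with `f` times the one for `X`, `Y`, `W`: the
terms without derivatives of `f` and the mixed terms cancel, and what remains is the claim
multiplied by `W x ≠ 0`. -/
theorem mvfderiv_mlieBracket_real [CompleteSpace E] {f : M → ℝ}
    (hf : ContMDiff 𝓘(ℝ, E) 𝓘(ℝ, ℝ) ∞ f)
    {X Y W : (x : M) → HermitianGeometry.Tan E x} (hX : HermitianGeometry.SmoothField X)
    (hY : HermitianGeometry.SmoothField Y) (hW : HermitianGeometry.SmoothField W) {x : M}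
    (hWx : W x ≠ 0) :
    mvfderiv 𝓘(ℝ, E) f x (mlieBracket 𝓘(ℝ, E) X Y x)
      = mvfderiv 𝓘(ℝ, E) (fun y ↦ mvfderiv 𝓘(ℝ, E) f y (Y y)) x (X x)
        - mvfderiv 𝓘(ℝ, E) (fun y ↦ mvfderiv 𝓘(ℝ, E) f y (X y)) x (Y x) := by
  have hbr : ∀ {U V : (x : M) → HermitianGeometry.Tan E x}, HermitianGeometry.SmoothField U →
      HermitianGeometry.SmoothField V →
      ∀ y, MDifferentiableAt 𝓘(ℝ, E) 𝓘(ℝ, E).tangent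
        (fun y ↦ (TotalSpace.mk y (mlieBracket 𝓘(ℝ, E) U V y) : TangentBundle 𝓘(ℝ, E) M)) y := by
    intro U V hU hV y
    have : IsManifold 𝓘(ℝ, E) (((2 : ℕ∞) : WithTop ℕ∞) + 1) M :=
      IsManifold.of_le (n := ∞) (ENat.LEInfty.out (m := 3))
    have h2 : ((2 : ℕ∞) : WithTop ℕ∞) ≤ ∞ := ENat.LEInfty.out (m := 2)
    refine (ContDiff.mlieBracket_vectorField (n := 2) (m := 1) (hU.of_le h2) (hV.of_le h2)
      ?_).mdifferentiableAt one_ne_zero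
    rw [minSmoothness_of_isRCLikeNormedField]
    exact le_rfl
  have hmd : ∀ {U : (x : M) → HermitianGeometry.Tan E x}, HermitianGeometry.SmoothField U → ∀ y,
      MDifferentiableAt 𝓘(ℝ, E) 𝓘(ℝ, E).tangent
        (fun y ↦ (TotalSpace.mk y (U y) : TangentBundle 𝓘(ℝ, E) M)) y := fun hU y =>
    ContMDiff.mdifferentiableAt hU (by simp)
  have hmf : ∀ {f : M → ℝ}, ContMDiff 𝓘(ℝ, E) 𝓘(ℝ, ℝ) ∞ f → ∀ y,
      MDifferentiableAt 𝓘(ℝ, E) 𝓘(ℝ, ℝ) f y := fun hf y => hf.mdifferentiableAt (by simp)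
  have hfW : HermitianGeometry.SmoothField (fun y ↦ f y • W y) := by
    exact hf.smul_section hW
  have key : ∀ {U : (x : M) → HermitianGeometry.Tan E x}, mlieBracket 𝓘(ℝ, E) U (f • W)
      = (fun y ↦ mvfderiv 𝓘(ℝ, E) f y (U y)) • W + f • mlieBracket 𝓘(ℝ, E) U W := by
    intro U
    funext y
    exact mlieBracket_smul_right (hmf hf y) (hmd hW y)
  have hle : minSmoothness ℝ 2 ≤ ∞ := by
    rw [minSmoothness_of_isRCLikeNormedField]
    exact ENat.LEInfty.out
  have hJ := leibniz_identity_mlieBracket_apply (I := 𝓘(ℝ, E)) (U := X) (V := Y) (W := f • W)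
    (x := x) (hX.contMDiffAt.of_le hle) (hY.contMDiffAt.of_le hle) (hfW.contMDiffAt.of_le hle)
  have hJ' := leibniz_identity_mlieBracket_apply (I := 𝓘(ℝ, E)) (U := X) (V := Y) (W := W)
    (x := x) (hX.contMDiffAt.of_le hle) (hY.contMDiffAt.of_le hle) (hW.contMDiffAt.of_le hle)
  have hfX := hmf (contMDiff_mvfderiv hf hX) x
  have hfY := hmf (contMDiff_mvfderiv hf hY) x
  have hexp : ∀ {U V : (x : M) → HermitianGeometry.Tan E x}, HermitianGeometry.SmoothField V →
      mlieBracket 𝓘(ℝ, E) U (mlieBracket 𝓘(ℝ, E) V (f • W)) x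
        = mvfderiv 𝓘(ℝ, E) (fun y ↦ mvfderiv 𝓘(ℝ, E) f y (V y)) x (U x) • W x
          + mvfderiv 𝓘(ℝ, E) f x (V x) • mlieBracket 𝓘(ℝ, E) U W x
          + (mvfderiv 𝓘(ℝ, E) f x (U x) • mlieBracket 𝓘(ℝ, E) V W x
          + f x • mlieBracket 𝓘(ℝ, E) U (mlieBracket 𝓘(ℝ, E) V W) x) := by
    intro U V hV
    have h1 := hmf (contMDiff_mvfderiv hf hV) x
    rw [key, mlieBracket_add_right (h1.smul_section (hmd hW x))
      ((hmf hf x).smul_section (hbr hV hW x)), mlieBracket_smul_right h1 (hmd hW x),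
      mlieBracket_smul_right (hmf hf x) (hbr hV hW x)]
  rw [hexp hY, hexp hX, mlieBracket_smul_right (hmf hf x) (hmd hW x), hJ'] at hJ
  refine smul_left_injective ℝ hWx ?_
  simp only [sub_smul]
  rw [eq_sub_iff_add_eq]
  have hJ2 := sub_eq_zero.2 hJ
  rw [← sub_eq_zero, ← neg_eq_zero, ← hJ2]
  module

end Derivative

end

/-! ### Left-invariant connections -/

section

namespace HermitianGeometry

variable {E : Type*} [NormedAddCommGroup E] [NormedSpace ℝ E]
  {G : Type*} [TopologicalSpace G] [ChartedSpace E G] [Group G] [LieGroup 𝓘(ℝ, E) ∞ G]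

/-- The coefficients of a vector field with respect to left translation. -/
def coeff (Y : (x : G) → Tan E x) (x : G) : E := leftLog x (Y x)

lemma leftEquiv_coeff (Y : (x : G) → Tan E x) (x : G) :
    leftEquiv (E := E) x (coeff (E := E) Y x) = Y x := (leftEquiv x).apply_symm_apply (Y x)

lemma coeff_leftEquiv (v : LieAlg E G) (x : G) :
    coeff (fun y : G ↦ leftEquiv y v) x = v := (leftEquiv x).symm_apply_apply v

lemma SmoothField.contMDiff_coeff {Y : (x : G) → Tan E x} (hY : SmoothField Y) :
    ContMDiff 𝓘(ℝ, E) 𝓘(ℝ, E) ∞ (coeff Y) := contMDiff_leftLog.comp hY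

lemma mdifferentiableAt_coeff {Y : (x : G) → Tan E x} {x : G}
    (hY : MDifferentiableAt 𝓘(ℝ, E) 𝓘(ℝ, E).tangent
      (fun y : G ↦ (TotalSpace.mk y (Y y) : TangentBundle 𝓘(ℝ, E) G)) x) :
    MDifferentiableAt 𝓘(ℝ, E) 𝓘(ℝ, E) (coeff Y) x :=
  (contMDiff_leftLog.mdifferentiableAt (by simp)).comp x hY

lemma SmoothField.mdifferentiableAt_coeff {Y : (x : G) → Tan E x} (hY : SmoothField Y) (x : G) :
    MDifferentiableAt 𝓘(ℝ, E) 𝓘(ℝ, E) (coeff Y) x :=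
  hY.contMDiff_coeff.mdifferentiableAt (by simp)

variable [FiniteDimensional ℝ E]

/-- A bilinear map of the Lie algebra as a continuous bilinear map of the model space. -/
def toModel (Γ : LieAlg E G →ₗ[ℝ] LieAlg E G →ₗ[ℝ] LieAlg E G) : E →L[ℝ] E →L[ℝ] E :=
  LinearMap.toContinuousLinearMap (E := E) (F' := E →L[ℝ] E)
    ((LinearMap.toContinuousLinearMap (𝕜 := ℝ) (E := E) (F' := E)).toLinearMap ∘ₗ
      (Γ : E →ₗ[ℝ] E →ₗ[ℝ] E))

lemma toModel_apply (Γ : LieAlg E G →ₗ[ℝ] LieAlg E G →ₗ[ℝ] LieAlg E G) (v w : E) :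
    toModel Γ v w = Γ v w := rfl

/-- The left-invariant connection with prescribed values on left-invariant vector fields. -/
def invariantConnection (Γ : LieAlg E G →ₗ[ℝ] LieAlg E G →ₗ[ℝ] LieAlg E G) : Connection E G where
  -- In the left trivialization this is `∇_v Y = dY(v) + Γ(v, Y)`.
  toFun Y x := (mfderiv 𝓘(ℝ, E) 𝓘(ℝ, E) (fun y : G ↦ x * y) 1 : E →L[ℝ] E) ∘L
    ((mvfderiv 𝓘(ℝ, E) (coeff Y) x : E →L[ℝ] E) + (toModel Γ).flip (coeff Y x) ∘L
      (mfderiv 𝓘(ℝ, E) 𝓘(ℝ, E) (fun y : G ↦ x⁻¹ * y) x : E →L[ℝ] E))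
  isCovariantDerivativeOnUniv :=
    { add := by
        intro Y Z x hY hZ _
        have h : coeff (Y + Z) = coeff Y + coeff Z := by
          funext y
          exact map_add (leftEquiv y).symm (Y y) (Z y)
        refine ContinuousLinearMap.ext fun v => ?_
        change leftEquiv (E := E) x (mvfderiv 𝓘(ℝ, E) (coeff (Y + Z)) x v
          + toModel Γ (leftLog x v) (coeff (Y + Z) x))
          = leftEquiv (E := E) x (mvfderiv 𝓘(ℝ, E) (coeff Y) x v
            + toModel Γ (leftLog x v) (coeff Y x))
          + leftEquiv (E := E) x (mvfderiv 𝓘(ℝ, E) (coeff Z) x v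
            + toModel Γ (leftLog x v) (coeff Z x))
        rw [h, mvfderiv_add (mdifferentiableAt_coeff hY) (mdifferentiableAt_coeff hZ)]
        refine (congrArg (leftEquiv (E := E) x) ?_).trans (map_add (leftEquiv x) _ _)
        change mvfderiv 𝓘(ℝ, E) (coeff Y) x v + mvfderiv 𝓘(ℝ, E) (coeff Z) x v
          + toModel Γ (leftLog x v) (coeff Y x + coeff Z x) = _
        rw [map_add]
        exact add_add_add_comm _ _ _ _
      leibniz := by
        intro Y f x hY hf _
        have h : coeff (f • Y) = f • coeff Y := by
          funext y
          exact map_smul (leftEquiv y).symm (f y) (Y y)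
        refine ContinuousLinearMap.ext fun v => ?_
        change leftEquiv (E := E) x (mvfderiv 𝓘(ℝ, E) (coeff (f • Y)) x v
          + toModel Γ (leftLog x v) (coeff (f • Y) x))
          = f x • leftEquiv (E := E) x (mvfderiv 𝓘(ℝ, E) (coeff Y) x v
            + toModel Γ (leftLog x v) (coeff Y x)) + mvfderiv 𝓘(ℝ, E) f x v • Y x
        rw [h, mvfderiv_smul hf (mdifferentiableAt_coeff hY)]
        have h2 : f x • leftEquiv (E := E) x (mvfderiv 𝓘(ℝ, E) (coeff Y) x v
            + toModel Γ (leftLog x v) (coeff Y x)) + mvfderiv 𝓘(ℝ, E) f x v • Y x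
            = leftEquiv (E := E) x (f x • (mvfderiv 𝓘(ℝ, E) (coeff Y) x v
            + toModel Γ (leftLog x v) (coeff Y x)) + mvfderiv 𝓘(ℝ, E) f x v • coeff Y x) := by
          conv_lhs => rw [← leftEquiv_coeff Y x]
          exact (((leftEquiv (E := E) x).map_add _ _).trans (congrArg₂ (· + ·)
            ((leftEquiv (E := E) x).map_smul _ _) ((leftEquiv (E := E) x).map_smul _ _))).symm
        rw [h2]
        refine congrArg (leftEquiv (E := E) x) ?_
        change f x • mvfderiv 𝓘(ℝ, E) (coeff Y) x v + mvfderiv 𝓘(ℝ, E) f x v • coeff Y x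
          + toModel Γ (leftLog x v) (f x • coeff Y x) = f x • (mvfderiv 𝓘(ℝ, E) (coeff Y) x v
            + toModel Γ (leftLog x v) (coeff Y x)) + mvfderiv 𝓘(ℝ, E) f x v • coeff Y x
        rw [map_smul, smul_add]
        exact add_right_comm _ _ _ }

lemma leftLog_invariantConnection (Γ : LieAlg E G →ₗ[ℝ] LieAlg E G →ₗ[ℝ] LieAlg E G)
    (Y : (x : G) → Tan E x) (x : G) (v : Tan E x) :
    leftLog x (invariantConnection Γ Y x v)
      = mvfderiv 𝓘(ℝ, E) (coeff Y) x v + toModel Γ (leftLog x v) (coeff Y x) :=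
  (leftEquiv x).symm_apply_apply _

lemma coeff_invariantConnection (Γ : LieAlg E G →ₗ[ℝ] LieAlg E G →ₗ[ℝ] LieAlg E G)
    (X Y : (x : G) → Tan E x) (x : G) :
    coeff (fun y ↦ invariantConnection Γ Y y (X y)) x
      = mvfderiv 𝓘(ℝ, E) (coeff Y) x (X x) + toModel Γ (coeff X x) (coeff Y x) :=
  leftLog_invariantConnection Γ Y x (X x)

end HermitianGeometry

end

/-! ### Torsion, brackets and curvature in the left trivialization -/

section

namespace HermitianGeometry

variable {E : Type*} [NormedAddCommGroup E] [NormedSpace ℝ E]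
  {G : Type*} [TopologicalSpace G] [ChartedSpace E G] [Group G] [LieGroup 𝓘(ℝ, E) ∞ G]
  [FiniteDimensional ℝ E]

lemma invariantConnection_leftEquiv (Γ : LieAlg E G →ₗ[ℝ] LieAlg E G →ₗ[ℝ] LieAlg E G)
    (v w : LieAlg E G) (x : G) :
    invariantConnection Γ (fun y ↦ leftEquiv y w) x (leftEquiv x v) = leftEquiv x (Γ v w) := by
  apply (leftEquiv x).symm.injective
  rw [LinearEquiv.symm_apply_apply]
  have h := coeff_invariantConnection Γ (fun y ↦ leftEquiv y v) (fun y ↦ leftEquiv y w) x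
  have hc : coeff (fun y : G ↦ leftEquiv (E := E) y w)
      = fun _ ↦ coeff (fun y : G ↦ leftEquiv (E := E) y w) x :=
    funext fun y => (coeff_leftEquiv w y).trans (coeff_leftEquiv w x).symm
  have h0 : mvfderiv 𝓘(ℝ, E) (coeff fun y : G ↦ leftEquiv (E := E) y w) x (leftEquiv x v) = 0 := by
    rw [hc, mvfderiv_const]
    rfl
  rw [h0, zero_add] at h
  refine h.trans ((toModel_apply Γ _ _).trans ?_)
  exact congrArg₂ (fun a b => Γ a b) (coeff_leftEquiv v x) (coeff_leftEquiv w x)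

variable [CompleteSpace E]

lemma torsion_invariantConnection (Γ : LieAlg E G →ₗ[ℝ] LieAlg E G →ₗ[ℝ] LieAlg E G)
    (v w : LieAlg E G) (x : G) :
    (invariantConnection Γ).torsion x (leftEquiv x v) (leftEquiv x w)
      = leftEquiv x (Γ v w - Γ w v - ⁅v, w⁆) := by
  have h := CovariantDerivative.torsion_apply (cov := invariantConnection Γ)
    (X := fun y : G => leftEquiv y v) (Y := fun y : G => leftEquiv y w)
    (mdifferentiableAt_leftEquiv v x) (mdifferentiableAt_leftEquiv w x)
  rw [mlieBracket_leftEquiv, invariantConnection_leftEquiv, invariantConnection_leftEquiv,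
    ← map_sub, ← map_sub] at h
  exact h

variable (E G) in
/-- The Lie bracket of the Lie algebra, as a bilinear map. -/
def lieForm : LieAlg E G →ₗ[ℝ] LieAlg E G →ₗ[ℝ] LieAlg E G :=
  (LieModule.toEnd ℝ (LieAlg E G) (LieAlg E G) : LieAlg E G →ₗ[ℝ] LieAlg E G →ₗ[ℝ] LieAlg E G)

/-- The connection with `Γ = 0` has as torsion minus the Lie bracket on left-invariant fields.
Torsion is tensorial, so its defining formula can be solved for the bracket of arbitrary fields. -/
lemma coeff_mlieBracket {X Y : (x : G) → Tan E x} (hX : SmoothField X) (hY : SmoothField Y)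
    (x : G) : coeff (mlieBracket 𝓘(ℝ, E) X Y) x
      = mvfderiv 𝓘(ℝ, E) (coeff Y) x (X x) - mvfderiv 𝓘(ℝ, E) (coeff X) x (Y x)
        + toModel (lieForm E G) (coeff X x) (coeff Y x) := by
  have h := CovariantDerivative.torsion_apply (cov := invariantConnection (0 : LieAlg E G →ₗ[ℝ] _))
    (X := X) (Y := Y) (ContMDiff.mdifferentiableAt hX (by simp) (x := x))
    (ContMDiff.mdifferentiableAt hY (by simp))
  have ht := torsion_invariantConnection (0 : LieAlg E G →ₗ[ℝ] LieAlg E G →ₗ[ℝ] LieAlg E G)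
    (coeff (E := E) X x) (coeff (E := E) Y x) x
  rw [leftEquiv_coeff, leftEquiv_coeff] at ht
  rw [ht] at h
  have h2 := congrArg (leftEquiv x).symm h
  rw [LinearEquiv.symm_apply_apply, map_sub, map_sub] at h2
  have hXY := coeff_invariantConnection (0 : LieAlg E G →ₗ[ℝ] LieAlg E G →ₗ[ℝ] LieAlg E G) X Y x
  have hYX := coeff_invariantConnection (0 : LieAlg E G →ₗ[ℝ] LieAlg E G →ₗ[ℝ] LieAlg E G) Y X x
  have h0 : ∀ v w : E, toModel (0 : LieAlg E G →ₗ[ℝ] LieAlg E G →ₗ[ℝ] LieAlg E G) v w = 0 :=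
    fun v w => rfl
  rw [h0, add_zero] at hXY hYX
  have h3 : (0 : E) - 0 - toModel (lieForm E G) (coeff X x) (coeff Y x)
      = mvfderiv 𝓘(ℝ, E) (coeff Y) x (X x) - mvfderiv 𝓘(ℝ, E) (coeff X) x (Y x)
        - coeff (mlieBracket 𝓘(ℝ, E) X Y) x := by
    rw [← hXY, ← hYX]
    exact h2
  rw [sub_zero, zero_sub, eq_comm, sub_eq_iff_eq_add] at h3
  rw [h3]
  abel

/-- Functionals reduce this to real-valued functions; a non-zero left-invariant field is the
auxiliary `W`, which exists unless `E` is trivial. -/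
lemma mvfderiv_mlieBracket {f : G → E} (hf : ContMDiff 𝓘(ℝ, E) 𝓘(ℝ, E) ∞ f)
    {X Y : (x : G) → Tan E x} (hX : SmoothField X) (hY : SmoothField Y) (x : G) :
    mvfderiv 𝓘(ℝ, E) f x (mlieBracket 𝓘(ℝ, E) X Y x)
      = mvfderiv 𝓘(ℝ, E) (fun y ↦ mvfderiv 𝓘(ℝ, E) f y (Y y)) x (X x)
        - mvfderiv 𝓘(ℝ, E) (fun y ↦ mvfderiv 𝓘(ℝ, E) f y (X y)) x (Y x) := by
  rcases subsingleton_or_nontrivial E with _ | _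
  · exact Subsingleton.elim _ _
  obtain ⟨w, hw⟩ := exists_ne (0 : E)
  have hwx : leftEquiv (E := E) x w ≠ 0 := fun h => hw ((leftEquiv (E := E) x).map_eq_zero_iff.1 h)
  have hmd : ∀ {f : G → E}, ContMDiff 𝓘(ℝ, E) 𝓘(ℝ, E) ∞ f → ∀ y,
      MDifferentiableAt 𝓘(ℝ, E) 𝓘(ℝ, E) f y := fun hf y => hf.mdifferentiableAt (by simp)
  refine (SeparatingDual.eq_iff_forall_dual_eq (R := ℝ)).2 fun φ => ?_
  have h := mvfderiv_mlieBracket_real (φ.contMDiff.comp hf) hX hY (contMDiff_leftEquiv w) hwx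
  have hφ : ∀ (y : G) (v : Tan E y), mvfderiv 𝓘(ℝ, E) (φ ∘ f) y v
      = φ (mvfderiv 𝓘(ℝ, E) f y v) := fun y v => mvfderiv_clm φ (hmd hf y) v
  simp only [hφ] at h
  rw [mvfderiv_clm φ (hmd (contMDiff_mvfderiv hf hX) x),
    mvfderiv_clm φ (hmd (contMDiff_mvfderiv hf hY) x)] at h
  rw [h, map_sub]

/-- The curvature of an invariant connection is the invariant curvature. -/
theorem coeff_curvature (Γ : LieAlg E G →ₗ[ℝ] LieAlg E G →ₗ[ℝ] LieAlg E G)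
    {X Y Z : (x : G) → Tan E x} (hX : SmoothField X) (hY : SmoothField Y) (hZ : SmoothField Z)
    (x : G) : curvature (invariantConnection Γ) X Y Z x
      = leftEquiv (E := E) x (invariantCurvature Γ (coeff (E := E) X x) (coeff (E := E) Y x)
        (coeff (E := E) Z x)) := by
  have hmd : ∀ {f : G → E}, ContMDiff 𝓘(ℝ, E) 𝓘(ℝ, E) ∞ f → ∀ y,
      MDifferentiableAt 𝓘(ℝ, E) 𝓘(ℝ, E) f y := fun hf y => hf.mdifferentiableAt (by simp)
  have hcov : ∀ {Y : (x : G) → Tan E x}, SmoothField Y → ∀ X : (x : G) → Tan E x,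
      coeff (fun y ↦ invariantConnection Γ (fun z ↦ invariantConnection Γ Z z (Y z)) y (X y)) x
        = mvfderiv 𝓘(ℝ, E) (fun y ↦ mvfderiv 𝓘(ℝ, E) (coeff Z) y (Y y)) x (X x)
          + (toModel Γ (mvfderiv 𝓘(ℝ, E) (coeff Y) x (X x)) (coeff Z x)
            + toModel Γ (coeff Y x) (mvfderiv 𝓘(ℝ, E) (coeff Z) x (X x)))
          + toModel Γ (coeff X x) (mvfderiv 𝓘(ℝ, E) (coeff Z) x (Y x)
            + toModel Γ (coeff Y x) (coeff Z x)) := by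
    intro Y hY X
    have h1 : coeff (fun z ↦ invariantConnection Γ Z z (Y z)) = fun z ↦
        mvfderiv 𝓘(ℝ, E) (coeff Z) z (Y z) + toModel Γ (coeff Y z) (coeff Z z) :=
      funext fun z => coeff_invariantConnection Γ Y Z z
    have h2 : ContMDiff 𝓘(ℝ, E) 𝓘(ℝ, E) ∞ (fun z ↦ toModel Γ (coeff Y z) (coeff Z z)) :=
      (contMDiff_const.clm_apply hY.contMDiff_coeff).clm_apply hZ.contMDiff_coeff
    rw [coeff_invariantConnection, h1,
      mvfderiv_fun_add (hmd (contMDiff_mvfderiv hZ.contMDiff_coeff hY) x) (hmd h2 x),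
      add_apply, mvfderiv_bilinear (toModel Γ) (hY.mdifferentiableAt_coeff x)
        (hZ.mdifferentiableAt_coeff x)]
  have hbr : coeff (fun y ↦ invariantConnection Γ Z y (mlieBracket 𝓘(ℝ, E) X Y y)) x
      = mvfderiv 𝓘(ℝ, E) (coeff Z) x (mlieBracket 𝓘(ℝ, E) X Y x)
        + toModel Γ (coeff (mlieBracket 𝓘(ℝ, E) X Y) x) (coeff Z x) :=
    coeff_invariantConnection Γ _ Z x
  rw [mvfderiv_mlieBracket hZ.contMDiff_coeff hX hY, coeff_mlieBracket hX hY] at hbr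
  have hR : coeff (curvature (invariantConnection Γ) X Y Z) x
      = coeff (fun y ↦ invariantConnection Γ (fun z ↦ invariantConnection Γ Z z (Y z)) y (X y)) x
        - coeff (fun y ↦ invariantConnection Γ (fun z ↦ invariantConnection Γ Z z (X z)) y (Y y)) x
        - coeff (fun y ↦ invariantConnection Γ Z y (mlieBracket 𝓘(ℝ, E) X Y y)) x :=
    ((leftEquiv x).symm.map_sub _ _).trans
      (congrArg (· - _) ((leftEquiv x).symm.map_sub _ _))
  have hR' : coeff (curvature (invariantConnection Γ) X Y Z) x
      = toModel Γ (coeff X x) (toModel Γ (coeff Y x) (coeff Z x))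
        - toModel Γ (coeff Y x) (toModel Γ (coeff X x) (coeff Z x))
        - toModel Γ (toModel (lieForm E G) (coeff X x) (coeff Y x)) (coeff Z x) := by
    rw [hR, hcov hY X, hcov hX Y, hbr]
    simp only [map_add, map_sub, add_apply, sub_apply]
    abel
  rw [← leftEquiv_coeff (curvature (invariantConnection Γ) X Y Z) x, hR']
  rfl

end HermitianGeometry

end

/-! ### From the normal form back to the group -/

section

namespace HermitianGeometry

variable {E : Type*} [NormedAddCommGroup E] [NormedSpace ℝ E]
  {G : Type*} [TopologicalSpace G] [ChartedSpace E G] [Group G] [LieGroup 𝓘(ℝ, E) ∞ G]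
  {g : Metric E G} {J : EndField E G}

/-- The inner product of the Lie algebra as a continuous bilinear form on the model space. -/
def innerModel (g : Metric E G) : E →L[ℝ] E →L[ℝ] ℝ := g.inner 1

/-- The complex structure of the Lie algebra as an endomorphism of the model space. -/
def endModel (J : EndField E G) : E →L[ℝ] E := J 1

lemma inner_eq_leftLog (hginv : IsLeftInvariantMetric g) (x : G) (v w : Tan E x) :
    g.inner x v w = innerModel g (leftLog x v) (leftLog x w) := by
  obtain ⟨v, rfl⟩ := (leftEquiv x).surjective v
  obtain ⟨w, rfl⟩ := (leftEquiv x).surjective w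
  refine (hginv.inner_leftEquiv x v w).trans ?_
  exact (congrArg₂ (fun a b : E => innerModel g a b) ((leftEquiv x).symm_apply_apply v)
    ((leftEquiv x).symm_apply_apply w)).symm

lemma leftLog_J (hJinv : IsLeftInvariantEndField J) (x : G) (v : Tan E x) :
    leftLog x (J x v) = endModel J (leftLog x v) := by
  obtain ⟨v, rfl⟩ := (leftEquiv x).surjective v
  refine (congrArg (leftLog x) (hJinv.apply_leftEquiv x v)).trans ?_
  refine ((leftEquiv x).symm_apply_apply _).trans ?_
  exact (congrArg (fun a : E => endModel J a) ((leftEquiv x).symm_apply_apply v)).symm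

lemma coeff_J (hJinv : IsLeftInvariantEndField J) (Y : (x : G) → Tan E x) :
    coeff (fun y ↦ J y (Y y)) = fun x ↦ endModel J (coeff Y x) :=
  funext fun x => leftLog_J hJinv x (Y x)

lemma mvfderiv_inner (hginv : IsLeftInvariantMetric g)
    {Y Z : (x : G) → Tan E x} (hY : SmoothField Y)
    (hZ : SmoothField Z) (x : G) (v : Tan E x) :
    mvfderiv 𝓘(ℝ, E) (fun y ↦ g.inner y (Y y) (Z y)) x v
      = innerModel g (mvfderiv 𝓘(ℝ, E) (coeff Y) x v) (coeff Z x)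
        + innerModel g (coeff Y x) (mvfderiv 𝓘(ℝ, E) (coeff Z) x v) := by
  have h : (fun y ↦ g.inner y (Y y) (Z y)) = fun y ↦ innerModel g (coeff Y y) (coeff Z y) :=
    funext fun y => inner_eq_leftLog hginv y (Y y) (Z y)
  rw [h]
  exact mvfderiv_bilinear _ (hY.mdifferentiableAt_coeff x) (hZ.mdifferentiableAt_coeff x) v

variable [FiniteDimensional ℝ E] [CompleteSpace E]

theorem isStrominger_invariantConnection (hJinv : IsLeftInvariantEndField J)
    (hginv : IsLeftInvariantMetric g)
    {Γ : LieAlg E G →ₗ[ℝ] LieAlg E G →ₗ[ℝ] LieAlg E G}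
    (hΓ : IsStromingerForm (metricForm g) (endForm J) Γ) :
    IsStrominger g J (invariantConnection Γ) where
  metric Y Z hY hZ x v := by
    have hskew : ∀ u v w : E, innerModel g (toModel Γ u v) w = -innerModel g v (toModel Γ u w) :=
      hΓ.skew
    rw [mvfderiv_inner hginv hY hZ, inner_eq_leftLog hginv, inner_eq_leftLog hginv,
      leftLog_invariantConnection, leftLog_invariantConnection, map_add, map_add, add_apply, hskew]
    change _ = innerModel g _ (coeff Z x) + -innerModel g (coeff Y x) (toModel Γ _ (coeff Z x))
      + (innerModel g (coeff Y x) _ + innerModel g (coeff Y x) (toModel Γ _ (coeff Z x)))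
    abel
  parallel Y hY x v := by
    have hcomm : ∀ u v : E, toModel Γ u (endModel J v) = endModel J (toModel Γ u v) := hΓ.comm
    apply (leftEquiv x).symm.injective
    change leftLog (E := E) x _ = leftLog (E := E) x _
    rw [leftLog_J hJinv, leftLog_invariantConnection, leftLog_invariantConnection, coeff_J hJinv,
      mvfderiv_clm _ (hY.mdifferentiableAt_coeff x), hcomm, map_add]
  torsion_skew x u v w := by
    obtain ⟨u, rfl⟩ := (leftEquiv x).surjective u
    obtain ⟨v, rfl⟩ := (leftEquiv x).surjective v
    obtain ⟨w, rfl⟩ := (leftEquiv x).surjective w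
    rw [torsion_invariantConnection, torsion_invariantConnection, hginv.inner_leftEquiv,
      hginv.inner_leftEquiv]
    exact hΓ.torsion_skew u v w

theorem isKahlerLike_invariantConnection (hJ : IsComplexStructure J)
    (hJinv : IsLeftInvariantEndField J) (hg : IsHermitianMetric g J)
    {Γ : LieAlg E G →ₗ[ℝ] LieAlg E G →ₗ[ℝ] LieAlg E G}
    (hΓ : IsStromingerForm (metricForm g) (endForm J) Γ)
    (hR : ∀ u v w, invariantCurvature Γ u v w + invariantCurvature Γ v w u
      + invariantCurvature Γ w u v = 0) :
    IsKahlerLike g J (invariantConnection Γ) where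
  bianchi X Y Z hX hY hZ x := by
    rw [coeff_curvature Γ hX hY hZ, coeff_curvature Γ hY hZ hX, coeff_curvature Γ hZ hX hY,
      ← map_add, ← map_add]
    exact (congrArg (leftEquiv x) (hR _ _ _)).trans (map_zero _)
  type_condition X Y Z W hX hY hZ hW x := by
    have hJR : ∀ u v w : LieAlg E G, invariantCurvature Γ u v (endForm J w)
        = endForm J (invariantCurvature Γ u v w) := fun u v w => by
      simp only [invariantCurvature, hΓ.comm, map_sub]
    have hc : invariantCurvature Γ (coeff (E := E) X x) (coeff (E := E) Y x)
        (coeff (E := E) (fun y ↦ J y (Z y)) x)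
        = endForm J (invariantCurvature Γ (coeff (E := E) X x) (coeff (E := E) Y x)
          (coeff (E := E) Z x)) :=
      (congrArg _ (congrFun (coeff_J hJinv Z) x)).trans (hJR _ _ _)
    rw [coeff_curvature Γ hX hY (hJ.smooth Z hZ), coeff_curvature Γ hX hY hZ, hc, endForm_apply,
      ← hJinv.apply_leftEquiv, hg]

theorem HasNormalForm.isStromingerKahlerLike {n r s : ℕ} (h : HasNormalForm g J n r s)
    (hJ : IsComplexStructure J) (hJinv : IsLeftInvariantEndField J)
    (hg : IsHermitianMetric g J) (hginv : IsLeftInvariantMetric g) :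
    IsStromingerKahlerLike g J := by
  obtain ⟨F⟩ := ((hasNormalForm_iff g J n r s).1 h).nonempty
  have hΓ := F.isStromingerForm (isHermitianPair hJ hg)
  exact ⟨invariantConnection F.connection, isStrominger_invariantConnection hJinv hginv hΓ,
    isKahlerLike_invariantConnection hJ hJinv hg hΓ F.invariantCurvature_cyclic⟩

theorem IsKahler.fundamentalForm_lie (h : IsKahler g J) (hJinv : IsLeftInvariantEndField J)
    (hginv : IsLeftInvariantMetric g) (u v w : LieAlg E G) :
    metricForm g (endForm J ⁅u, v⁆) w + metricForm g (endForm J ⁅v, w⁆) u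
      + metricForm g (endForm J ⁅w, u⁆) v = 0 := by
  have h := h _ _ _ (contMDiff_leftEquiv u) (contMDiff_leftEquiv v) (contMDiff_leftEquiv w) 1
  have hω : ∀ v w : LieAlg E G, fundamentalForm g J (fun y : G ↦ leftEquiv y v)
      (fun y : G ↦ leftEquiv y w) = fun _ ↦ metricForm g (endForm J v) w := fun v w => by
    funext y
    unfold fundamentalForm
    rw [hJinv.apply_leftEquiv, hginv.inner_leftEquiv]
    rfl
  have hωl : ∀ u v w : LieAlg E G, fundamentalForm g J
      (mlieBracket 𝓘(ℝ, E) (fun y : G ↦ leftEquiv y u) (fun y : G ↦ leftEquiv y v))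
      (fun y : G ↦ leftEquiv y w) 1 = metricForm g (endForm J ⁅u, v⁆) w := fun u v w => by
    unfold fundamentalForm
    rw [mlieBracket_leftEquiv, hJinv.apply_leftEquiv, hginv.inner_leftEquiv]
    rfl
  rw [hω, hω, hω, hωl, hωl, hωl] at h
  simp only [mvfderiv_const, zero_apply] at h
  linarith

/-- For vanishing brackets the left trivialization behaves like a flat one: `ω` has constant
coefficients, and the derivatives of the fields cancel by skewness of `ω`. -/
theorem isKahler_of_abelian (hJ : IsComplexStructure J) (hJinv : IsLeftInvariantEndField J)
    (hg : IsHermitianMetric g J) (hginv : IsLeftInvariantMetric g)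
    (hab : ∀ u v : LieAlg E G, ⁅u, v⁆ = 0) : IsKahler g J := by
  intro X Y Z hX hY hZ x
  set B := innerModel g
  set K := endModel J
  have hH := isHermitianPair hJ hg
  have hskew : ∀ v w : E, B (K v) w = -B (K w) v := fun v w => by
    have h1 : B (K v) w = -B v (K w) := hH.apply_J_left v w
    have h2 : B v (K w) = B (K w) v := hH.symm v (K w)
    rw [h1, h2]
  have hω : ∀ {Y Z : (x : G) → Tan E x}, fundamentalForm g J Y Z x
      = B (K (coeff Y x)) (coeff Z x) := fun {Y Z} => by
    refine (inner_eq_leftLog hginv x (J x (Y x)) (Z x)).trans ?_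
    rw [leftLog_J hJinv]
    rfl
  have hdω : ∀ {Y Z : (x : G) → Tan E x}, SmoothField Y → SmoothField Z → ∀ v : Tan E x,
      mvfderiv 𝓘(ℝ, E) (fundamentalForm g J Y Z) x v
        = B (K (mvfderiv 𝓘(ℝ, E) (coeff Y) x v)) (coeff Z x)
          + B (K (coeff Y x)) (mvfderiv 𝓘(ℝ, E) (coeff Z) x v) := by
    intro Y Z hY hZ v
    have h1 := mvfderiv_inner hginv (hJ.smooth Y hY) hZ x v
    rw [coeff_J hJinv, mvfderiv_clm (endModel J) (hY.mdifferentiableAt_coeff x)] at h1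
    exact h1
  have hbr : ∀ {X Y : (x : G) → Tan E x}, SmoothField X → SmoothField Y →
      coeff (mlieBracket 𝓘(ℝ, E) X Y) x
        = mvfderiv 𝓘(ℝ, E) (coeff Y) x (X x) - mvfderiv 𝓘(ℝ, E) (coeff X) x (Y x) := by
    intro X Y hX hY
    rw [coeff_mlieBracket hX hY]
    have h0 : toModel (lieForm E G) (coeff X x) (coeff Y x) = (0 : E) :=
      hab (coeff (E := E) X x) (coeff (E := E) Y x)
    rw [h0, add_zero]
  rw [hdω hY hZ, hdω hZ hX, hdω hX hY, hω, hω, hω, hbr hX hY, hbr hY hZ, hbr hZ hX]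
  simp only [map_sub, sub_apply]
  rw [hskew (coeff Y x) (mvfderiv 𝓘(ℝ, E) (coeff Z) x (X x)),
    hskew (coeff Z x) (mvfderiv 𝓘(ℝ, E) (coeff X) x (Y x)),
    hskew (coeff X x) (mvfderiv 𝓘(ℝ, E) (coeff Y) x (Z x))]
  ring

end HermitianGeometry

end

end

theorem theorem1p1 {E : Type*} [NormedAddCommGroup E] [NormedSpace ℝ E] [FiniteDimensional ℝ E]
    [CompleteSpace E]
    {G : Type*} [TopologicalSpace G] [ChartedSpace E G] [Group G] [LieGroup 𝓘(ℝ, E) ∞ G]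
    (n : ℕ) (hn : Module.finrank ℝ E = 2 * n)
    (g : HermitianGeometry.Metric E G) (J : HermitianGeometry.EndField E G)
    (hJ : HermitianGeometry.IsComplexStructure J)
    (hJinv : HermitianGeometry.IsLeftInvariantEndField J)
    (hg : HermitianGeometry.IsHermitianMetric g J)
    (hginv : HermitianGeometry.IsLeftInvariantMetric g)
    (hnil : HermitianGeometry.IsNilpotentLieGroup E G) :
    (HermitianGeometry.IsStromingerKahlerLike g J ↔
      ∃ r s : ℕ, HermitianGeometry.HasNormalForm g J n r s) ∧
    ∀ r s : ℕ, HermitianGeometry.HasNormalForm g J n r s →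
      n - r ≤ s ∧ s ≤ min r (2 * (n - r)) ∧
      (∀ x y z : HermitianGeometry.LieAlg E G, ⁅x, ⁅y, z⁆⁆ = 0) ∧
      HermitianGeometry.IsAbelianComplexStructure J ∧
      (HermitianGeometry.IsKahler g J ↔ s = 0 ∧ r = n) := by
  refine ⟨⟨fun h => h.exists_hasNormalForm hJ hJinv hg hginv hnil hn,
    fun ⟨r, s, h⟩ => h.isStromingerKahlerLike hJ hJinv hg hginv⟩, fun r s h => ?_⟩
  have : LieRing.IsNilpotent (HermitianGeometry.LieAlg E G) := hnil
  have : FiniteDimensional ℝ (HermitianGeometry.LieAlg E G) :=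
    inferInstanceAs (FiniteDimensional ℝ E)
  have hH := HermitianGeometry.isHermitianPair hJ hg
  obtain ⟨F⟩ := ((HermitianGeometry.hasNormalForm_iff g J n r s).1 h).nonempty
  refine ⟨F.sub_le_s, le_min (F.s_le_r hH) F.s_le_two_mul, F.lie_lie_eq_zero, F.lie_J_J hH,
    fun hK => ?_, ?_⟩
  · have hs : s = 0 := by
      by_contra hs
      obtain ⟨x, y, z, hxyz⟩ := F.exists_fundamental_ne_zero hH hs
      exact hxyz (hK.fundamentalForm_lie hJinv hginv x y z)
    -- With `s = 0`, the bound `n - r ≤ s` and `r ≤ n` force `r = n`.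
    have h1 := F.sub_le_s
    have h2 := F.r_le
    omega
  · rintro ⟨rfl, -⟩
    exact HermitianGeometry.isKahler_of_abelian hJ hJinv hg hginv F.lie_eq_zero_of_s_eq_zero
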